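/- **Conventions.** For $r\in\mathbb R^3$ write $\rho(r)=\tfrac12(\mathbf 1+r\cdot\vec\sigma)$ with $\vec\sigma=(X,Y,Z)$ the Pauli matrices. A qubit basis is an orthonormal basis of $\mathbb C^2$ regarded as the set of its two pure states; it has the form $\{\rho(r),\rho(-r)\}$ for a unit vector $r$ and is denoted by its Bloch vector $\pm r$. A quasiprobability representation of the qubit over a measure space $\Lambda$ consists of Hermitian operators $F(\lambda),G(\lambda)$ such that $\mu_\rho(\lambda)=\operatorname{tr}(\rho F(\lambda))$ and $\xi_E(\lambda)=\operatorname{tr}(EG(\lambda))$ satisfy $\int_\Lambda\mu_\rho=1$ for all states $\rho$, $\sum_j\xi_{E_j}(\lambda)=1$ for all $\lambda$ and all POVMs $\{E_j\}$, and $\operatorname{tr}(\rho E)=\int_\Lambda\mu_\rho\,\xi_E$ for all states $\rho$ and effects $E$. A set $B$ of bases is *non-negative* in it if $\mu_P(\lambda)\ge 0$ and $\xi_P(\lambda)\in[0,1]$ for all $\lambda$ and all states $P$ of all bases in $B$. The symmetry group of $B$ is the group of all unitaries $U\in U(2)$ whose conjugation action permutes the bases in $B$; its quotient by the phases is the point group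 of $B$. Below, "generated by" means generated together with the phases; $R_z(t)$ is the rotation by $t$ about the $z$-axis, $H$ the Hadamard gate, $P=\operatorname{diag}(1,i)$. **Theorem.** A nonempty set of qubit bases is non-negative in some quasiprobability representation and is permuted by a unitary group that does not consist of multiples of the identity only if and only if it is unitarily equivalent to one of the following sets: 1. one basis $\pm(0,0,1)$; 2. two bases $\pm(\sin\theta,0,\cos\theta)$, $\pm(-\sin\theta,0,\cos\theta)$ with $\theta\in(0,\frac\pi2)$; 3. three bases $\pm(\sin\theta,0,\cos\theta)$, $\pm(-\frac12\sin\theta,\pm'\frac{\sqrt3}2\sin\theta,\cos\theta)$ (one basis for each value of the sign $\pm'$) with $\theta\in(0,\pi)$ and $\sin^2\theta\le\frac89$; 4. three bases $\pm(\sin\theta,0,\cos\theta)$, $\pm(-\sin\theta,0,\cos\theta)$, $\pm(\cos\phi,\sin\phi,0)$ with $\theta\in(0,\frac\pi2)$, $\phi\in(0,\pi)$ and $|\cos\phi|\le\sin\theta$; 5. four bases, whose Bloch vectors are the vertices $(\pm\cos\phi\sin\theta,\pm\sin\phi\sin\theta,\pm\cos\theta)$ of a right cuboid, with $\theta,\phi\in(0,\frac\pi2)$.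 For $\theta\in(0,\pi)$ the three bases in 3 are distinct and are non-negative in some quasiprobability representation if and only if $\sin^2\theta\le\frac89$; for $\theta\in(0,\frac\pi2)$, $\phi\in(0,\pi)$ the three bases in 4 are distinct and are non-negative in some quasiprobability representation if and only if $|\cos\phi|\le\sin\theta$. The bases in 1, 2 and 5 are distinct, one, two and four in number. *Symmetry.* - In 1 the symmetry group is generated by the $R_z(t)$, $t\in\mathbb R$, and $X$; the point group is $D_\infty\cong O(2)$. - In 2 it is generated by $X,Z$, with point group $D_2$, if $\theta\ne\frac\pi4$, and by $X,Y^{1/2}$, with point group $D_4$, if $\theta=\frac\pi4$. - In 3, for $\theta\ne\frac\pi2$, it is generated by $R_z(\frac{2\pi}3)$ and $Y$, with point group $D_3$, if $\sin^2\theta\ne\frac23$. The bases are unitarily equivalent to the stabilizer bases $\pm(1,0,0),\pm(0,1,0),\pm(0,0,1)$ if and only if $\sin^2\theta=\frac23$. - In 4 (for all $\theta\in(0,\frac\pi2)$, $\phi\in(0,\pi)$), for $\phi\ne\frac\pi2$, it is generated by $Z$, with point group $\mathbb Z_2$, if $|\cos2\theta|\ne\sin\theta|\cos\phi|$; if $|\cos2\theta|=\sin\theta|\cos\phi|$,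 it contains $Z$ and the point group is $D_3$. For $\phi=\frac\pi2$, $\theta\ne\frac\pi4$, it is generated by $X,Z$, with point group $D_2$. The bases are unitarily equivalent to the stabilizer bases if and only if $\theta=\frac\pi4$ and $\phi=\frac\pi2$. - The symmetry group of the stabilizer bases is the Clifford group, generated by $H$ and $P$; the point group is the octahedral rotation group ($\cong S_4$). - In 5 the symmetry group contains $X,Z$. If the three edge lengths of the cuboid are distinct, it is the Pauli group generated by $X,Z$, with point group $D_2$; if exactly two of them agree, the point group is $D_4$; if $\phi=\frac\pi4$ and $\cos\theta\neq\frac1{\sqrt3}$, the symmetry group is generated by $X,P$; for the cube, $\phi=\frac\pi4$ and $\cos\theta=\frac1{\sqrt3}$, it is generated by $H,P$ with octahedral point group. *Explicit representations.* The following weights $q(a)\ge0$ and vectors $d(a)\in\mathbb R^3$ define, over the finite set of points $(\epsilon,a)$, $\epsilon=\pm$, with counting measure, a quasiprobability representation $F(\epsilon,a)=\frac{q(a)}2(\mathbf 1+\epsilon\, d(a)\cdot\vec\sigma)$, $G(\epsilon,a)=\frac12(\mathbf 1+\epsilon\, d(a)\cdot\vec\sigma)$ in which the stated bases are non-negative.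 - Stabilizer bases, and the basis in 1: $q(a)=\frac14$ for $a=0,\dots,3$; $d=(1,1,1),(1,-1,-1),(-1,1,-1),(-1,-1,1)$. - In 3 with $\sin^2\theta\le\frac89$: $q(0)=1-\frac98\sin^2\theta$, $q(1)=q(2)=q(3)=\frac38\sin^2\theta$; $d(0)=(0,0,\sec\theta)$, $d(1)=(\frac43\csc\theta,0,-\frac13\sec\theta)$, $d(2),d(3)=(-\frac23\csc\theta,\pm\frac2{\sqrt3}\csc\theta,-\frac13\sec\theta)$. For $\sin^2\theta=\frac23$ all weights are $\frac14$. - In 4 with $|\cos\phi|\le\sin\theta$: $q(0)=q(3)=\frac12\cos^2\theta$, $q(1)=\frac12\sin\theta(\sin\theta-\cos\phi)$, $q(2)=\frac12\sin\theta(\sin\theta+\cos\phi)$; $d(0)=(0,\csc\phi,\sec\theta)$, $d(3)=(0,\csc\phi,-\sec\theta)$, $d(1)=(\csc\theta,-\csc\phi-\cot\phi\csc\theta,0)$, $d(2)=(-\csc\theta,-\csc\phi+\cot\phi\csc\theta,0)$. With $\phi=\frac\pi2$ this also represents the bases in 2. For $\theta=\frac\pi4,\phi=\frac\pi2$ all weights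 are $\frac14$. - In 5: $q(a)=c_a^2$, $d(a)=e_a/c_a$ for $a=1,2,3$, with $c=(\cos\phi\sin\theta,\sin\phi\sin\theta,\cos\theta)$ and $e_a$ the canonical basis vectors. -/

import Mathlib

open MeasureTheory

universe u

noncomputable section

namespace Qubit

open scoped ComplexOrder

/-- Operators on the qubit Hilbert space. -/
abbrev Op : Type := Matrix (Fin 2) (Fin 2) ℂ

/-! ### States, effects, quasiprobability representations -/

/-- Density operators. -/
def IsState (ρ : Op) : Prop := ρ.PosSemidef ∧ ρ.trace = 1

/-- Effects: elements of a POVM. -/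
def IsEffect (E : Op) : Prop := E.PosSemidef ∧ (1 - E).PosSemidef

/-- POVMs with `n` outcomes. -/
def IsPOVM {n : ℕ} (E : Fin n → Op) : Prop :=
  (∀ j, (E j).PosSemidef) ∧ ∑ j, E j = 1

/-- The quasiprobability distribution `μ_ρ(l) = tr(ρ F(l))` of a state (a real number, since
`ρ` and `F l` are Hermitian where this is used). -/
def mu {Λ : Type*} (F : Λ → Op) (ρ : Op) (l : Λ) : ℝ := (ρ * F l).trace.re

/-- The conditional quasiprobability `ξ_E(l) = tr(E G(l))` of an effect. -/
def xi {Λ : Type*} (G : Λ → Op) (E : Op) (l : Λ) : ℝ := (E * G l).trace.re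

/-- `F` and `G` define a quasiprobability representation of the qubit over the measure space
`(Λ, ν)`. As states and effects both span the real space of Hermitian operators, the Born rule for
all states and effects is the same, by linearity, as `∫ tr(A F(l)) tr(B G(l)) dν(l) = tr(A B)` for all
Hermitian `A`, `B`, i.e. as the reconstruction formula `A = ∫ tr(A F(l)) G(l) dν(l)`, which says
that the two families of operators are dual frames; in particular `ρ ↦ μ_ρ` is injective. -/
structure IsQuasiprobRep {Λ : Type*} [MeasurableSpace Λ] (ν : Measure Λ) (F G : Λ → Op) :
    Prop where
  hermitian_F : ∀ l, (F l).IsHermitian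
  hermitian_G : ∀ l, (G l).IsHermitian
  measurable_xi : ∀ E, IsEffect E → AEStronglyMeasurable (xi G E) ν
  integrable_mu : ∀ ρ, IsState ρ → Integrable (mu F ρ) ν
  normalized : ∀ ρ, IsState ρ → ∫ l, mu F ρ l ∂ν = 1
  complete : ∀ (n : ℕ) (E : Fin n → Op), IsPOVM E → ∀ l, ∑ j, xi G (E j) l = 1
  integrable_born : ∀ ρ E, IsState ρ → IsEffect E → Integrable (fun l => mu F ρ l * xi G E l) ν
  born : ∀ ρ E, IsState ρ → IsEffect E → ∫ l, mu F ρ l * xi G E l ∂ν = (ρ * E).trace.re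

/-! ### Bases and non-negativity -/

/-- An orthonormal basis of the qubit, as the set `{|v₀⟩⟨v₀|, |v₁⟩⟨v₁|}` of its pure states (so the
order and the phases of the basis vectors play no role). -/
def IsBasis (b : Set Op) : Prop :=
  ∃ v : OrthonormalBasis (Fin 2) ℂ (EuclideanSpace ℂ (Fin 2)),
    b = Set.range fun j => Matrix.vecMulVec (v j).ofLp (star (v j).ofLp)

/-- The basis `b` is non-negative, both as a set of states and as a measurement. -/
def NonnegBasis {Λ : Type*} (F G : Λ → Op) (b : Set Op) : Prop :=
  ∀ P ∈ b, ∀ l, 0 ≤ mu F P l ∧ xi G P l ∈ Set.Icc (0 : ℝ) 1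

/-- All bases in `B` are non-negative in one and the same quasiprobability representation. -/
def IsNonneg (B : Set (Set Op)) : Prop :=
  ∃ (Λ : Type u) (_ : MeasurableSpace Λ) (ν : Measure Λ) (F G : Λ → Op),
    IsQuasiprobRep ν F G ∧ ∀ b ∈ B, NonnegBasis F G b

/-! ### Unitary transformations -/

/-- The unitary group of the qubit. -/
abbrev U2 : Type := Matrix.unitaryGroup (Fin 2) ℂ

/-- The unitary transformation `P ↦ U P U†`. -/
def conj (U : U2) (P : Op) : Op := (U : Op) * P * star (U : Op)

/-- The action of a unitary on sets of bases. -/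
def move (U : U2) (B : Set (Set Op)) : Set (Set Op) := (fun b => conj U '' b) '' B

lemma conj_one : conj 1 = id := by
  funext P; simp [conj]

lemma conj_mul (U V : U2) : conj (U * V) = conj U ∘ conj V := by
  funext P; simp [conj, Matrix.mul_assoc]

lemma move_one (B : Set (Set Op)) : move 1 B = B := by
  simp [move, conj_one]

lemma move_mul (U V : U2) (B : Set (Set Op)) : move (U * V) B = move U (move V B) := by
  simp only [move, conj_mul, Set.image_image, Set.image_comp]

/-- The unitaries that permute the bases in `B`. -/
def symmetryGroup (B : Set (Set Op)) : Subgroup U2 where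
  carrier := {U | move U B = B}
  one_mem' := move_one B
  mul_mem' := by
    intro U V hU hV
    simp only [Set.mem_ofPred_eq] at *
    rw [move_mul, hV, hU]
  inv_mem' := by
    intro U hU
    simp only [Set.mem_ofPred_eq] at *
    conv_lhs => rw [← hU]
    rw [← move_mul, inv_mul_cancel, move_one]

/-- The phase multiples of the identity. -/
def phases : Subgroup U2 where
  carrier := {U | ∃ z : ℂ, (U : Op) = z • (1 : Op)}
  one_mem' := ⟨1, by simp⟩
  mul_mem' := by
    rintro U V ⟨z, hz⟩ ⟨w, hw⟩
    exact ⟨z * w, by simp [hz, hw, smul_smul, mul_comm]⟩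
  inv_mem' := by
    rintro U ⟨z, hz⟩
    refine ⟨star z, ?_⟩
    rw [← Unitary.star_eq_inv, Unitary.coe_star, hz]
    simp

instance phases_normal : phases.Normal where
  conj_mem := by
    rintro U ⟨z, hz⟩ V
    refine ⟨z, ?_⟩
    have h : (V : Op) * ((V⁻¹ : U2) : Op) = 1 := by
      rw [← Submonoid.coe_mul, mul_inv_cancel, Submonoid.coe_one]
    simp only [Submonoid.coe_mul, hz, Matrix.mul_smul, Matrix.mul_one, Matrix.smul_mul, h]

/-- The point group of a set of bases: the unitaries that permute the bases, modulo phases. -/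
def pointGroup (B : Set (Set Op)) : Subgroup (U2 ⧸ phases) :=
  (symmetryGroup B).map (QuotientGroup.mk' phases)

/-- The bases in `B` are permuted by a nontrivial unitary group, i.e. one that does not consist of
phase multiples of the identity only. -/
def HasNontrivialSymmetry (B : Set (Set Op)) : Prop :=
  ∃ H : Subgroup U2, (∀ U ∈ H, move U B = B) ∧ ∃ U ∈ H, U ∉ phases

/-- Unitary equivalence of sets of bases. -/
def UnitaryEquiv (B C : Set (Set Op)) : Prop := ∃ U : U2, move U B = C

/-- The group generated by a set of unitary matrices together with all phases. -/
def generated (S : Set Op) : Subgroup U2 :=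
  Subgroup.closure {U | (U : Op) ∈ S} ⊔ phases

/-! ### Unitary matrices -/

def X : Op := !![0, 1; 1, 0]

def Y : Op := !![0, -Complex.I; Complex.I, 0]

def Z : Op := !![1, 0; 0, -1]

/-- The Hadamard gate. -/
def hadamard : Op := !![(1 / √2 : ℝ), (1 / √2 : ℝ); (1 / √2 : ℝ), (-(1 / √2) : ℝ)]

/-- The phase gate. -/
def phaseGate : Op := !![1, 0; 0, Complex.I]

/-- The gate `Y^{1/2}`, up to a phase: a rotation by `π/2` about the `y`-axis. -/
def sqrtY : Op := !![(1 / √2 : ℝ), (-(1 / √2) : ℝ); (1 / √2 : ℝ), (1 / √2 : ℝ)]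

/-- The rotation by `t` about the `z`-axis, up to a phase. -/
def rotZ (t : ℝ) : Op := !![1, 0; 0, Complex.exp (t * Complex.I)]

/-! ### Bloch vectors and the families of bases -/

/-- The operator `(1 + r · σ) / 2`. -/
def blochOp (r : Fin 3 → ℝ) : Op :=
  (1 / 2 : ℂ) • (1 + (r 0 : ℂ) • X + (r 1 : ℂ) • Y + (r 2 : ℂ) • Z)

/-- The basis with Bloch vectors `± r`, for a unit vector `r`. -/
def blochBasis (r : Fin 3 → ℝ) : Set Op := {blochOp r, blochOp (-r)}

/-- The computational basis. -/
def oneBasis : Set (Set Op) := {blochBasis ![0, 0, 1]}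

def twoBases (θ : ℝ) : Set (Set Op) :=
  {blochBasis ![Real.sin θ, 0, Real.cos θ], blochBasis ![-Real.sin θ, 0, Real.cos θ]}

def threeBasesD3 (θ : ℝ) : Set (Set Op) :=
  {blochBasis ![Real.sin θ, 0, Real.cos θ],
   blochBasis ![-(1 / 2) * Real.sin θ, √3 / 2 * Real.sin θ, Real.cos θ],
   blochBasis ![-(1 / 2) * Real.sin θ, -(√3 / 2) * Real.sin θ, Real.cos θ]}

def threeBasesZ2 (θ φ : ℝ) : Set (Set Op) :=
  {blochBasis ![Real.sin θ, 0, Real.cos θ],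
   blochBasis ![-Real.sin θ, 0, Real.cos θ],
   blochBasis ![Real.cos φ, Real.sin φ, 0]}

/-- The vertex in the positive octant of the cuboid. -/
def cuboidVec (θ φ : ℝ) : Fin 3 → ℝ :=
  ![Real.cos φ * Real.sin θ, Real.sin φ * Real.sin θ, Real.cos θ]

/-- The bases whose Bloch vectors are the vertices of a right cuboid. -/
def cuboidBases (θ φ : ℝ) : Set (Set Op) :=
  {b | ∃ s : Fin 3 → ℝ, (∀ i, s i = 1 ∨ s i = -1) ∧ b = blochBasis (s * cuboidVec θ φ)}

/-- The bases of single-qubit stabilizer states. -/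
def stabilizerBases : Set (Set Op) :=
  {blochBasis ![1, 0, 0], blochBasis ![0, 1, 0], blochBasis ![0, 0, 1]}

/-! ### Explicit representations

They are given by weights `q(a)` (the same for `ε = ±`) and vectors `d(a)`, as
`F(ε, a) = q(a) / 2 * (1 + ε d(a) · σ)` and `G(ε, a) = 1 / 2 * (1 + ε d(a) · σ)`. -/

/-- `true` stands for the sign `+`, `false` for the sign `-`. -/
def sgn (ε : Bool) : ℝ := if ε then 1 else -1

def repF {n : ℕ} (q : Fin n → ℝ) (d : Fin n → Fin 3 → ℝ) (l : Bool × Fin n) : Op :=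
  (q l.2 : ℂ) • blochOp (sgn l.1 • d l.2)

def repG {n : ℕ} (d : Fin n → Fin 3 → ℝ) (l : Bool × Fin n) : Op :=
  blochOp (sgn l.1 • d l.2)

/-- The operators given by non-negative weights `q` and vectors `d` define a quasiprobability
representation over the finite set `{+, -} × Fin n` in which the bases in `B` are non-negative. -/
def Represents {n : ℕ} (q : Fin n → ℝ) (d : Fin n → Fin 3 → ℝ) (B : Set (Set Op)) : Prop :=
  (∀ a, 0 ≤ q a) ∧ IsQuasiprobRep Measure.count (repF q d) (repG d) ∧
    ∀ b ∈ B, NonnegBasis (repF q d) (repG d) b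

def weightsD3 (θ : ℝ) : Fin 4 → ℝ :=
  ![1 - 9 / 8 * Real.sin θ ^ 2, 3 / 8 * Real.sin θ ^ 2, 3 / 8 * Real.sin θ ^ 2,
    3 / 8 * Real.sin θ ^ 2]

def vectorsD3 (θ : ℝ) : Fin 4 → Fin 3 → ℝ :=
  ![![0, 0, 1 / Real.cos θ],
    ![4 / (3 * Real.sin θ), 0, -1 / (3 * Real.cos θ)],
    ![-2 / (3 * Real.sin θ), 2 / (√3 * Real.sin θ), -1 / (3 * Real.cos θ)],
    ![-2 / (3 * Real.sin θ), -2 / (√3 * Real.sin θ), -1 / (3 * Real.cos θ)]]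

def weightsZ2 (θ φ : ℝ) : Fin 4 → ℝ :=
  ![Real.cos θ ^ 2 / 2, Real.sin θ / 2 * (Real.sin θ - Real.cos φ),
    Real.sin θ / 2 * (Real.sin θ + Real.cos φ), Real.cos θ ^ 2 / 2]

def vectorsZ2 (θ φ : ℝ) : Fin 4 → Fin 3 → ℝ :=
  ![![0, 1 / Real.sin φ, 1 / Real.cos θ],
    ![1 / Real.sin θ, -1 / Real.sin φ - Real.cos φ / (Real.sin φ * Real.sin θ), 0],
    ![-1 / Real.sin θ, -1 / Real.sin φ + Real.cos φ / (Real.sin φ * Real.sin θ), 0],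
    ![0, 1 / Real.sin φ, -1 / Real.cos θ]]

def weightsCuboid (θ φ : ℝ) : Fin 3 → ℝ := fun a => cuboidVec θ φ a ^ 2

def vectorsCuboid (θ φ : ℝ) : Fin 3 → Fin 3 → ℝ := fun a => Pi.single a (1 / cuboidVec θ φ a)

def weightsStabilizer : Fin 4 → ℝ := fun _ => 1 / 4

def vectorsStabilizer : Fin 4 → Fin 3 → ℝ :=
  ![![1, 1, 1], ![1, -1, -1], ![-1, 1, -1], ![-1, -1, 1]]

end Qubit

end

/-!
A unitary acts on Bloch vectors by a rotation (`rot`), every rotation arises in this way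
(`exists_rot_eq`), and exactly the phases act trivially (`mem_phases_iff`). A basis is an axis
`± r` in the Bloch ball, so everything becomes a question about sets of axes and the rotations that
permute them.

*Non-negativity.* If the basis `± r` is non-negative, then `∫ μ_P (1 - ξ_P) = 1 - tr P² = 0` for its
two states, whose integrands are non-negative. Hence, almost everywhere with respect to the density
`tr F / 2` of total mass one, the function `l ↦ r · g(l)` takes only the values `± 1`, where `g(l)`
is the Bloch vector of `G(l)`. The Born rule says that the correlations of these random signs are
the scalar products of the Bloch vectors. So the probabilities that three signs agree, or agree after
some of the vectors have been replaced by their negatives, are non-negative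
(`IsNonneg.exists_functional`):
`0 ≤ 1 ± r · s ± r · t ± s · t` with an even number of minus signs. This gives the inequalities
for three bases. As the product of the four numbers would be negative for coplanar axes, three
different axes are linearly independent (`IsNonneg.det_ne_zero`). If there is a fourth axis `± v`,
then a sign pattern of positive probability is realized by a vector `g(l)` on which `v`, too, takes
the value `± 1`; comparing the patterns shows that `v` is a signed sum of the three others
(`IsNonneg.eq_signed_sum`). Four unit vectors that sum to zero span the space diagonals of a cuboid,
and a fifth axis does not fit in (`IsNonneg.exists_cuboid`). For three axes, a symmetry that is not
a phase forces two of the scalar products to have the same absolute value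
(`exists_abs_dot_eq_of_symmetry`), and the Gram matrix then determines the parameters `θ`, `φ`.
So the second family of three bases contains all symmetric triples, and the first family
is only needed for its larger symmetry (`exhaustive`).

Conversely, weights and vectors that form a tight frame, with `|d(a) · r| ≤ 1` for all Bloch vectors
`r` of the bases, define a representation in which the bases are non-negative
(`isQuasiprobRep_of_frame`); the conditions are checked for each of the families.

*Symmetry groups.* A unitary is determined up to a phase by the images of two independent Bloch
vectors (`rot_eq_of_two`). The images allowed by the scalar products and the orientation are listed,
and each is realized by a product of the generators. For cuboids, symmetries permute the edge
directions (`symm_cuboid_apply`), which reduces them to symmetries of the coordinate axes.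

*Point groups.* Dihedral groups are recognized by their generators
(`nonempty_closure_mulEquiv_dihedralGroup`); the group `O(2)` is the action on the plane orthogonal
to a single axis (`pointGroup_oneBasis`), and the symmetric group on four letters is the action on
the diagonals of the cube (`pointGroup_cube`).
-/

noncomputable section

namespace Qubit

open scoped ComplexOrder Matrix

/-! ### Bloch vectors and the rotation of a unitary -/

lemma blochOp_eq (r : Fin 3 → ℝ) : blochOp r =
    !![((1 + r 2 : ℝ) / 2 : ℂ), ((r 0 : ℂ) - r 1 * Complex.I) / 2;
      ((r 0 : ℂ) + r 1 * Complex.I) / 2, ((1 - r 2 : ℝ) / 2 : ℂ)] := by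
  ext i j
  fin_cases i <;> fin_cases j <;> simp [blochOp, X, Y, Z] <;> ring

/-- The Bloch vector `Re tr(σ_i A)` of a Hermitian operator `A`. -/
def blochVec (A : Op) : Fin 3 → ℝ :=
  ![(A 0 1).re + (A 1 0).re, (A 1 0).im - (A 0 1).im, (A 0 0).re - (A 1 1).re]

@[simp] lemma blochVec_blochOp (r : Fin 3 → ℝ) : blochVec (blochOp r) = r := by
  rw [blochOp_eq]
  ext i
  fin_cases i <;> simp [blochVec] <;> ring

lemma blochOp_injective : Function.Injective blochOp :=
  Function.LeftInverse.injective blochVec_blochOp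

@[simp] lemma blochOp_inj {r s : Fin 3 → ℝ} : blochOp r = blochOp s ↔ r = s :=
  blochOp_injective.eq_iff

lemma isHermitian_blochOp (r : Fin 3 → ℝ) : (blochOp r).IsHermitian := by
  rw [blochOp_eq]
  ext i j
  fin_cases i <;> fin_cases j <;> simp
  ring

@[simp] lemma trace_blochOp (r : Fin 3 → ℝ) : (blochOp r).trace = 1 := by
  rw [blochOp_eq]
  simp [Matrix.trace_fin_two]
  ring

lemma blochOp_blochVec {A : Op} (hA : A.IsHermitian) (ht : A.trace = 1) :
    blochOp (blochVec A) = A := by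
  have h01 := congrFun (congrFun hA 0) 1
  have h00 := congrFun (congrFun hA 0) 0
  have h11 := congrFun (congrFun hA 1) 1
  simp only [Matrix.conjTranspose_apply, Complex.ext_iff, Complex.star_def, Complex.conj_re,
    Complex.conj_im] at h01 h00 h11
  simp only [Matrix.trace_fin_two, Complex.ext_iff, Complex.add_re, Complex.add_im,
    Complex.one_re, Complex.one_im] at ht
  rw [blochOp_eq]
  ext i j
  fin_cases i <;> fin_cases j <;> apply Complex.ext <;> simp [blochVec] <;> linarith

/-- The trace of a product of two Hermitian operators in Bloch coordinates. -/
lemma trace_mul_re {A B : Op} (hA : A.IsHermitian) (hB : B.IsHermitian) :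
    (A * B).trace.re = (A.trace.re * B.trace.re + blochVec A ⬝ᵥ blochVec B) / 2 := by
  have a01 := congrFun (congrFun hA 0) 1
  have a00 := congrFun (congrFun hA 0) 0
  have a11 := congrFun (congrFun hA 1) 1
  have b01 := congrFun (congrFun hB 0) 1
  have b00 := congrFun (congrFun hB 0) 0
  have b11 := congrFun (congrFun hB 1) 1
  simp only [Matrix.conjTranspose_apply, Complex.ext_iff, Complex.star_def, Complex.conj_re,
    Complex.conj_im] at a01 a00 a11 b01 b00 b11
  have a1 : (A 0 0).im = 0 := by linarith
  have a2 : (A 1 1).im = 0 := by linarith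
  simp only [Matrix.trace_fin_two, Matrix.mul_apply, Fin.sum_univ_two, Complex.add_re,
    Complex.mul_re, blochVec, dotProduct, Fin.sum_univ_three, Matrix.cons_val]
  rw [a1, a2, ← a01.1, ← a01.2, ← b01.1, ← b01.2]
  ring

lemma trace_blochOp_mul (r s : Fin 3 → ℝ) :
    (blochOp r * blochOp s).trace.re = (1 + r ⬝ᵥ s) / 2 := by
  rw [trace_mul_re (isHermitian_blochOp r) (isHermitian_blochOp s)]
  simp

/-- The orientation of a triple of Bloch vectors is an invariant of the operators. -/
lemma trace_blochOp_triple (r s t : Fin 3 → ℝ) :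
    (blochOp r * blochOp s * blochOp t).trace.im = (Matrix.of ![r, s, t]).det / 4 := by
  rw [blochOp_eq, blochOp_eq, blochOp_eq, Matrix.det_fin_three]
  simp [Matrix.trace_fin_two]
  ring

lemma coe_mul_star (U : U2) : (U : Op) * star (U : Op) = 1 :=
  Matrix.mem_unitaryGroup_iff.mp U.2

lemma star_mul_coe (U : U2) : star (U : Op) * (U : Op) = 1 :=
  Matrix.mem_unitaryGroup_iff'.mp U.2

lemma conj_mul_conj (U : U2) (A B : Op) : conj U A * conj U B = conj U (A * B) := by
  simp only [conj]
  calc (U : Op) * A * star (U : Op) * ((U : Op) * B * star (U : Op))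
      = (U : Op) * A * (star (U : Op) * (U : Op)) * B * star (U : Op) := by
        simp only [Matrix.mul_assoc]
    _ = _ := by rw [star_mul_coe]; simp only [Matrix.mul_assoc, Matrix.mul_one]

@[simp] lemma trace_conj (U : U2) (A : Op) : (conj U A).trace = A.trace := by
  rw [conj, Matrix.trace_mul_comm, ← Matrix.mul_assoc, star_mul_coe, Matrix.one_mul]

lemma isHermitian_conj (U : U2) {A : Op} (hA : A.IsHermitian) : (conj U A).IsHermitian :=
  Matrix.isHermitian_mul_mul_conjTranspose _ hA

/-- The Pauli matrices as a family. -/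
def pauli : Fin 3 → Op := ![X, Y, Z]

/-- The rotation of Bloch vectors by which a unitary acts on states. -/
def rot (U : U2) : Matrix (Fin 3) (Fin 3) ℝ :=
  Matrix.of fun i j => blochVec (conj U (pauli j)) i / 2

lemma conj_blochOp (U : U2) (r : Fin 3 → ℝ) : conj U (blochOp r) = blochOp (rot U *ᵥ r) := by
  rw [← blochOp_blochVec (isHermitian_conj U (isHermitian_blochOp r)) (by simp)]
  congr 1
  have h : conj U (blochOp r) = (1 / 2 : ℂ) • (1 + (r 0 : ℂ) • conj U (pauli 0) +
      (r 1 : ℂ) • conj U (pauli 1) + (r 2 : ℂ) • conj U (pauli 2)) := by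
    simp only [conj, blochOp, pauli, Matrix.cons_val, Matrix.mul_smul, Matrix.smul_mul,
      Matrix.mul_add, Matrix.add_mul, Matrix.mul_one, coe_mul_star]
  rw [h]
  ext i
  simp only [Matrix.mulVec, dotProduct, rot, Matrix.of_apply, Fin.sum_univ_three]
  generalize conj U (pauli 0) = A
  generalize conj U (pauli 1) = B
  generalize conj U (pauli 2) = C
  fin_cases i <;> simp [blochVec] <;> ring

lemma rot_mulVec_eq {U : U2} {r s : Fin 3 → ℝ} (h : conj U (blochOp r) = blochOp s) :
    rot U *ᵥ r = s := by
  rw [conj_blochOp] at h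
  exact blochOp_injective h

lemma rot_eq_of_conj {U : U2} {R : Matrix (Fin 3) (Fin 3) ℝ}
    (h : ∀ r, conj U (blochOp r) = blochOp (R *ᵥ r)) : rot U = R :=
  Matrix.ext_of_mulVec_single fun _ => rot_mulVec_eq (h _)

@[simp] lemma rot_one : rot 1 = 1 := rot_eq_of_conj fun r => by simp [conj_one]

@[simp] lemma rot_mul (U V : U2) : rot (U * V) = rot U * rot V :=
  rot_eq_of_conj fun r => by
    rw [conj_mul, Function.comp_apply, conj_blochOp, conj_blochOp, Matrix.mulVec_mulVec]

lemma dot_rot (U : U2) (r s : Fin 3 → ℝ) : (rot U *ᵥ r) ⬝ᵥ (rot U *ᵥ s) = r ⬝ᵥ s := by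
  have h := trace_blochOp_mul (rot U *ᵥ r) (rot U *ᵥ s)
  rw [← conj_blochOp, ← conj_blochOp, conj_mul_conj, trace_conj, trace_blochOp_mul] at h
  linarith

lemma rot_transpose_mul (U : U2) : (rot U)ᵀ * rot U = 1 := by
  ext i j
  have h := dot_rot U (Pi.single i 1) (Pi.single j 1)
  simp only [Matrix.mulVec_single_one, single_dotProduct, one_mul] at h
  have h' : (rot U).col i ⬝ᵥ (rot U).col j = if i = j then 1 else 0 := by
    simpa [Pi.single_apply] using h
  rw [Matrix.mul_apply', Matrix.one_apply]
  exact h'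

lemma rot_mul_transpose (U : U2) : rot U * (rot U)ᵀ = 1 :=
  mul_eq_one_comm.mp (rot_transpose_mul U)

lemma rot_inv (U : U2) : rot U⁻¹ = (rot U)ᵀ := by
  have h : rot U⁻¹ * rot U = 1 := by rw [← rot_mul]; simp
  calc rot U⁻¹ = rot U⁻¹ * (rot U * (rot U)ᵀ) := by rw [rot_mul_transpose, mul_one]
    _ = (rot U)ᵀ := by rw [← mul_assoc, h, one_mul]

lemma det_rot_mulVec (U : U2) (r s t : Fin 3 → ℝ) :
    (Matrix.of ![rot U *ᵥ r, rot U *ᵥ s, rot U *ᵥ t]).det = (Matrix.of ![r, s, t]).det := by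
  have h := trace_blochOp_triple (rot U *ᵥ r) (rot U *ᵥ s) (rot U *ᵥ t)
  rw [← conj_blochOp, ← conj_blochOp, ← conj_blochOp, conj_mul_conj, conj_mul_conj, trace_conj,
    trace_blochOp_triple] at h
  linarith

@[simp] lemma det_rot (U : U2) : (rot U).det = 1 := by
  have h := det_rot_mulVec U (Pi.single 0 1) (Pi.single 1 1) (Pi.single 2 1)
  rw [Matrix.mulVec_single_one, Matrix.mulVec_single_one, Matrix.mulVec_single_one,
    Matrix.det_fin_three, Matrix.det_fin_three] at h
  rw [Matrix.det_fin_three]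
  simp at h
  linarith

/-- A unitary that fixes all Bloch vectors commutes with `X` and `Z`, hence is a scalar. -/
lemma mem_phases_of_rot_eq_one {U : U2} (h : rot U = 1) : U ∈ phases := by
  have hc : ∀ r, (U : Op) * blochOp r = blochOp r * (U : Op) := fun r => by
    have h1 := conj_blochOp U r
    rw [h, Matrix.one_mulVec, conj] at h1
    calc (U : Op) * blochOp r = (U : Op) * blochOp r * (star (U : Op) * (U : Op)) := by
          rw [star_mul_coe, Matrix.mul_one]
      _ = (U : Op) * blochOp r * star (U : Op) * (U : Op) := by simp only [Matrix.mul_assoc]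
      _ = _ := by rw [h1]
  have h1 := hc ![1, 0, 0]
  have h3 := hc ![0, 0, 1]
  rw [blochOp_eq] at h1 h3
  have a := congrFun (congrFun h3 0) 1
  have b := congrFun (congrFun h3 1) 0
  have c := congrFun (congrFun h1 0) 1
  simp [Matrix.mul_apply] at a b c
  refine ⟨(U : Op) 0 0, ?_⟩
  ext i j
  fin_cases i <;> fin_cases j <;> simp
  · exact a.symm
  · exact b
  · linear_combination -2 * c

lemma conj_of_mem_phases {U : U2} (h : U ∈ phases) (P : Op) : conj U P = P := by
  obtain ⟨z, hz⟩ := h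
  have h1 := coe_mul_star U
  rw [hz] at h1
  rw [conj, hz]
  calc (z • (1 : Op)) * P * star (z • (1 : Op)) = ((z • (1 : Op)) * star (z • (1 : Op))) * P := by
        simp [smul_smul, mul_comm]
    _ = P := by rw [h1, Matrix.one_mul]

lemma mem_phases_iff {U : U2} : U ∈ phases ↔ rot U = 1 :=
  ⟨fun h => rot_eq_of_conj fun r => by rw [conj_of_mem_phases h, Matrix.one_mulVec],
    mem_phases_of_rot_eq_one⟩

lemma rot_eq_iff {U V : U2} : rot U = rot V ↔ U⁻¹ * V ∈ phases := by
  rw [mem_phases_iff, rot_mul]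
  constructor
  · intro h
    rw [← h, ← rot_mul, inv_mul_cancel, rot_one]
  · intro h
    have := congrArg (rot U * ·) h
    simp only [← mul_assoc, ← rot_mul, mul_inv_cancel, mul_one, one_mul] at this
    exact this.symm

/-! ### Some unitaries and their rotations -/

/-- The gate `X` as an element of the unitary group; `uY`, …, `uRotZ` below do the same for the
other gates. -/
def uX : U2 := ⟨X, Matrix.mem_unitaryGroup_iff.mpr (by
  ext i j; fin_cases i <;> fin_cases j <;> simp [X, Matrix.mul_apply])⟩

def uY : U2 := ⟨Y, Matrix.mem_unitaryGroup_iff.mpr (by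
  ext i j; fin_cases i <;> fin_cases j <;> simp [Y, Matrix.mul_apply])⟩

def uZ : U2 := ⟨Z, Matrix.mem_unitaryGroup_iff.mpr (by
  ext i j; fin_cases i <;> fin_cases j <;> simp [Z, Matrix.mul_apply])⟩

lemma inv_sqrt_two_mul_self : ((√2 : ℝ) : ℂ)⁻¹ * ((√2 : ℝ) : ℂ)⁻¹ = 1 / 2 := by
  rw [← mul_inv, ← Complex.ofReal_mul, Real.mul_self_sqrt (by norm_num)]
  norm_num

def uH : U2 := ⟨hadamard, Matrix.mem_unitaryGroup_iff.mpr (by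
  ext i j
  fin_cases i <;> fin_cases j <;> simp [hadamard, Matrix.mul_apply, inv_sqrt_two_mul_self] <;>
    norm_num)⟩

def uP : U2 := ⟨phaseGate, Matrix.mem_unitaryGroup_iff.mpr (by
  ext i j; fin_cases i <;> fin_cases j <;> simp [phaseGate, Matrix.mul_apply])⟩

def uS : U2 := ⟨sqrtY, Matrix.mem_unitaryGroup_iff.mpr (by
  ext i j
  fin_cases i <;> fin_cases j <;> simp [sqrtY, Matrix.mul_apply, inv_sqrt_two_mul_self] <;>
    norm_num)⟩

lemma exp_mul_conj (t : ℝ) :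
    Complex.exp (t * Complex.I) * (starRingEnd ℂ) (Complex.exp (t * Complex.I)) = 1 := by
  rw [← Complex.exp_conj, ← Complex.exp_add]
  simp

def uRotZ (t : ℝ) : U2 := ⟨rotZ t, Matrix.mem_unitaryGroup_iff.mpr (by
  ext i j; fin_cases i <;> fin_cases j <;> simp [rotZ, Matrix.mul_apply, exp_mul_conj])⟩

/-- The rotation by `t` about the `y`-axis. -/
def uRotY (t : ℝ) : U2 := ⟨!![(Real.cos (t / 2) : ℂ), -(Real.sin (t / 2) : ℂ);
    (Real.sin (t / 2) : ℂ), (Real.cos (t / 2) : ℂ)], Matrix.mem_unitaryGroup_iff.mpr (by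
  have h : (Real.cos (t / 2) : ℂ) * Real.cos (t / 2) + Real.sin (t / 2) * Real.sin (t / 2) = 1 := by
    norm_cast
    nlinarith [Real.sin_sq_add_cos_sq (t / 2)]
  ext i j
  fin_cases i <;> fin_cases j <;>
    simp [Matrix.mul_apply, -Complex.ofReal_cos, -Complex.ofReal_sin, Complex.conj_ofReal]
  · exact h
  · ring
  · ring
  · rw [add_comm]; exact h)⟩

lemma rot_uX : rot uX = !![1, 0, 0; 0, -1, 0; 0, 0, -1] := by
  refine rot_eq_of_conj fun r => ?_
  rw [blochOp_eq, blochOp_eq]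
  ext i j
  fin_cases i <;> fin_cases j <;>
    simp [conj, uX, X, Matrix.mul_apply, Matrix.mulVec, dotProduct, Fin.sum_univ_three] <;> ring

lemma rot_uY : rot uY = !![-1, 0, 0; 0, 1, 0; 0, 0, -1] := by
  refine rot_eq_of_conj fun r => ?_
  rw [blochOp_eq, blochOp_eq]
  ext i j
  fin_cases i <;> fin_cases j <;> apply Complex.ext <;>
    simp [conj, uY, Y, Matrix.mul_apply, Matrix.mulVec, dotProduct, Fin.sum_univ_three] <;> ring

lemma rot_uZ : rot uZ = !![-1, 0, 0; 0, -1, 0; 0, 0, 1] := by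
  refine rot_eq_of_conj fun r => ?_
  rw [blochOp_eq, blochOp_eq]
  ext i j
  fin_cases i <;> fin_cases j <;>
    simp [conj, uZ, Z, Matrix.mul_apply, Matrix.mulVec, dotProduct, Fin.sum_univ_three] <;> ring

lemma rot_uP : rot uP = !![0, -1, 0; 1, 0, 0; 0, 0, 1] := by
  refine rot_eq_of_conj fun r => ?_
  rw [blochOp_eq, blochOp_eq]
  ext i j
  fin_cases i <;> fin_cases j <;> apply Complex.ext <;>
    simp [conj, uP, phaseGate, Matrix.mul_apply, Matrix.mulVec, dotProduct,
      Fin.sum_univ_three] <;> ring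

lemma rot_uH : rot uH = !![0, 0, 1; 0, -1, 0; 1, 0, 0] := by
  refine rot_eq_of_conj fun r => ?_
  rw [blochOp_eq, blochOp_eq]
  ext i j
  have h := inv_sqrt_two_mul_self
  fin_cases i <;> fin_cases j <;>
    simp [conj, uH, hadamard, Matrix.mul_apply, Matrix.mulVec, dotProduct, Fin.sum_univ_three]
  · linear_combination (1 + r 0 : ℂ) * h
  · linear_combination (r 2 + r 1 * Complex.I : ℂ) * h
  · linear_combination (r 2 - r 1 * Complex.I : ℂ) * h
  · linear_combination (1 - r 0 : ℂ) * h

lemma rot_uS : rot uS = !![0, 0, 1; 0, 1, 0; -1, 0, 0] := by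
  refine rot_eq_of_conj fun r => ?_
  rw [blochOp_eq, blochOp_eq]
  ext i j
  have h := inv_sqrt_two_mul_self
  fin_cases i <;> fin_cases j <;>
    simp [conj, uS, sqrtY, Matrix.mul_apply, Matrix.mulVec, dotProduct, Fin.sum_univ_three]
  · linear_combination (1 - r 0 : ℂ) * h
  · linear_combination (r 2 - r 1 * Complex.I : ℂ) * h
  · linear_combination (r 2 + r 1 * Complex.I : ℂ) * h
  · linear_combination (1 + r 0 : ℂ) * h

lemma rot_uRotZ (t : ℝ) : rot (uRotZ t) =
    !![Real.cos t, -Real.sin t, 0; Real.sin t, Real.cos t, 0; 0, 0, 1] := by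
  refine rot_eq_of_conj fun r => ?_
  rw [blochOp_eq, blochOp_eq]
  have h := exp_mul_conj t
  have hI := Complex.I_sq
  ext i j
  fin_cases i <;> fin_cases j <;>
    simp [conj, uRotZ, rotZ, Matrix.mul_apply, Matrix.mulVec, dotProduct, Fin.sum_univ_three]
  · rw [← Complex.exp_conj]
    simp only [map_mul, Complex.conj_ofReal, Complex.conj_I]
    rw [mul_neg, ← neg_mul, Complex.exp_mul_I, Complex.cos_neg, Complex.sin_neg]
    linear_combination (r 1 * Complex.sin t / 2) * hI
  · rw [Complex.exp_mul_I]
    linear_combination (r 1 * Complex.sin t / 2) * hI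
  · linear_combination ((1 - r 2) / 2 : ℂ) * h

lemma rot_uRotY (t : ℝ) : rot (uRotY t) =
    !![Real.cos t, 0, Real.sin t; 0, 1, 0; -Real.sin t, 0, Real.cos t] := by
  obtain ⟨s, rfl⟩ : ∃ s, t = 2 * s := ⟨t / 2, by ring⟩
  refine rot_eq_of_conj fun r => ?_
  rw [blochOp_eq, blochOp_eq, Real.cos_two_mul, Real.sin_two_mul]
  have h : (Real.sin s : ℂ) ^ 2 = 1 - (Real.cos s : ℂ) ^ 2 := by
    rw [← Complex.ofReal_pow, Real.sin_sq]
    push_cast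
    ring
  have hs : 2 * s / 2 = s := by ring
  ext i j
  fin_cases i <;> fin_cases j <;>
    simp [conj, uRotY, Matrix.mul_apply, Matrix.mulVec, dotProduct, Fin.sum_univ_three,
      Complex.conj_ofReal, -Complex.ofReal_cos, -Complex.ofReal_sin, hs]
  · linear_combination ((1 - r 2) / 2 : ℂ) * h
  · linear_combination ((-r 0 - r 1 * Complex.I) / 2 : ℂ) * h
  · linear_combination ((-r 0 + r 1 * Complex.I) / 2 : ℂ) * h
  · linear_combination ((1 + r 2) / 2 : ℂ) * h

/-! ### Every rotation comes from a unitary -/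

lemma exists_cos_sin {x y : ℝ} (h : x ^ 2 + y ^ 2 = 1) : ∃ t : ℝ, x = Real.cos t ∧ y = Real.sin t := by
  have hn : ‖(⟨x, y⟩ : ℂ)‖ = 1 := by
    rw [Complex.norm_def, Complex.normSq_mk, Real.sqrt_eq_one]
    linarith
  have h0 : (⟨x, y⟩ : ℂ) ≠ 0 := fun h => by simp [h] at hn
  exact ⟨Complex.arg ⟨x, y⟩, by rw [Complex.cos_arg h0, hn, div_one],
    by rw [Complex.sin_arg, hn, div_one]⟩

lemma dot_self_three (r : Fin 3 → ℝ) : r ⬝ᵥ r = r 0 ^ 2 + r 1 ^ 2 + r 2 ^ 2 := by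
  simp [dotProduct, Fin.sum_univ_three]
  ring

lemma dot_three (r s : Fin 3 → ℝ) : r ⬝ᵥ s = r 0 * s 0 + r 1 * s 1 + r 2 * s 2 := by
  simp [dotProduct, Fin.sum_univ_three]

/-- Spherical coordinates: the `z`-axis is turned to any given direction by a rotation about the
`y`-axis followed by one about the `z`-axis. -/
lemma exists_rot_mulVec_eq {r : Fin 3 → ℝ} (hr : r ⬝ᵥ r = 1) :
    ∃ U : U2, rot U *ᵥ ![0, 0, 1] = r := by
  rw [dot_self_three] at hr
  obtain ⟨b, hb2, hb1⟩ := exists_cos_sin (x := r 2) (y := √(r 0 ^ 2 + r 1 ^ 2)) (by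
    rw [Real.sq_sqrt (by positivity)]; linarith)
  obtain ⟨a, ha⟩ : ∃ a : ℝ, r 0 = Real.sin b * Real.cos a ∧ r 1 = Real.sin b * Real.sin a := by
    rw [← hb1]
    rcases eq_or_ne (√(r 0 ^ 2 + r 1 ^ 2)) 0 with h | h
    · rw [Real.sqrt_eq_zero (by positivity)] at h
      exact ⟨0, by simp [h]; nlinarith [sq_nonneg (r 0), sq_nonneg (r 1)],
        by simp; nlinarith [sq_nonneg (r 0), sq_nonneg (r 1)]⟩
    · obtain ⟨a, h0, h1⟩ := exists_cos_sin (x := r 0 / √(r 0 ^ 2 + r 1 ^ 2))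
        (y := r 1 / √(r 0 ^ 2 + r 1 ^ 2)) (by
          rw [div_pow, div_pow, ← add_div, Real.sq_sqrt (by positivity)]
          exact div_self fun h' => h (by rw [h', Real.sqrt_zero]))
      exact ⟨a, by rw [← h0, mul_div_cancel₀ _ h], by rw [← h1, mul_div_cancel₀ _ h]⟩
  refine ⟨uRotZ a * uRotY b, ?_⟩
  rw [rot_mul, ← Matrix.mulVec_mulVec, rot_uRotZ, rot_uRotY]
  ext i
  fin_cases i <;> simp [Matrix.mulVec, dotProduct, Fin.sum_univ_three, ha, hb2] <;> ring

/-- By Euler angles: a rotation that fixes the `z`-axis is some `R_z(t)`, and every rotation is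
brought into this form by a rotation that moves its third column to the `z`-axis. -/
lemma exists_rot_eq {R : Matrix (Fin 3) (Fin 3) ℝ} (hR : Rᵀ * R = 1) (hd : R.det = 1) :
    ∃ U : U2, rot U = R := by
  have hr : (R *ᵥ ![0, 0, 1]) ⬝ᵥ (R *ᵥ ![0, 0, 1]) = 1 := by
    rw [Matrix.dotProduct_mulVec, Matrix.vecMul_mulVec, hR, Matrix.vecMul_one]
    simp
  obtain ⟨U, hU⟩ := exists_rot_mulVec_eq hr
  obtain ⟨Q, hQ⟩ : ∃ Q, Q = (rot U)ᵀ * R := ⟨_, rfl⟩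
  have hQ1 : Qᵀ * Q = 1 := by
    rw [hQ, Matrix.transpose_mul, Matrix.transpose_transpose]
    calc Rᵀ * rot U * ((rot U)ᵀ * R) = Rᵀ * (rot U * (rot U)ᵀ) * R := by
          simp only [Matrix.mul_assoc]
      _ = 1 := by rw [rot_mul_transpose, Matrix.mul_one, hR]
  have hQd : Q.det = 1 := by rw [hQ, Matrix.det_mul, Matrix.det_transpose, det_rot, hd, one_mul]
  have hQ3 : Q *ᵥ ![0, 0, 1] = ![0, 0, 1] := by
    rw [hQ, ← Matrix.mulVec_mulVec, ← hU, Matrix.mulVec_mulVec, rot_transpose_mul,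
      Matrix.one_mulVec]
  have q02 := congrFun hQ3 0
  have q12 := congrFun hQ3 1
  have q22 := congrFun hQ3 2
  have hQ2 : Q * Qᵀ = 1 := mul_eq_one_comm.mp hQ1
  have e00 := congrFun (congrFun hQ1 0) 0
  have e11 := congrFun (congrFun hQ1 1) 1
  have e22 := congrFun (congrFun hQ2 2) 2
  rw [Matrix.det_fin_three] at hQd
  simp [Matrix.mulVec, dotProduct, Fin.sum_univ_three] at q02 q12 q22
  simp [Matrix.mul_apply, Fin.sum_univ_three, q02, q12, q22] at e00 e11 e22 hQd
  have q20 : Q 2 0 = 0 := by nlinarith [sq_nonneg (Q 2 0), sq_nonneg (Q 2 1)]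
  have q21 : Q 2 1 = 0 := by nlinarith [sq_nonneg (Q 2 0), sq_nonneg (Q 2 1)]
  simp only [q20, q21] at e00 e11 hQd
  have hs : (Q 0 0 - Q 1 1) ^ 2 + (Q 0 1 + Q 1 0) ^ 2 = 0 := by linear_combination e00 + e11 - 2 * hQd
  have q11 : Q 1 1 = Q 0 0 := by nlinarith [sq_nonneg (Q 0 0 - Q 1 1), sq_nonneg (Q 0 1 + Q 1 0)]
  have q01 : Q 0 1 = -Q 1 0 := by nlinarith [sq_nonneg (Q 0 0 - Q 1 1), sq_nonneg (Q 0 1 + Q 1 0)]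
  obtain ⟨t, ht0, ht1⟩ := exists_cos_sin (x := Q 0 0) (y := Q 1 0) (by linarith)
  have hQt : Q = rot (uRotZ t) := by
    rw [rot_uRotZ, ← ht0, ← ht1]
    ext i j
    fin_cases i <;> fin_cases j <;> simp [q02, q12, q22, q20, q21, q11, q01]
  refine ⟨U * uRotZ t, ?_⟩
  rw [rot_mul, ← hQt, hQ, ← Matrix.mul_assoc, rot_mul_transpose, Matrix.one_mul]

/-- Two linearly independent triples of vectors with the same Gram matrix are related by an
orthogonal transformation, which is a rotation up to a common sign. -/
lemma exists_rot_of_gram {A B : Matrix (Fin 3) (Fin 3) ℝ} (hA : A.det ≠ 0) (h : A * Aᵀ = B * Bᵀ) :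
    ∃ (U : U2) (ε : ℝ), (ε = 1 ∨ ε = -1) ∧ ∀ i, rot U *ᵥ A i = ε • B i := by
  have hA' : IsUnit A.det := isUnit_iff_ne_zero.mpr hA
  have hAt : IsUnit Aᵀ.det := by rwa [Matrix.det_transpose]
  obtain ⟨O, hO⟩ : ∃ O, O = Bᵀ * Aᵀ⁻¹ := ⟨_, rfl⟩
  have hOA : O * Aᵀ = Bᵀ := by rw [hO, Matrix.mul_assoc, Matrix.nonsing_inv_mul _ hAt, mul_one]
  have hOO : Oᵀ * O = 1 := by
    rw [hO, Matrix.transpose_mul, Matrix.transpose_nonsing_inv, Matrix.transpose_transpose,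
      Matrix.transpose_transpose]
    calc A⁻¹ * B * (Bᵀ * Aᵀ⁻¹) = A⁻¹ * (B * Bᵀ) * Aᵀ⁻¹ := by simp only [Matrix.mul_assoc]
      _ = (A⁻¹ * A) * (Aᵀ * Aᵀ⁻¹) := by rw [← h]; simp only [Matrix.mul_assoc]
      _ = 1 := by rw [Matrix.nonsing_inv_mul _ hA', Matrix.mul_nonsing_inv _ hAt, one_mul]
  have hd : O.det * O.det = 1 := by
    have := congrArg Matrix.det hOO
    rwa [Matrix.det_mul, Matrix.det_transpose, Matrix.det_one] at this
  obtain ⟨U, hU⟩ := exists_rot_eq (R := O.det • O)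
    (by rw [Matrix.transpose_smul, Matrix.smul_mul, Matrix.mul_smul, smul_smul, hd, one_smul, hOO])
    (by rw [Matrix.det_smul, Fintype.card_fin]; linear_combination (O.det * O.det + 1) * hd)
  refine ⟨U, O.det, mul_self_eq_one_iff.mp hd, fun i => ?_⟩
  rw [hU, Matrix.smul_mulVec]
  congr 1
  ext j
  exact congrFun (congrFun hOA j) i

/-! ### Bases as axes in the Bloch ball -/

lemma blochBasis_eq_iff {r s : Fin 3 → ℝ} : blochBasis r = blochBasis s ↔ r = s ∨ r = -s := by
  constructor
  · intro h
    have : blochOp r ∈ blochBasis s := h ▸ Set.mem_insert _ _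
    simpa [blochBasis] using this
  · rintro (rfl | rfl)
    · rfl
    · simp [blochBasis, Set.pair_comm]

lemma blochBasis_neg (r : Fin 3 → ℝ) : blochBasis (-r) = blochBasis r :=
  blochBasis_eq_iff.mpr (Or.inr rfl)

lemma blochBasis_smul {ε : ℝ} (h : ε = 1 ∨ ε = -1) (r : Fin 3 → ℝ) :
    blochBasis (ε • r) = blochBasis r := by
  rcases h with rfl | rfl
  · rw [one_smul]
  · rw [neg_one_smul, blochBasis_neg]

lemma image_conj_blochBasis (U : U2) (r : Fin 3 → ℝ) :
    conj U '' blochBasis r = blochBasis (rot U *ᵥ r) := by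
  simp [blochBasis, Set.image_pair, conj_blochOp, Matrix.mulVec_neg]

lemma move_image_blochBasis (U : U2) (S : Set (Fin 3 → ℝ)) :
    move U (blochBasis '' S) = blochBasis '' ((fun r => rot U *ᵥ r) '' S) := by
  simp only [move, Set.image_image, image_conj_blochBasis]

lemma exists_eq_or_eq_neg_of_mem_symmetryGroup {S : Set (Fin 3 → ℝ)} {U : U2}
    (hU : U ∈ symmetryGroup (blochBasis '' S)) {r : Fin 3 → ℝ} (hr : r ∈ S) :
    ∃ s ∈ S, rot U *ᵥ r = s ∨ rot U *ᵥ r = -s := by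
  have h1 : move U (blochBasis '' S) = blochBasis '' S := hU
  have h2 : blochBasis (rot U *ᵥ r) ∈ blochBasis '' S := by
    rw [← h1, move_image_blochBasis]
    exact Set.mem_image_of_mem _ (Set.mem_image_of_mem _ hr)
  obtain ⟨s, hs, h⟩ := h2
  exact ⟨s, hs, blochBasis_eq_iff.mp h.symm⟩

lemma conj_injective (U : U2) : Function.Injective (conj U) := by
  refine Function.LeftInverse.injective (g := conj U⁻¹) fun P => ?_
  rw [← Function.comp_apply (f := conj U⁻¹), ← conj_mul, inv_mul_cancel, conj_one, id]

/-- For finitely many axes it suffices that they are mapped into themselves. -/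
lemma mem_symmetryGroup_of_forall {S : Set (Fin 3 → ℝ)} (hS : S.Finite) {U : U2}
    (h : ∀ r ∈ S, ∃ s ∈ S, rot U *ᵥ r = s ∨ rot U *ᵥ r = -s) :
    U ∈ symmetryGroup (blochBasis '' S) := by
  have hsub : move U (blochBasis '' S) ⊆ blochBasis '' S := by
    rw [move_image_blochBasis]
    rintro _ ⟨_, ⟨r, hr, rfl⟩, rfl⟩
    obtain ⟨s, hs, h'⟩ := h r hr
    exact ⟨s, hs, (blochBasis_eq_iff.mpr h').symm⟩
  refine Set.eq_of_subset_of_ncard_le hsub ?_ (hS.image _)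
  rw [move, Set.ncard_image_of_injective _ (Set.image_injective.mpr (conj_injective U))]

lemma orthonormal_dot {v : OrthonormalBasis (Fin 2) ℂ (EuclideanSpace ℂ (Fin 2))} (i j : Fin 2) :
    star (v i).ofLp ⬝ᵥ (v j).ofLp = if i = j then 1 else 0 := by
  rw [← orthonormal_iff_ite.mp v.orthonormal i j, EuclideanSpace.inner_eq_star_dotProduct,
    dotProduct_comm]

/-- The two projections of a basis have orthogonal supports, so their Bloch vectors are opposite;
conversely the columns of a unitary that turns the `z`-axis to `r` form a basis. -/
lemma isBasis_iff {b : Set Op} : IsBasis b ↔ ∃ r : Fin 3 → ℝ, r ⬝ᵥ r = 1 ∧ b = blochBasis r := by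
  constructor
  · rintro ⟨v, rfl⟩
    obtain ⟨p, hp⟩ : ∃ p : Fin 2 → Op, p = fun j => Matrix.vecMulVec (v j).ofLp (star (v j).ofLp) :=
      ⟨_, rfl⟩
    have hH : ∀ j, (p j).IsHermitian := fun j => by
      rw [hp, Matrix.IsHermitian, Matrix.conjTranspose_vecMulVec, star_star]
    have ht : ∀ i j, (p i * p j).trace = if i = j then 1 else 0 := fun i j => by
      simp only [hp]
      rw [Matrix.vecMulVec_mul_vecMulVec, Matrix.trace_vecMulVec, dotProduct_smul,
        orthonormal_dot, dotProduct_comm, orthonormal_dot]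
      split_ifs <;> simp_all
    have h1 : ∀ j, (p j).trace = 1 := fun j => by
      rw [hp, Matrix.trace_vecMulVec, dotProduct_comm, orthonormal_dot, if_pos rfl]
    have hb : ∀ j, p j = blochOp (blochVec (p j)) := fun j => (blochOp_blochVec (hH j) (h1 j)).symm
    have hd : ∀ i j, (1 + blochVec (p i) ⬝ᵥ blochVec (p j)) / 2 = if i = j then (1 : ℝ) else 0 :=
      fun i j => by
        rw [← trace_blochOp_mul, ← hb, ← hb, ht]
        split_ifs <;> simp
    have h00 := hd 0 0
    have h11 := hd 1 1
    have h01 := hd 0 1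
    simp at h00 h11 h01
    refine ⟨blochVec (p 0), by linarith, ?_⟩
    have hn : blochVec (p 1) = -blochVec (p 0) := by
      rw [dot_three] at h00 h11 h01
      have hs : (blochVec (p 1) 0 + blochVec (p 0) 0) ^ 2 + (blochVec (p 1) 1 + blochVec (p 0) 1) ^ 2
          + (blochVec (p 1) 2 + blochVec (p 0) 2) ^ 2 = 0 := by
        linear_combination 2 * h00 + 2 * h11 + 2 * h01
      ext i
      rw [Pi.neg_apply, eq_neg_iff_add_eq_zero]
      fin_cases i <;> simp <;> nlinarith [sq_nonneg (blochVec (p 1) 0 + blochVec (p 0) 0),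
        sq_nonneg (blochVec (p 1) 1 + blochVec (p 0) 1),
        sq_nonneg (blochVec (p 1) 2 + blochVec (p 0) 2)]
    rw [blochBasis, ← hn, ← hb, ← hb, ← hp]
    ext A
    simp [Fin.exists_fin_two, eq_comm]
  · rintro ⟨r, hr, rfl⟩
    obtain ⟨U, hU⟩ := exists_rot_mulVec_eq hr
    have hs := star_mul_coe U
    have ho : Orthonormal ℂ fun j => (WithLp.toLp 2 fun k => (U : Op) k j : EuclideanSpace ℂ (Fin 2)) := by
      rw [orthonormal_iff_ite]
      intro i j
      have := congrFun (congrFun hs i) j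
      rw [Matrix.one_apply] at this
      rw [← this, EuclideanSpace.inner_eq_star_dotProduct, dotProduct_comm]
      simp [dotProduct, Matrix.mul_apply]
    obtain ⟨v, hv⟩ := Orthonormal.exists_orthonormalBasis_extension_of_card_eq
      (𝕜 := ℂ) (E := EuclideanSpace ℂ (Fin 2)) (ι := Fin 2) (by simp) (s := Set.univ)
      (v := fun j => WithLp.toLp 2 fun k => (U : Op) k j)
      (ho.comp _ Subtype.val_injective)
    refine ⟨v, ?_⟩
    have h0 : conj U (blochOp ![0, 0, 1]) =
        Matrix.vecMulVec (v 0).ofLp (star (v 0).ofLp) := by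
      rw [hv 0 trivial, blochOp_eq]
      ext i j
      simp [conj, Matrix.mul_apply, Matrix.vecMulVec_apply]
    have h1 : conj U (blochOp (-![0, 0, 1])) =
        Matrix.vecMulVec (v 1).ofLp (star (v 1).ofLp) := by
      rw [hv 1 trivial, blochOp_eq]
      ext i j
      simp [conj, Matrix.mul_apply, Matrix.vecMulVec_apply]
    rw [conj_blochOp, hU] at h0
    rw [conj_blochOp, Matrix.mulVec_neg, hU] at h1
    rw [blochBasis, h0, h1]
    ext A
    simp [Fin.exists_fin_two, eq_comm]

/-! ### Finite quasiprobability representations -/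

lemma trace_mul_blochOp_re {A : Op} (hA : A.IsHermitian) (d : Fin 3 → ℝ) :
    (A * blochOp d).trace.re = (A.trace.re + blochVec A ⬝ᵥ d) / 2 := by
  rw [trace_mul_re hA (isHermitian_blochOp d)]
  simp

lemma mu_smul_blochOp {Λ : Type*} {F : Λ → Op} {l : Λ} {w : ℝ} {d : Fin 3 → ℝ}
    (hF : F l = (w : ℂ) • blochOp d) {ρ : Op} (hρ : ρ.IsHermitian) :
    mu F ρ l = w * ((ρ.trace.re + blochVec ρ ⬝ᵥ d) / 2) := by
  rw [mu, hF, Matrix.mul_smul, Matrix.trace_smul, smul_eq_mul, Complex.re_ofReal_mul,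
    trace_mul_blochOp_re hρ]

lemma sum_xi {Λ : Type*} (G : Λ → Op) {n : ℕ} (E : Fin n → Op) (l : Λ) :
    ∑ j, xi G (E j) l = xi G (∑ j, E j) l := by
  simp [xi, Finset.sum_mul, Matrix.trace_sum]

/-- A finite representation with `F(l) = w(l) G(l)` from a tight frame of vectors that is balanced
in the sense that the weighted sum of the vectors is zero. -/
lemma isQuasiprobRep_count {Λ : Type*} [Fintype Λ] [MeasurableSpace Λ] [MeasurableSingletonClass Λ]
    {F G : Λ → Op} {w : Λ → ℝ} {d : Λ → Fin 3 → ℝ}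
    (hF : ∀ l, F l = (w l : ℂ) • blochOp (d l)) (hG : ∀ l, G l = blochOp (d l))
    (h0 : ∑ l, w l = 2) (h1 : ∀ i, ∑ l, w l * d l i = 0)
    (h2 : ∀ i j, ∑ l, w l * d l i * d l j = if i = j then 2 else 0) :
    IsQuasiprobRep Measure.count F G := by
  have hmu : ∀ ρ, ρ.IsHermitian → ∀ l,
      mu F ρ l = w l * ((ρ.trace.re + blochVec ρ ⬝ᵥ d l) / 2) :=
    fun ρ hρ l => mu_smul_blochOp (hF l) hρ
  have hxi : ∀ E, E.IsHermitian → ∀ l, xi G E l = (E.trace.re + blochVec E ⬝ᵥ d l) / 2 :=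
    fun E hE l => by rw [xi, hG, trace_mul_blochOp_re hE]
  have hint : ∀ f : Λ → ℝ, Integrable f Measure.count := fun f => Integrable.of_finite
  refine ⟨fun l => ?_, fun l => ?_, fun E _ => (hint _).aestronglyMeasurable, fun ρ _ => hint _,
    fun ρ hρ => ?_, fun n E hE l => ?_, fun ρ E _ _ => hint _, fun ρ E hρ hE => ?_⟩
  · rw [hF, Matrix.IsHermitian, Matrix.conjTranspose_smul, (isHermitian_blochOp _).eq]
    simp
  · rw [hG]
    exact isHermitian_blochOp _
  · rw [integral_count]
    simp only [hmu ρ hρ.1.isHermitian, hρ.2, Complex.one_re, dot_three]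
    have : ∀ l, w l * ((1 + (blochVec ρ 0 * d l 0 + blochVec ρ 1 * d l 1 + blochVec ρ 2 * d l 2)) / 2)
        = 1 / 2 * w l + blochVec ρ 0 / 2 * (w l * d l 0) + blochVec ρ 1 / 2 * (w l * d l 1)
          + blochVec ρ 2 / 2 * (w l * d l 2) := fun l => by ring
    simp only [this, Finset.sum_add_distrib, ← Finset.mul_sum, h0, h1]
    norm_num
  · rw [sum_xi, hE.2, xi, hG, one_mul, trace_blochOp, Complex.one_re]
  · rw [integral_count, trace_mul_re hρ.1.isHermitian hE.1.isHermitian]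
    simp only [hmu ρ hρ.1.isHermitian, hxi E hE.1.isHermitian, hρ.2, Complex.one_re, dot_three]
    generalize blochVec ρ = r
    generalize blochVec E = e
    generalize E.trace.re = t
    have : ∀ l, w l * ((1 + (r 0 * d l 0 + r 1 * d l 1 + r 2 * d l 2)) / 2) *
        ((t + (e 0 * d l 0 + e 1 * d l 1 + e 2 * d l 2)) / 2) =
        t / 4 * w l + (t * r 0 + e 0) / 4 * (w l * d l 0) + (t * r 1 + e 1) / 4 * (w l * d l 1)
        + (t * r 2 + e 2) / 4 * (w l * d l 2) + r 0 * e 0 / 4 * (w l * d l 0 * d l 0)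
        + r 1 * e 1 / 4 * (w l * d l 1 * d l 1) + r 2 * e 2 / 4 * (w l * d l 2 * d l 2)
        + (r 0 * e 1 + r 1 * e 0) / 4 * (w l * d l 0 * d l 1)
        + (r 0 * e 2 + r 2 * e 0) / 4 * (w l * d l 0 * d l 2)
        + (r 1 * e 2 + r 2 * e 1) / 4 * (w l * d l 1 * d l 2) := fun l => by ring
    simp only [this, Finset.sum_add_distrib, ← Finset.mul_sum, h0, h1, h2]
    simp
    ring

lemma sgn_eq (ε : Bool) : sgn ε = 1 ∨ sgn ε = -1 := by
  cases ε <;> simp [sgn]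

/-- Weights and vectors define a representation when the vectors form a tight frame with respect to
the weights, and axes whose Bloch vectors `r` lie for every vector `d` in the slab `|d · r| ≤ 1` become non-negative. The index
set is allowed to be any copy of `{+, -} × Fin n`, to have the representation in every universe. -/
lemma isQuasiprobRep_of_frame {Λ : Type*} [MeasurableSpace Λ] [MeasurableSingletonClass Λ] {n : ℕ}
    (e : Λ ≃ Bool × Fin n) {q : Fin n → ℝ} {d : Fin n → Fin 3 → ℝ} {S : Set (Fin 3 → ℝ)}
    (hq : ∀ a, 0 ≤ q a) (h0 : ∑ a, q a = 1)
    (h2 : ∀ i j, ∑ a, q a * d a i * d a j = if i = j then 1 else 0)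
    (hS : ∀ r ∈ S, ∀ a, |d a ⬝ᵥ r| ≤ 1) :
    IsQuasiprobRep Measure.count (repF q d ∘ e) (repG d ∘ e) ∧
      ∀ b ∈ blochBasis '' S, NonnegBasis (repF q d ∘ e) (repG d ∘ e) b := by
  have := Fintype.ofEquiv _ e.symm
  refine ⟨isQuasiprobRep_count (w := fun l => q (e l).2) (d := fun l => sgn (e l).1 • d (e l).2)
    (fun _ => rfl) (fun _ => rfl) ?_ ?_ ?_, ?_⟩
  · rw [e.sum_comp (fun l => q l.2), Fintype.sum_prod_type, Fintype.sum_bool, h0]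
    norm_num
  · intro i
    rw [e.sum_comp (fun l => q l.2 * (sgn l.1 • d l.2) i), Fintype.sum_prod_type, Fintype.sum_bool]
    simp [sgn]
  · intro i j
    rw [e.sum_comp (fun l => q l.2 * (sgn l.1 • d l.2) i * (sgn l.1 • d l.2) j),
      Fintype.sum_prod_type, Fintype.sum_bool]
    simp only [sgn, if_true, one_smul, Bool.false_eq_true, if_false, neg_smul, Pi.neg_apply,
      mul_neg, neg_mul, neg_neg, h2]
    split_ifs <;> norm_num
  · rintro _ ⟨r, hr, rfl⟩ P hP l
    obtain ⟨s, hs, rfl⟩ : ∃ s, |s ⬝ᵥ (sgn (e l).1 • d (e l).2)| ≤ 1 ∧ P = blochOp s := by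
      have h : ∀ s, |s ⬝ᵥ (sgn (e l).1 • d (e l).2)| = |d (e l).2 ⬝ᵥ s| := fun s => by
        rw [dotProduct_smul, smul_eq_mul, abs_mul, dotProduct_comm]
        rcases sgn_eq (e l).1 with h | h <;> simp [h]
      rcases hP with rfl | rfl
      · exact ⟨r, by rw [h]; exact hS r hr _, rfl⟩
      · exact ⟨-r, by rw [h, dotProduct_neg, abs_neg]; exact hS r hr _, rfl⟩
    rw [abs_le] at hs
    rw [mu_smul_blochOp (F := repF q d ∘ e) (l := l) (w := q (e l).2) (d := sgn (e l).1 • d (e l).2) rfl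
      (isHermitian_blochOp s), xi]
    simp only [Function.comp_apply, repG]
    rw [trace_mul_blochOp_re (isHermitian_blochOp s), trace_blochOp, blochVec_blochOp,
      Complex.one_re]
    exact ⟨mul_nonneg (hq _) (by linarith), by linarith, by linarith⟩

section frame

variable {n : ℕ} {q : Fin n → ℝ} {d : Fin n → Fin 3 → ℝ} {S : Set (Fin 3 → ℝ)}

lemma represents_of_frame (hq : ∀ a, 0 ≤ q a) (h0 : ∑ a, q a = 1)
    (h2 : ∀ i j, ∑ a, q a * d a i * d a j = if i = j then 1 else 0)
    (hS : ∀ r ∈ S, ∀ a, |d a ⬝ᵥ r| ≤ 1) : Represents q d (blochBasis '' S) :=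
  ⟨hq, isQuasiprobRep_of_frame (Equiv.refl _) hq h0 h2 hS⟩

lemma isNonneg_of_frame (hq : ∀ a, 0 ≤ q a) (h0 : ∑ a, q a = 1)
    (h2 : ∀ i j, ∑ a, q a * d a i * d a j = if i = j then 1 else 0)
    (hS : ∀ r ∈ S, ∀ a, |d a ⬝ᵥ r| ≤ 1) : IsNonneg.{u} (blochBasis '' S) := by
  let _ : MeasurableSpace (ULift.{u} (Bool × Fin n)) := ⊤
  have : DiscreteMeasurableSpace (ULift.{u} (Bool × Fin n)) := ⟨fun _ => trivial⟩
  exact ⟨_, _, _, _, _, isQuasiprobRep_of_frame Equiv.ulift hq h0 h2 hS⟩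

end frame

/-! ### Bloch vectors of the families -/

/-- The Bloch vector `(sin θ, 0, cos θ)`. -/
def vecXZ (θ : ℝ) : Fin 3 → ℝ := ![Real.sin θ, 0, Real.cos θ]

/-- The Bloch vector `(-sin θ, 0, cos θ)`. -/
def vecXZ' (θ : ℝ) : Fin 3 → ℝ := ![-Real.sin θ, 0, Real.cos θ]

/-- The three Bloch vectors obtained from `vecXZ θ` by rotations of order three about the
`z`-axis. -/
def vecD3 (θ : ℝ) : Fin 3 → Fin 3 → ℝ :=
  ![vecXZ θ, ![-(1 / 2) * Real.sin θ, √3 / 2 * Real.sin θ, Real.cos θ],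
    ![-(1 / 2) * Real.sin θ, -(√3 / 2) * Real.sin θ, Real.cos θ]]

/-- The three Bloch vectors of the second family of three bases. -/
def vecZ2 (θ φ : ℝ) : Fin 3 → Fin 3 → ℝ :=
  ![vecXZ θ, vecXZ' θ, ![Real.cos φ, Real.sin φ, 0]]

/-- The vertices of the cuboid with vertex `c` and edges parallel to the coordinate axes. -/
def cuboid (c : Fin 3 → ℝ) : Set (Fin 3 → ℝ) := {v | ∀ i, v i = c i ∨ v i = -c i}

lemma oneBasis_eq : oneBasis = blochBasis '' {![0, 0, 1]} := by
  simp [oneBasis]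

lemma twoBases_eq (θ : ℝ) : twoBases θ = blochBasis '' {vecXZ θ, vecXZ' θ} := by
  simp [twoBases, vecXZ, vecXZ', Set.image_insert_eq]

lemma threeBasesD3_eq (θ : ℝ) : threeBasesD3 θ = blochBasis '' Set.range (vecD3 θ) := by
  ext b
  simp [threeBasesD3, vecD3, vecXZ, eq_comm]
  tauto

lemma threeBasesZ2_eq (θ φ : ℝ) : threeBasesZ2 θ φ = blochBasis '' Set.range (vecZ2 θ φ) := by
  ext b
  simp [threeBasesZ2, vecZ2, vecXZ, vecXZ', eq_comm]
  tauto

lemma stabilizerBases_eq : stabilizerBases =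
    blochBasis '' Set.range fun i : Fin 3 => (Pi.single i 1 : Fin 3 → ℝ) := by
  have h0 : (Pi.single 0 1 : Fin 3 → ℝ) = ![1, 0, 0] := by ext i; fin_cases i <;> simp
  have h1 : (Pi.single 1 1 : Fin 3 → ℝ) = ![0, 1, 0] := by ext i; fin_cases i <;> simp
  have h2 : (Pi.single 2 1 : Fin 3 → ℝ) = ![0, 0, 1] := by ext i; fin_cases i <;> simp
  ext b
  simp [stabilizerBases, Fin.exists_fin_succ, eq_comm, h0, h1, h2]

lemma cuboidBases_eq (θ φ : ℝ) : cuboidBases θ φ = blochBasis '' cuboid (cuboidVec θ φ) := by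
  ext b
  constructor
  · rintro ⟨s, hs, rfl⟩
    refine ⟨_, fun i => ?_, rfl⟩
    rcases hs i with h | h <;> simp [h]
  · rintro ⟨v, hv, rfl⟩
    choose! s hs using fun i => (show ∃ s : ℝ, (s = 1 ∨ s = -1) ∧ v i = s * cuboidVec θ φ i from
      (hv i).elim (fun h => ⟨1, Or.inl rfl, by rw [h, one_mul]⟩)
        fun h => ⟨-1, Or.inr rfl, by rw [h, neg_one_mul]⟩)
    exact ⟨s, fun i => (hs i).1, by congr 1; ext i; exact (hs i).2⟩

/-! ### The explicit representations -/

lemma frame_stabilizer : ∀ i j, ∑ a, weightsStabilizer a * vectorsStabilizer a i *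
    vectorsStabilizer a j = if i = j then 1 else 0 := by
  intro i j
  fin_cases i <;> fin_cases j <;>
    simp [weightsStabilizer, vectorsStabilizer, Fin.sum_univ_four] <;> norm_num

lemma abs_dot_vectorsStabilizer (i : Fin 3) (a : Fin 4) :
    |vectorsStabilizer a ⬝ᵥ Pi.single i 1| ≤ 1 := by
  rw [dotProduct_single, mul_one]
  fin_cases i <;> fin_cases a <;> simp [vectorsStabilizer]

lemma sum_weightsStabilizer : ∑ a, weightsStabilizer a = 1 := by
  simp [weightsStabilizer]

lemma frame_D3 {θ : ℝ} (hs : Real.sin θ ≠ 0) (hc : Real.cos θ ≠ 0) (i j : Fin 3) :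
    ∑ a, weightsD3 θ a * vectorsD3 θ a i * vectorsD3 θ a j = if i = j then 1 else 0 := by
  have h3 : √3 ^ 2 = 3 := Real.sq_sqrt (by norm_num)
  have h30 : √3 ≠ 0 := by positivity
  have hsc : Real.sin θ ^ 2 = 1 - Real.cos θ ^ 2 := Real.sin_sq θ
  fin_cases i <;> fin_cases j <;>
    simp [weightsD3, vectorsD3, Fin.sum_univ_four] <;> field_simp
  all_goals try rw [h3]
  all_goals try rw [hsc]
  all_goals ring_nf

lemma abs_dot_vectorsD3 {θ : ℝ} (hs : Real.sin θ ≠ 0) (hc : Real.cos θ ≠ 0) (i : Fin 3)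
    (a : Fin 4) : |vectorsD3 θ a ⬝ᵥ vecD3 θ i| ≤ 1 := by
  have h3 : √3 ^ 2 = 3 := Real.sq_sqrt (by norm_num)
  have h30 : √3 ≠ 0 := by positivity
  have h : vectorsD3 θ a ⬝ᵥ vecD3 θ i = 1 ∨ vectorsD3 θ a ⬝ᵥ vecD3 θ i = -1 := by
    rw [dot_three]
    fin_cases i <;> fin_cases a <;> simp [vectorsD3, vecD3, vecXZ] <;> field_simp <;> ring_nf <;>
      simp
  rcases h with h | h <;> simp [h]

lemma sum_weightsD3 (θ : ℝ) : ∑ a, weightsD3 θ a = 1 := by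
  simp [weightsD3, Fin.sum_univ_four]
  ring

lemma weightsD3_nonneg {θ : ℝ} (h : Real.sin θ ^ 2 ≤ 8 / 9) (a : Fin 4) : 0 ≤ weightsD3 θ a := by
  have h0 := sq_nonneg (Real.sin θ)
  fin_cases a <;> simp [weightsD3] <;> linarith

lemma frame_Z2 {θ φ : ℝ} (hs : Real.sin θ ≠ 0) (hc : Real.cos θ ≠ 0) (hp : Real.sin φ ≠ 0)
    (i j : Fin 3) :
    ∑ a, weightsZ2 θ φ a * vectorsZ2 θ φ a i * vectorsZ2 θ φ a j = if i = j then 1 else 0 := by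
  have hsc : Real.cos θ ^ 2 = 1 - Real.sin θ ^ 2 := Real.cos_sq' θ
  have hpp : Real.cos φ ^ 2 = 1 - Real.sin φ ^ 2 := Real.cos_sq' φ
  fin_cases i <;> fin_cases j <;>
    simp [weightsZ2, vectorsZ2, Fin.sum_univ_four] <;> field_simp <;> ring_nf
  all_goals try rw [hsc]
  all_goals try ring_nf
  all_goals try rw [hpp]
  all_goals try ring_nf

lemma abs_dot_vectorsZ2 {θ φ : ℝ} (hs : Real.sin θ ≠ 0) (hc : Real.cos θ ≠ 0)
    (hp : Real.sin φ ≠ 0) (i : Fin 3) (a : Fin 4) : |vectorsZ2 θ φ a ⬝ᵥ vecZ2 θ φ i| ≤ 1 := by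
  have h : vectorsZ2 θ φ a ⬝ᵥ vecZ2 θ φ i = 1 ∨ vectorsZ2 θ φ a ⬝ᵥ vecZ2 θ φ i = -1 := by
    rw [dot_three]
    fin_cases i <;> fin_cases a <;> simp [vectorsZ2, vecZ2, vecXZ, vecXZ'] <;> field_simp <;> ring_nf <;>
      simp
  rcases h with h | h <;> simp [h]

lemma sum_weightsZ2 (θ φ : ℝ) : ∑ a, weightsZ2 θ φ a = 1 := by
  simp [weightsZ2, Fin.sum_univ_four]
  linear_combination Real.sin_sq_add_cos_sq θ

lemma weightsZ2_nonneg {θ φ : ℝ} (h : |Real.cos φ| ≤ Real.sin θ) (a : Fin 4) :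
    0 ≤ weightsZ2 θ φ a := by
  have h0 := (abs_nonneg _).trans h
  rw [abs_le] at h
  fin_cases a <;> simp [weightsZ2]
  · positivity
  · exact mul_nonneg (by positivity) (by linarith)
  · exact mul_nonneg (by positivity) (by linarith)
  · positivity

lemma sum_sq_cuboidVec (θ φ : ℝ) : ∑ a, cuboidVec θ φ a ^ 2 = 1 := by
  simp [cuboidVec, Fin.sum_univ_three]
  linear_combination Real.sin θ ^ 2 * Real.sin_sq_add_cos_sq φ + Real.sin_sq_add_cos_sq θ

lemma cuboidVec_pos {θ φ : ℝ} (hθ : θ ∈ Set.Ioo 0 (Real.pi / 2)) (hφ : φ ∈ Set.Ioo 0 (Real.pi / 2))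
    (i : Fin 3) : 0 < cuboidVec θ φ i := by
  have h1 : 0 < Real.sin θ := Real.sin_pos_of_pos_of_lt_pi hθ.1 (by linarith [hθ.2, Real.pi_pos])
  have h2 : 0 < Real.sin φ := Real.sin_pos_of_pos_of_lt_pi hφ.1 (by linarith [hφ.2, Real.pi_pos])
  have h3 : 0 < Real.cos θ := Real.cos_pos_of_mem_Ioo ⟨by linarith [hθ.1, Real.pi_pos], hθ.2⟩
  have h4 : 0 < Real.cos φ := Real.cos_pos_of_mem_Ioo ⟨by linarith [hφ.1, Real.pi_pos], hφ.2⟩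
  fin_cases i <;> simp [cuboidVec] <;> positivity

lemma frame_cuboid {θ φ : ℝ} (h : ∀ i, cuboidVec θ φ i ≠ 0) (i j : Fin 3) :
    ∑ a, weightsCuboid θ φ a * vectorsCuboid θ φ a i * vectorsCuboid θ φ a j =
      if i = j then 1 else 0 := by
  simp only [weightsCuboid, vectorsCuboid]
  rw [Finset.sum_eq_single i]
  · rcases eq_or_ne i j with rfl | hij
    · have := h i
      simp
      field_simp
    · simp [hij, Ne.symm hij]
  · intro a _ ha
    simp [Ne.symm ha]
  · simp

lemma abs_dot_vectorsCuboid {θ φ : ℝ} (h : ∀ i, cuboidVec θ φ i ≠ 0) {r : Fin 3 → ℝ}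
    (hr : r ∈ cuboid (cuboidVec θ φ)) (a : Fin 3) : |vectorsCuboid θ φ a ⬝ᵥ r| ≤ 1 := by
  rw [vectorsCuboid, single_dotProduct]
  have := h a
  rcases hr a with h' | h' <;> rw [h']
  · rw [one_div_mul_cancel this, abs_one]
  · rw [mul_neg, one_div_mul_cancel this, abs_neg, abs_one]

/-! ### Constraints from non-negativity -/

lemma one_sub_blochOp (r : Fin 3 → ℝ) : 1 - blochOp r = blochOp (-r) := by
  rw [blochOp_eq, blochOp_eq]
  ext i j
  fin_cases i <;> fin_cases j <;> simp <;> ring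

lemma blochOp_mul_self {r : Fin 3 → ℝ} (hr : r ⬝ᵥ r = 1) : blochOp r * blochOp r = blochOp r := by
  have h : (r 0 : ℂ) ^ 2 + (r 1 : ℂ) ^ 2 + (r 2 : ℂ) ^ 2 = 1 := by
    rw [dot_self_three] at hr
    exact_mod_cast hr
  have hI := Complex.I_sq
  rw [blochOp_eq]
  ext i j
  fin_cases i <;> fin_cases j <;> simp [Matrix.mul_apply]
  · linear_combination h / 4 - (r 1 : ℂ) ^ 2 / 4 * hI
  · ring
  · ring
  · linear_combination h / 4 - (r 1 : ℂ) ^ 2 / 4 * hI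

lemma posSemidef_blochOp {r : Fin 3 → ℝ} (hr : r ⬝ᵥ r = 1) : (blochOp r).PosSemidef := by
  have h := Matrix.posSemidef_conjTranspose_mul_self (blochOp r)
  rwa [(isHermitian_blochOp r).eq, blochOp_mul_self hr] at h

lemma neg_dot_neg_self {r : Fin 3 → ℝ} (hr : r ⬝ᵥ r = 1) : -r ⬝ᵥ -r = 1 := by simpa using hr

lemma isState_blochOp {r : Fin 3 → ℝ} (hr : r ⬝ᵥ r = 1) : IsState (blochOp r) :=
  ⟨posSemidef_blochOp hr, trace_blochOp r⟩

lemma isEffect_blochOp {r : Fin 3 → ℝ} (hr : r ⬝ᵥ r = 1) : IsEffect (blochOp r) :=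
  ⟨posSemidef_blochOp hr, by rw [one_sub_blochOp]; exact posSemidef_blochOp (neg_dot_neg_self hr)⟩

namespace IsQuasiprobRep

variable {Λ : Type*} [MeasurableSpace Λ] {ν : Measure Λ} {F G : Λ → Op}

lemma trace_G (h : IsQuasiprobRep ν F G) (l : Λ) : (G l).trace.re = 1 := by
  have := h.complete 1 (fun _ => 1) ⟨fun _ => Matrix.PosSemidef.one, by simp⟩ l
  simpa [xi] using this

lemma xi_blochOp (h : IsQuasiprobRep ν F G) (r : Fin 3 → ℝ) (l : Λ) :
    xi G (blochOp r) l = (1 + r ⬝ᵥ blochVec (G l)) / 2 := by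
  rw [xi, trace_mul_re (isHermitian_blochOp r) (h.hermitian_G l), h.trace_G]
  simp

lemma mu_blochOp (h : IsQuasiprobRep ν F G) (r : Fin 3 → ℝ) (l : Λ) :
    mu F (blochOp r) l = ((F l).trace.re + r ⬝ᵥ blochVec (F l)) / 2 := by
  rw [mu, trace_mul_re (isHermitian_blochOp r) (h.hermitian_F l)]
  simp

/-- A non-negative state `P` satisfies `∫ μ_P (1 - ξ_P) = 1 - tr P² = 0` with a non-negative
integrand. -/
lemma mu_mul_one_sub_xi_ae (h : IsQuasiprobRep ν F G) {r : Fin 3 → ℝ} (hr : r ⬝ᵥ r = 1)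
    (hb : NonnegBasis F G (blochBasis r)) :
    ∀ᵐ l ∂ν, mu F (blochOp r) l * (1 - xi G (blochOp r) l) = 0 := by
  have hs := isState_blochOp hr
  have he := isEffect_blochOp hr
  have hp : blochOp r ∈ blochBasis r := Set.mem_insert _ _
  have hi : Integrable (fun l => mu F (blochOp r) l * (1 - xi G (blochOp r) l)) ν := by
    simp only [mul_sub, mul_one]
    exact (h.integrable_mu _ hs).sub (h.integrable_born _ _ hs he)
  have h0 : ∫ l, mu F (blochOp r) l * (1 - xi G (blochOp r) l) ∂ν = 0 := by
    simp only [mul_sub, mul_one]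
    rw [integral_sub (h.integrable_mu _ hs) (h.integrable_born _ _ hs he), h.normalized _ hs,
      h.born _ _ hs he, trace_blochOp_mul, hr]
    norm_num
  exact (integral_eq_zero_iff_of_nonneg (fun l => mul_nonneg (hb _ hp l).1
    (sub_nonneg.mpr (hb _ hp l).2.2)) hi).mp h0

/-- Where `F` has nonzero trace, the vector of `G` has scalar products `± 1` with the Bloch vectors
of a non-negative basis, and the vector of `F` has the same scalar products up to normalization. -/
lemma ae_of_nonnegBasis (h : IsQuasiprobRep ν F G) {r : Fin 3 → ℝ} (hr : r ⬝ᵥ r = 1)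
    (hb : NonnegBasis F G (blochBasis r)) :
    ∀ᵐ l ∂ν, 0 ≤ (F l).trace.re ∧
      (F l).trace.re * (r ⬝ᵥ blochVec (G l)) ^ 2 = (F l).trace.re ∧
      mu F (blochOp r) l - mu F (blochOp (-r)) l = (F l).trace.re * (r ⬝ᵥ blochVec (G l)) := by
  have hb' : NonnegBasis F G (blochBasis (-r)) := by rwa [blochBasis_neg]
  filter_upwards [h.mu_mul_one_sub_xi_ae hr hb,
    h.mu_mul_one_sub_xi_ae (neg_dot_neg_self hr) hb'] with l h1 h2
  have p1 := (hb _ (Set.mem_insert _ _) l).1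
  have p2 := (hb' _ (Set.mem_insert _ _) l).1
  rw [h.mu_blochOp, h.xi_blochOp] at h1 h2
  rw [h.mu_blochOp] at p1 p2
  rw [h.mu_blochOp, h.mu_blochOp]
  simp only [neg_dotProduct] at *
  refine ⟨by linarith, ?_, ?_⟩
  · linear_combination -2 * (1 + r ⬝ᵥ blochVec (G l)) * h1 - 2 * (1 - r ⬝ᵥ blochVec (G l)) * h2
  · linear_combination 2 * h1 - 2 * h2

lemma integrable_and_integral (h : IsQuasiprobRep ν F G) {r s : Fin 3 → ℝ} (hr : r ⬝ᵥ r = 1)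
    (hs : s ⬝ᵥ s = 1) (hb : NonnegBasis F G (blochBasis r)) :
    Integrable (fun l => (F l).trace.re * (r ⬝ᵥ blochVec (G l)) * (s ⬝ᵥ blochVec (G l))) ν ∧
      ∫ l, (F l).trace.re * (r ⬝ᵥ blochVec (G l)) * (s ⬝ᵥ blochVec (G l)) ∂ν = 2 * (r ⬝ᵥ s) := by
  have i1 := h.integrable_born _ _ (isState_blochOp hr) (isEffect_blochOp hs)
  have i2 := h.integrable_born _ _ (isState_blochOp (neg_dot_neg_self hr)) (isEffect_blochOp hs)
  have j1 := h.integrable_mu _ (isState_blochOp hr)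
  have j2 := h.integrable_mu _ (isState_blochOp (neg_dot_neg_self hr))
  have hae : (fun l => 2 * (mu F (blochOp r) l * xi G (blochOp s) l -
      mu F (blochOp (-r)) l * xi G (blochOp s) l) - (mu F (blochOp r) l - mu F (blochOp (-r)) l))
      =ᵐ[ν] fun l => (F l).trace.re * (r ⬝ᵥ blochVec (G l)) * (s ⬝ᵥ blochVec (G l)) := by
    filter_upwards [h.ae_of_nonnegBasis hr hb] with l hl
    rw [← hl.2.2, h.xi_blochOp]
    ring
  refine ⟨(((i1.sub i2).const_mul 2).sub (j1.sub j2)).congr hae, ?_⟩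
  rw [← integral_congr_ae hae, integral_sub (by exact (i1.sub i2).const_mul 2)
    (by exact j1.sub j2), integral_const_mul, integral_sub i1 i2, integral_sub j1 j2, h.normalized _ (isState_blochOp hr),
    h.normalized _ (isState_blochOp (neg_dot_neg_self hr)),
    h.born _ _ (isState_blochOp hr) (isEffect_blochOp hs),
    h.born _ _ (isState_blochOp (neg_dot_neg_self hr)) (isEffect_blochOp hs), trace_blochOp_mul,
    trace_blochOp_mul, neg_dotProduct]
  ring

lemma integrable_trace_F (h : IsQuasiprobRep ν F G) :
    Integrable (fun l => (F l).trace.re) ν ∧ ∫ l, (F l).trace.re ∂ν = 2 := by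
  have hz : (![0, 0, 1] : Fin 3 → ℝ) ⬝ᵥ ![0, 0, 1] = 1 := by simp
  have j1 := h.integrable_mu _ (isState_blochOp hz)
  have j2 := h.integrable_mu _ (isState_blochOp (neg_dot_neg_self hz))
  have he : (fun l => (F l).trace.re) =
      fun l => mu F (blochOp ![0, 0, 1]) l + mu F (blochOp (-![0, 0, 1])) l := by
    funext l
    rw [h.mu_blochOp, h.mu_blochOp, neg_dotProduct]
    ring
  rw [he]
  refine ⟨j1.add j2, ?_⟩
  rw [integral_add j1 j2, h.normalized _ (isState_blochOp hz),
    h.normalized _ (isState_blochOp (neg_dot_neg_self hz))]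
  norm_num

end IsQuasiprobRep

/-- The Bloch vectors of non-negative bases, read as `±1`-valued random variables under the
probability density `tr F / 2`, have the scalar products as correlations. So the probability that
three of them agree is non-negative; if it is positive, then there is a point where they agree,
which provides a vector with scalar products `± 1`. -/
lemma IsNonneg.exists_functional {B : Set (Set Op)} (hB : IsNonneg.{u} B)
    {r s t v : Fin 3 → ℝ} (hr : r ⬝ᵥ r = 1) (hs : s ⬝ᵥ s = 1) (ht : t ⬝ᵥ t = 1) (hv : v ⬝ᵥ v = 1)
    (hrB : blochBasis r ∈ B) (hsB : blochBasis s ∈ B) (htB : blochBasis t ∈ B)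
    (hvB : blochBasis v ∈ B) :
    0 ≤ 1 + r ⬝ᵥ s + r ⬝ᵥ t + s ⬝ᵥ t ∧
      (0 < 1 + r ⬝ᵥ s + r ⬝ᵥ t + s ⬝ᵥ t →
        ∃ d : Fin 3 → ℝ, r ⬝ᵥ d = 1 ∧ s ⬝ᵥ d = 1 ∧ t ⬝ᵥ d = 1 ∧ (v ⬝ᵥ d) ^ 2 = 1) := by
  obtain ⟨Λ, _, ν, F, G, h, hB⟩ := hB
  obtain ⟨i0, e0⟩ := h.integrable_trace_F
  obtain ⟨i1, e1⟩ := h.integrable_and_integral hr hs (hB _ hrB)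
  obtain ⟨i2, e2⟩ := h.integrable_and_integral hr ht (hB _ hrB)
  obtain ⟨i3, e3⟩ := h.integrable_and_integral hs ht (hB _ hsB)
  have hint : ∫ l, ((F l).trace.re + (F l).trace.re * (r ⬝ᵥ blochVec (G l)) * (s ⬝ᵥ blochVec (G l)) +
      (F l).trace.re * (r ⬝ᵥ blochVec (G l)) * (t ⬝ᵥ blochVec (G l)) +
      (F l).trace.re * (s ⬝ᵥ blochVec (G l)) * (t ⬝ᵥ blochVec (G l))) ∂ν =
      2 * (1 + r ⬝ᵥ s + r ⬝ᵥ t + s ⬝ᵥ t) := by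
    rw [integral_add (by exact (i0.add i1).add i2) i3, integral_add (by exact i0.add i1) i2,
      integral_add i0 i1,
      e0, e1, e2, e3]
    ring
  -- where the trace of `F` is nonzero, the three variables are signs
  have hsign : ∀ᵐ l ∂ν, ((F l).trace.re = 0 ∨ 0 < (F l).trace.re ∧ (r ⬝ᵥ blochVec (G l)) ^ 2 = 1 ∧
      (s ⬝ᵥ blochVec (G l)) ^ 2 = 1 ∧ (t ⬝ᵥ blochVec (G l)) ^ 2 = 1 ∧
      (v ⬝ᵥ blochVec (G l)) ^ 2 = 1) := by
    filter_upwards [h.ae_of_nonnegBasis hr (hB _ hrB), h.ae_of_nonnegBasis hs (hB _ hsB),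
      h.ae_of_nonnegBasis ht (hB _ htB), h.ae_of_nonnegBasis hv (hB _ hvB)] with l h1 h2 h3 h4
    rcases eq_or_ne (F l).trace.re 0 with h0 | h0
    · exact Or.inl h0
    · exact Or.inr ⟨lt_of_le_of_ne h1.1 h0.symm, mul_left_cancel₀ h0 (by rw [h1.2.1, mul_one]),
        mul_left_cancel₀ h0 (by rw [h2.2.1, mul_one]), mul_left_cancel₀ h0 (by rw [h3.2.1, mul_one]),
        mul_left_cancel₀ h0 (by rw [h4.2.1, mul_one])⟩
  constructor
  · have : 0 ≤ 2 * (1 + r ⬝ᵥ s + r ⬝ᵥ t + s ⬝ᵥ t) := by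
      rw [← hint]
      refine integral_nonneg_of_ae ?_
      filter_upwards [hsign] with l hl
      rcases hl with h0 | ⟨h0, hr1, hs1, ht1, -⟩
      · simp [h0]
      · rcases sq_eq_one_iff.mp hr1 with a | a <;> rcases sq_eq_one_iff.mp hs1 with b | b <;>
          rcases sq_eq_one_iff.mp ht1 with c | c <;> rw [Pi.zero_apply, a, b, c] <;> linarith
    linarith
  · intro hpos
    by_contra hne
    have : 2 * (1 + r ⬝ᵥ s + r ⬝ᵥ t + s ⬝ᵥ t) = 0 := by
      rw [← hint]
      refine integral_eq_zero_of_ae ?_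
      filter_upwards [hsign] with l hl
      rcases hl with h0 | ⟨h0, hr1, hs1, ht1, hv1⟩
      · simp [h0]
      · have hd : ∀ ε : ℝ, ε ^ 2 = 1 → ¬ (r ⬝ᵥ blochVec (G l) = ε ∧ s ⬝ᵥ blochVec (G l) = ε ∧
            t ⬝ᵥ blochVec (G l) = ε) := by
          rintro ε hε ⟨a, b, c⟩
          refine hne ⟨ε • blochVec (G l), ?_, ?_, ?_, ?_⟩ <;>
            rw [dotProduct_smul, smul_eq_mul] <;> nlinarith
        have hd1 := hd 1 (by norm_num)
        have hd2 := hd (-1) (by norm_num)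
        rcases sq_eq_one_iff.mp hr1 with a | a <;> rcases sq_eq_one_iff.mp hs1 with b | b <;>
          rcases sq_eq_one_iff.mp ht1 with c | c <;> rw [a, b, c] at hd1 hd2 ⊢ <;>
          first
          | exact absurd ⟨rfl, rfl, rfl⟩ hd1
          | exact absurd ⟨rfl, rfl, rfl⟩ hd2
          | (rw [Pi.zero_apply]; ring)
    linarith

/-! ### Gram matrices -/

lemma gram_det (r s t : Fin 3 → ℝ) : (Matrix.of ![r, s, t]).det ^ 2 =
    (r ⬝ᵥ r) * (s ⬝ᵥ s) * (t ⬝ᵥ t) + 2 * (r ⬝ᵥ s) * (r ⬝ᵥ t) * (s ⬝ᵥ t) -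
      (r ⬝ᵥ r) * (s ⬝ᵥ t) ^ 2 - (s ⬝ᵥ s) * (r ⬝ᵥ t) ^ 2 - (t ⬝ᵥ t) * (r ⬝ᵥ s) ^ 2 := by
  simp only [Matrix.det_fin_three, dot_three, Matrix.of_apply, Matrix.cons_val]
  ring

lemma eq_of_dot_sub {r s : Fin 3 → ℝ} (h : r ⬝ᵥ r - 2 * (r ⬝ᵥ s) + s ⬝ᵥ s = 0) : r = s := by
  have h' : (r - s) ⬝ᵥ (r - s) = 0 := by
    rw [sub_dotProduct, dotProduct_sub, dotProduct_sub, dotProduct_comm s r]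
    linarith
  exact sub_eq_zero.mp (dotProduct_self_eq_zero.mp h')

lemma dot_self_nonneg (r : Fin 3 → ℝ) : 0 ≤ r ⬝ᵥ r := by
  rw [dot_self_three]
  positivity

lemma abs_dot_lt_one {r s : Fin 3 → ℝ} (hr : r ⬝ᵥ r = 1) (hs : s ⬝ᵥ s = 1)
    (h : blochBasis r ≠ blochBasis s) : -1 < r ⬝ᵥ s ∧ r ⬝ᵥ s < 1 := by
  rw [Ne, blochBasis_eq_iff, not_or] at h
  have h1 := dot_self_nonneg (r - s)
  have h2 := dot_self_nonneg (r + s)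
  rw [sub_dotProduct, dotProduct_sub, dotProduct_sub, dotProduct_comm s r, hr, hs] at h1
  rw [add_dotProduct, dotProduct_add, dotProduct_add, dotProduct_comm s r, hr, hs] at h2
  constructor
  · refine lt_of_le_of_ne (by linarith) fun h' => h.2 (eq_of_dot_sub ?_)
    rw [dotProduct_neg, neg_dotProduct, dotProduct_neg, hr, hs]
    linarith
  · refine lt_of_le_of_ne (by linarith) fun h' => h.1 (eq_of_dot_sub ?_)
    rw [hr, hs]
    linarith

lemma eq_of_mulVec_eq {A R Q : Matrix (Fin 3) (Fin 3) ℝ} (hA : A.det ≠ 0)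
    (h : ∀ i, R *ᵥ A i = Q *ᵥ A i) : R = Q := by
  have hu : IsUnit Aᵀ.det := by rw [Matrix.det_transpose]; exact isUnit_iff_ne_zero.mpr hA
  have h1 : R * Aᵀ = Q * Aᵀ := by
    ext i j
    exact congrFun (h j) i
  calc R = R * Aᵀ * Aᵀ⁻¹ := by rw [Matrix.mul_assoc, Matrix.mul_nonsing_inv _ hu, mul_one]
    _ = Q := by rw [h1, Matrix.mul_assoc, Matrix.mul_nonsing_inv _ hu, mul_one]

lemma exists_combination {r s t : Fin 3 → ℝ} (h : (Matrix.of ![r, s, t]).det ≠ 0)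
    (v : Fin 3 → ℝ) : ∃ α β γ : ℝ, v = α • r + β • s + γ • t := by
  have hu : IsUnit (Matrix.of ![r, s, t])ᵀ.det := by
    rw [Matrix.det_transpose]; exact isUnit_iff_ne_zero.mpr h
  obtain ⟨c, hc⟩ : ∃ c, c = (Matrix.of ![r, s, t])ᵀ⁻¹ *ᵥ v := ⟨_, rfl⟩
  refine ⟨c 0, c 1, c 2, ?_⟩
  have hv : (Matrix.of ![r, s, t])ᵀ *ᵥ c = v := by
    rw [hc, Matrix.mulVec_mulVec, Matrix.mul_nonsing_inv _ hu, Matrix.one_mulVec]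
  rw [← hv]
  ext i
  simp [Matrix.mulVec, dotProduct, Fin.sum_univ_three]
  ring

/-- Rotations preserve scalar products and the orientation, hence the cross product. -/
lemma rot_cross (U : U2) (r s : Fin 3 → ℝ) :
    rot U *ᵥ (r ⨯₃ s) = (rot U *ᵥ r) ⨯₃ (rot U *ᵥ s) := by
  have h := det_rot_mulVec U (r ⨯₃ s) r s
  have e : ∀ u v w : Fin 3 → ℝ, (Matrix.of ![u, v, w]).det = u ⬝ᵥ v ⨯₃ w :=
    fun u v w => (triple_product_eq_det u v w).symm
  rw [e, e] at h
  refine eq_of_dot_sub ?_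
  rw [h, dot_rot, cross_dot_cross, cross_dot_cross, dot_rot, dot_rot, dot_rot, dot_rot]
  ring

/-- Two unitaries whose rotations agree on two linearly independent vectors differ by a phase. -/
lemma rot_eq_of_two {U V : U2} {r s : Fin 3 → ℝ} (h : (r ⬝ᵥ r) * (s ⬝ᵥ s) - (r ⬝ᵥ s) ^ 2 ≠ 0)
    (hr : rot U *ᵥ r = rot V *ᵥ r) (hs : rot U *ᵥ s = rot V *ᵥ s) : rot U = rot V := by
  refine eq_of_mulVec_eq (A := Matrix.of ![r, s, r ⨯₃ s]) (fun h0 => h ?_) fun i => ?_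
  · have := gram_det r s (r ⨯₃ s)
    rw [h0, dot_self_cross, dot_cross_self, cross_dot_cross, dotProduct_comm s r] at this
    have h2 : ((r ⬝ᵥ r) * (s ⬝ᵥ s) - (r ⬝ᵥ s) ^ 2) ^ 2 = 0 := by linear_combination -this
    exact pow_eq_zero_iff two_ne_zero |>.mp h2
  · fin_cases i
    · exact hr
    · exact hs
    · show rot U *ᵥ (r ⨯₃ s) = rot V *ᵥ (r ⨯₃ s)
      rw [rot_cross, rot_cross, hr, hs]

lemma unitaryEquiv_of_rot {ι : Type*} {v w : ι → Fin 3 → ℝ} (U : U2)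
    (h : ∀ i, rot U *ᵥ v i = w i ∨ rot U *ᵥ v i = -w i) :
    UnitaryEquiv (blochBasis '' Set.range v) (blochBasis '' Set.range w) := by
  refine ⟨U, ?_⟩
  rw [move_image_blochBasis, ← Set.range_comp, ← Set.range_comp, ← Set.range_comp]
  congr 1
  funext i
  exact blochBasis_eq_iff.mpr (h i)

lemma exists_rot_of_gram_three {r s t p q m : Fin 3 → ℝ} (hd : (Matrix.of ![r, s, t]).det ≠ 0)
    (h0 : r ⬝ᵥ r = p ⬝ᵥ p) (h1 : s ⬝ᵥ s = q ⬝ᵥ q) (h2 : t ⬝ᵥ t = m ⬝ᵥ m)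
    (h3 : r ⬝ᵥ s = p ⬝ᵥ q) (h4 : r ⬝ᵥ t = p ⬝ᵥ m) (h5 : s ⬝ᵥ t = q ⬝ᵥ m) :
    ∃ (U : U2) (ε : ℝ), (ε = 1 ∨ ε = -1) ∧ rot U *ᵥ r = ε • p ∧ rot U *ᵥ s = ε • q ∧
      rot U *ᵥ t = ε • m := by
  obtain ⟨U, ε, hε, h⟩ := exists_rot_of_gram (B := Matrix.of ![p, q, m]) hd (by
    ext i j
    have e : ∀ A : Matrix (Fin 3) (Fin 3) ℝ, (A * Aᵀ) i j = A i ⬝ᵥ A j := fun A => rfl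
    rw [e, e]
    have h3' : s ⬝ᵥ r = q ⬝ᵥ p := by rw [dotProduct_comm, h3, dotProduct_comm]
    have h4' : t ⬝ᵥ r = m ⬝ᵥ p := by rw [dotProduct_comm, h4, dotProduct_comm]
    have h5' : t ⬝ᵥ s = m ⬝ᵥ q := by rw [dotProduct_comm, h5, dotProduct_comm]
    fin_cases i <;> fin_cases j
    exacts [h0, h3, h4, h3', h1, h5, h4', h5', h2])
  exact ⟨U, ε, hε, h 0, h 1, h 2⟩

lemma eq_or_eq_neg_of_eq_smul {ε : ℝ} (hε : ε = 1 ∨ ε = -1) {r s : Fin 3 → ℝ} (h : r = ε • s) :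
    r = s ∨ r = -s := by
  rcases hε with rfl | rfl
  · left; simpa using h
  · right; simpa using h

lemma exists_rot_of_gram_two {r s p q : Fin 3 → ℝ} (h : (r ⬝ᵥ r) * (s ⬝ᵥ s) - (r ⬝ᵥ s) ^ 2 ≠ 0)
    (h0 : r ⬝ᵥ r = p ⬝ᵥ p) (h1 : s ⬝ᵥ s = q ⬝ᵥ q) (h3 : r ⬝ᵥ s = p ⬝ᵥ q) :
    ∃ (U : U2) (ε : ℝ), (ε = 1 ∨ ε = -1) ∧ rot U *ᵥ r = ε • p ∧ rot U *ᵥ s = ε • q := by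
  obtain ⟨U, ε, hε, a, b, -⟩ := exists_rot_of_gram_three (t := r ⨯₃ s) (m := p ⨯₃ q)
    (fun h' => h (by
      have := gram_det r s (r ⨯₃ s)
      rw [h', dot_self_cross, dot_cross_self, cross_dot_cross, dotProduct_comm s r] at this
      have h2 : ((r ⬝ᵥ r) * (s ⬝ᵥ s) - (r ⬝ᵥ s) ^ 2) ^ 2 = 0 := by linear_combination -this
      exact pow_eq_zero_iff two_ne_zero |>.mp h2))
    h0 h1 (by rw [cross_dot_cross, cross_dot_cross, h0, h1, h3, dotProduct_comm s r, h3,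
      dotProduct_comm q p]) h3 (by rw [dot_self_cross, dot_self_cross])
    (by rw [dot_cross_self, dot_cross_self])
  exact ⟨U, ε, hε, a, b⟩

/-! ### Sets of non-negative bases -/

/-- If three distinct axes were coplanar, then the product of the four probabilities in
`IsNonneg.exists_functional` would be a negative multiple of
`(1 - (r ⬝ s)²) (1 - (r ⬝ t)²) (1 - (s ⬝ t)²)`. -/
lemma IsNonneg.det_ne_zero {B : Set (Set Op)} (hB : IsNonneg.{u} B)
    {r s t : Fin 3 → ℝ} (hr : r ⬝ᵥ r = 1) (hs : s ⬝ᵥ s = 1) (ht : t ⬝ᵥ t = 1)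
    (hrB : blochBasis r ∈ B) (hsB : blochBasis s ∈ B) (htB : blochBasis t ∈ B)
    (hrs : blochBasis r ≠ blochBasis s) (hrt : blochBasis r ≠ blochBasis t)
    (hst : blochBasis s ≠ blochBasis t) : (Matrix.of ![r, s, t]).det ≠ 0 := by
  intro h0
  have hg := gram_det r s t
  have hs' := neg_dot_neg_self hs
  have ht' := neg_dot_neg_self ht
  have hsB' := hsB
  have htB' := htB
  rw [← blochBasis_neg] at hsB' htB'
  have c0 := (hB.exists_functional hr hs ht hr hrB hsB htB hrB).1
  have c1 := (hB.exists_functional hr hs ht' hr hrB hsB htB' hrB).1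
  have c2 := (hB.exists_functional hr hs' ht hr hrB hsB' htB hrB).1
  have c3 := (hB.exists_functional hr hs' ht' hr hrB hsB' htB' hrB).1
  obtain ⟨a1, a2⟩ := abs_dot_lt_one hr hs hrs
  obtain ⟨b1, b2⟩ := abs_dot_lt_one hr ht hrt
  obtain ⟨d1, d2⟩ := abs_dot_lt_one hs ht hst
  simp only [dotProduct_neg, neg_dotProduct, neg_neg] at c1 c2 c3
  rw [h0, hr, hs, ht] at hg
  generalize r ⬝ᵥ s = a at *
  generalize r ⬝ᵥ t = b at *
  generalize s ⬝ᵥ t = c at *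
  have hp : (1 + a + b + c) * (1 + a + -b + -c) * ((1 + -a + b + -c) * (1 + -a + -b + c)) =
      -4 * ((1 - a) * (1 + a) * ((1 - b) * (1 + b)) * ((1 - c) * (1 + c))) := by
    linear_combination
      -(5 - a ^ 2 - b ^ 2 - c ^ 2 - 2 * a * b * c) * hg
  have hpos : 0 < (1 - a) * (1 + a) * ((1 - b) * (1 + b)) * ((1 - c) * (1 + c)) := by
    have : 0 < 1 - a := by linarith
    have : 0 < 1 + a := by linarith
    have : 0 < 1 - b := by linarith
    have : 0 < 1 + b := by linarith
    have : 0 < 1 - c := by linarith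
    have : 0 < 1 + c := by linarith
    positivity
  have hnn := mul_nonneg (mul_nonneg c0 c1) (mul_nonneg c2 c3)
  linarith

lemma smul_dot_smul_self {ε : ℝ} (hε : ε = 1 ∨ ε = -1) {r : Fin 3 → ℝ} (hr : r ⬝ᵥ r = 1) :
    (ε • r) ⬝ᵥ (ε • r) = 1 := by
  rcases hε with rfl | rfl <;> simp [hr]

/-- Among four non-negative bases with distinct axes, the fourth Bloch vector is a signed sum of the
three others. Each pattern of relative signs of the first three that has a positive probability
yields an equation `(α ± β ± γ)² = 1` for the coefficients. As no three of the vectors are dependent,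
no coefficient vanishes, so the four equations do not all hold, and one pattern has probability
zero. Since the axes are distinct, any two patterns have a positive probability together, so the
other three equations do hold, and they force all coefficients to be `± 1`. -/
lemma IsNonneg.eq_signed_sum {B : Set (Set Op)} (hB : IsNonneg.{u} B)
    {r s t v : Fin 3 → ℝ} (hr : r ⬝ᵥ r = 1) (hs : s ⬝ᵥ s = 1) (ht : t ⬝ᵥ t = 1) (hv : v ⬝ᵥ v = 1)
    (hrB : blochBasis r ∈ B) (hsB : blochBasis s ∈ B) (htB : blochBasis t ∈ B)
    (hvB : blochBasis v ∈ B)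
    (hrs : blochBasis r ≠ blochBasis s) (hrt : blochBasis r ≠ blochBasis t)
    (hst : blochBasis s ≠ blochBasis t) (hrv : blochBasis r ≠ blochBasis v)
    (hsv : blochBasis s ≠ blochBasis v) (htv : blochBasis t ≠ blochBasis v) :
    ∃ α β γ : ℝ, (α = 1 ∨ α = -1) ∧ (β = 1 ∨ β = -1) ∧ (γ = 1 ∨ γ = -1) ∧
      v = α • r + β • s + γ • t := by
  have hd := hB.det_ne_zero hr hs ht hrB hsB htB hrs hrt hst
  obtain ⟨α, β, γ, hv'⟩ := exists_combination hd v
  have hα : α ≠ 0 := by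
    rintro rfl
    refine hB.det_ne_zero hs ht hv hsB htB hvB hst hsv htv ?_
    rw [hv', Matrix.det_fin_three]
    simp
    ring
  have hβ : β ≠ 0 := by
    rintro rfl
    refine hB.det_ne_zero hr ht hv hrB htB hvB hrt hrv htv ?_
    rw [hv', Matrix.det_fin_three]
    simp
    ring
  have hγ : γ ≠ 0 := by
    rintro rfl
    refine hB.det_ne_zero hr hs hv hrB hsB hvB hrs hrv hsv ?_
    rw [hv', Matrix.det_fin_three]
    simp
    ring
  have pat : ∀ σ τ : ℝ, (σ = 1 ∨ σ = -1) → (τ = 1 ∨ τ = -1) →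
      0 ≤ 1 + σ * (r ⬝ᵥ s) + τ * (r ⬝ᵥ t) + σ * τ * (s ⬝ᵥ t) ∧
      (0 < 1 + σ * (r ⬝ᵥ s) + τ * (r ⬝ᵥ t) + σ * τ * (s ⬝ᵥ t) →
        (α + β * σ + γ * τ) ^ 2 = 1) := by
    intro σ τ hσ hτ
    have h := hB.exists_functional hr (smul_dot_smul_self hσ hs) (smul_dot_smul_self hτ ht) hv hrB
      (by rwa [blochBasis_smul hσ]) (by rwa [blochBasis_smul hτ]) hvB
    have e : 1 + r ⬝ᵥ σ • s + r ⬝ᵥ τ • t + σ • s ⬝ᵥ τ • t =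
        1 + σ * (r ⬝ᵥ s) + τ * (r ⬝ᵥ t) + σ * τ * (s ⬝ᵥ t) := by
      simp only [dotProduct_smul, smul_dotProduct, smul_eq_mul]
      ring
    rw [e] at h
    refine ⟨h.1, fun hp => ?_⟩
    obtain ⟨d, d1, d2, d3, d4⟩ := h.2 hp
    rw [smul_dotProduct, smul_eq_mul] at d2 d3
    have hσ2 : σ * σ = 1 := mul_self_eq_one_iff.mpr hσ
    have hτ2 : τ * τ = 1 := mul_self_eq_one_iff.mpr hτ
    have d2' : s ⬝ᵥ d = σ := by linear_combination σ * d2 - s ⬝ᵥ d * hσ2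
    have d3' : t ⬝ᵥ d = τ := by linear_combination τ * d3 - t ⬝ᵥ d * hτ2
    rw [hv', add_dotProduct, add_dotProduct, smul_dotProduct, smul_dotProduct, smul_dotProduct, d1,
      d2', d3'] at d4
    simpa using d4
  obtain ⟨a1, a2⟩ := abs_dot_lt_one hr hs hrs
  obtain ⟨b1, b2⟩ := abs_dot_lt_one hr ht hrt
  obtain ⟨c1, c2⟩ := abs_dot_lt_one hs ht hst
  obtain ⟨p0, q0⟩ := pat 1 1 (Or.inl rfl) (Or.inl rfl)
  obtain ⟨p1, q1⟩ := pat 1 (-1) (Or.inl rfl) (Or.inr rfl)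
  obtain ⟨p2, q2⟩ := pat (-1) 1 (Or.inr rfl) (Or.inl rfl)
  obtain ⟨p3, q3⟩ := pat (-1) (-1) (Or.inr rfl) (Or.inr rfl)
  generalize r ⬝ᵥ s = a at *
  generalize r ⬝ᵥ t = b at *
  generalize s ⬝ᵥ t = c at *
  refine ⟨α, β, γ, ?_⟩
  rw [← sq_eq_one_iff, ← sq_eq_one_iff, ← sq_eq_one_iff]
  suffices h : α ^ 2 = 1 ∧ β ^ 2 = 1 ∧ γ ^ 2 = 1 from ⟨h.1, h.2.1, h.2.2, hv'⟩
  have zero : ∀ x y : ℝ, x ≠ 0 → x * y = 0 → y = 0 := fun x y hx h =>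
    (mul_eq_zero.mp h).resolve_left hx
  rcases p0.eq_or_lt with e0 | e0
  · have f1 := q1 (by linarith)
    have f2 := q2 (by linarith)
    have f3 := q3 (by linarith)
    have g1 := zero α (β - γ) hα (by linear_combination (f1 - f2) / 4)
    have g2 := zero β (α - γ) hβ (by linear_combination (f1 - f3) / 4)
    have k1 : β = γ := by linarith
    have k2 : α = γ := by linarith
    subst k1 k2
    have : α ^ 2 = 1 := by linear_combination f1
    exact ⟨this, this, this⟩
  · have f0 := q0 e0
    rcases p1.eq_or_lt with e1 | e1
    · have f2 := q2 (by linarith)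
      have f3 := q3 (by linarith)
      have g1 := zero α (β + γ) hα (by linear_combination (f0 - f3) / 4)
      have g2 := zero β (α + γ) hβ (by linear_combination (f0 - f2) / 4)
      have k1 : β = -γ := by linarith
      have k2 : α = -γ := by linarith
      subst k1 k2
      have : γ ^ 2 = 1 := by linear_combination f0
      simpa using this
    · have f1 := q1 e1
      rcases p2.eq_or_lt with e2 | e2
      · have f3 := q3 (by linarith)
        have g1 := zero α (β + γ) hα (by linear_combination (f0 - f3) / 4)
        have g2 := zero γ (α + β) hγ (by linear_combination (f0 - f1) / 4)
        have k1 : γ = -β := by linarith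
        have k2 : α = -β := by linarith
        subst k1 k2
        have : β ^ 2 = 1 := by linear_combination f0
        simpa using this
      · have f2 := q2 e2
        rcases p3.eq_or_lt with e3 | e3
        · have g1 := zero β (α + γ) hβ (by linear_combination (f0 - f2) / 4)
          have g2 := zero γ (α + β) hγ (by linear_combination (f0 - f1) / 4)
          have k1 : γ = -α := by linarith
          have k2 : β = -α := by linarith
          subst k1 k2
          have : α ^ 2 = 1 := by linear_combination f0
          simpa using this
        · have f3 := q3 e3
          have g := zero α β hα (by linear_combination (f0 + f1 - f2 - f3) / 8)
          exact absurd g hβ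

/-- The four vertices of a cuboid that represent its space diagonals; they sum to zero. -/
def tetra (c : Fin 3 → ℝ) : Fin 4 → Fin 3 → ℝ :=
  ![![c 0, c 1, c 2], ![c 0, -c 1, -c 2], ![-c 0, c 1, -c 2], ![-c 0, -c 1, c 2]]

lemma image_cuboid (c : Fin 3 → ℝ) :
    blochBasis '' cuboid c = blochBasis '' Set.range (tetra c) := by
  have e : ∀ v : Fin 3 → ℝ, ![v 0, v 1, v 2] = v := fun v => by
    ext i; fin_cases i <;> rfl
  apply Set.Subset.antisymm
  · rintro _ ⟨v, hv, rfl⟩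
    suffices h : ∃ i, v = tetra c i ∨ v = -tetra c i by
      obtain ⟨i, h⟩ := h
      exact ⟨tetra c i, ⟨i, rfl⟩, (blochBasis_eq_iff.mpr h).symm⟩
    rw [← e v]
    rcases hv 0 with h0 | h0 <;> rcases hv 1 with h1 | h1 <;> rcases hv 2 with h2 | h2 <;>
      rw [h0, h1, h2]
    · exact ⟨0, Or.inl (by simp [tetra])⟩
    · exact ⟨3, Or.inr (by simp [tetra])⟩
    · exact ⟨2, Or.inr (by simp [tetra])⟩
    · exact ⟨1, Or.inl (by simp [tetra])⟩
    · exact ⟨1, Or.inr (by simp [tetra])⟩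
    · exact ⟨2, Or.inl (by simp [tetra])⟩
    · exact ⟨3, Or.inl (by simp [tetra])⟩
    · exact ⟨0, Or.inr (by simp [tetra])⟩
  · rintro _ ⟨_, ⟨i, rfl⟩, rfl⟩
    refine ⟨_, fun j => ?_, rfl⟩
    fin_cases i <;> fin_cases j <;> simp [tetra]

lemma sin_pos_of_mem {θ : ℝ} (hθ : θ ∈ Set.Ioo 0 (Real.pi / 2)) : 0 < Real.sin θ :=
  Real.sin_pos_of_pos_of_lt_pi hθ.1 (by linarith [hθ.2, Real.pi_pos])

lemma cos_pos_of_mem {θ : ℝ} (hθ : θ ∈ Set.Ioo 0 (Real.pi / 2)) : 0 < Real.cos θ :=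
  Real.cos_pos_of_mem_Ioo ⟨by linarith [hθ.1, Real.pi_pos], hθ.2⟩

lemma arccos_mem {x : ℝ} (h0 : 0 < x) (h1 : x < 1) : Real.arccos x ∈ Set.Ioo 0 (Real.pi / 2) :=
  ⟨Real.arccos_pos.mpr h1, Real.arccos_lt_pi_div_two.mpr h0⟩

lemma exists_cuboidVec_eq {c : Fin 3 → ℝ} (hc : ∀ i, 0 < c i) (h : c 0 ^ 2 + c 1 ^ 2 + c 2 ^ 2 = 1) :
    ∃ θ ∈ Set.Ioo 0 (Real.pi / 2), ∃ φ ∈ Set.Ioo 0 (Real.pi / 2), cuboidVec θ φ = c := by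
  have h0 := hc 0
  have h1 := hc 1
  have h2 := hc 2
  have hθ := arccos_mem h2 (by nlinarith)
  have hcθ : Real.cos (Real.arccos (c 2)) = c 2 := Real.cos_arccos (by linarith) (by nlinarith)
  obtain ⟨θ, rfl⟩ : ∃ θ, θ = Real.arccos (c 2) := ⟨_, rfl⟩
  have hs := sin_pos_of_mem hθ
  have hs2 := Real.sin_sq_add_cos_sq (Real.arccos (c 2))
  generalize Real.arccos (c 2) = θ at *
  have hlt : c 0 < Real.sin θ := by
    refine lt_of_pow_lt_pow_left₀ 2 hs.le ?_
    rw [hcθ] at hs2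
    nlinarith
  have hφ := arccos_mem (div_pos h0 hs) ((div_lt_one hs).mpr hlt)
  have hcφ : Real.cos (Real.arccos (c 0 / Real.sin θ)) = c 0 / Real.sin θ :=
    Real.cos_arccos (by linarith [div_pos h0 hs]) ((div_lt_one hs).mpr hlt).le
  have hsφ := sin_pos_of_mem hφ
  have hsφ2 := Real.sin_sq_add_cos_sq (Real.arccos (c 0 / Real.sin θ))
  generalize Real.arccos (c 0 / Real.sin θ) = φ at *
  have e0 : Real.cos φ * Real.sin θ = c 0 := by rw [hcφ, div_mul_cancel₀ _ hs.ne']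
  refine ⟨θ, hθ, φ, hφ, ?_⟩
  have e1 : Real.sin φ * Real.sin θ = c 1 := by
    refine (pow_left_inj₀ (by positivity) h1.le two_ne_zero).mp ?_
    rw [hcθ] at hs2
    linear_combination Real.sin θ ^ 2 * hsφ2 + hs2 - h - (Real.cos φ * Real.sin θ + c 0) * e0
  ext i
  fin_cases i <;> simp [cuboidVec, e0, e1, hcθ]

/-- Four unit vectors on distinct axes that sum to zero are, after a rotation and up to a common
sign, half the vertices of a cuboid: the three sums of two of them are orthogonal. -/
lemma exists_cuboid_of_sum_zero {v : Fin 4 → Fin 3 → ℝ} (hu : ∀ i, v i ⬝ᵥ v i = 1)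
    (hd : (Matrix.of ![v 0, v 1, v 2]).det ≠ 0)
    (h01 : -1 < v 0 ⬝ᵥ v 1) (h02 : -1 < v 0 ⬝ᵥ v 2) (h03 : -1 < v 0 ⬝ᵥ v 3)
    (hs : v 0 + v 1 + v 2 + v 3 = 0) :
    ∃ θ ∈ Set.Ioo 0 (Real.pi / 2), ∃ φ ∈ Set.Ioo 0 (Real.pi / 2),
      UnitaryEquiv (blochBasis '' Set.range v) (cuboidBases θ φ) := by
  have h3 : v 3 = -(v 0 + v 1 + v 2) := by
    rw [eq_neg_iff_add_eq_zero, ← hs]; abel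
  have e3 := hu 3
  have e03 : v 0 ⬝ᵥ v 3 = -(1 + v 0 ⬝ᵥ v 1 + v 0 ⬝ᵥ v 2) := by
    rw [h3, dotProduct_neg, dotProduct_add, dotProduct_add, hu]
  have e12 : v 1 ⬝ᵥ v 2 = v 0 ⬝ᵥ v 3 := by
    rw [e03]
    rw [h3] at e3
    simp only [neg_dotProduct, dotProduct_neg, add_dotProduct, dotProduct_add, hu,
      dotProduct_comm (v 1) (v 0), dotProduct_comm (v 2) (v 0), dotProduct_comm (v 2) (v 1)] at e3
    linarith
  obtain ⟨c, hc⟩ : ∃ c : Fin 3 → ℝ, c = ![√((1 + v 0 ⬝ᵥ v 1) / 2), √((1 + v 0 ⬝ᵥ v 2) / 2),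
      √((1 + v 0 ⬝ᵥ v 3) / 2)] := ⟨_, rfl⟩
  have p0 : 0 < c 0 := by rw [hc]; exact Real.sqrt_pos.mpr (by linarith)
  have p1 : 0 < c 1 := by rw [hc]; exact Real.sqrt_pos.mpr (by linarith)
  have p2 : 0 < c 2 := by rw [hc]; exact Real.sqrt_pos.mpr (by linarith)
  have s0 : c 0 ^ 2 = (1 + v 0 ⬝ᵥ v 1) / 2 := by rw [hc]; exact Real.sq_sqrt (by linarith)
  have s1 : c 1 ^ 2 = (1 + v 0 ⬝ᵥ v 2) / 2 := by rw [hc]; exact Real.sq_sqrt (by linarith)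
  have s2 : c 2 ^ 2 = (1 + v 0 ⬝ᵥ v 3) / 2 := by rw [hc]; exact Real.sq_sqrt (by linarith)
  obtain ⟨θ, hθ, φ, hφ, hcv⟩ := exists_cuboidVec_eq (c := c)
    (fun i => by fin_cases i <;> assumption) (by linarith)
  refine ⟨θ, hθ, φ, hφ, ?_⟩
  have t01 : tetra c 0 ⬝ᵥ tetra c 1 = c 0 ^ 2 - c 1 ^ 2 - c 2 ^ 2 := by simp [tetra]; ring
  have t02 : tetra c 0 ⬝ᵥ tetra c 2 = c 1 ^ 2 - c 0 ^ 2 - c 2 ^ 2 := by simp [tetra]; ring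
  have t12 : tetra c 1 ⬝ᵥ tetra c 2 = c 2 ^ 2 - c 0 ^ 2 - c 1 ^ 2 := by simp [tetra]; ring
  obtain ⟨U, ε, hε, u0, u1, u2⟩ := exists_rot_of_gram_three (p := tetra c 0) (q := tetra c 1)
    (m := tetra c 2) hd
    (by rw [hu]; simp [tetra]; linarith)
    (by rw [hu]; simp [tetra]; linarith)
    (by rw [hu]; simp [tetra]; linarith)
    (by rw [t01]; linarith) (by rw [t02]; linarith) (by rw [t12, e12]; linarith)
  have ht : tetra c 3 = -(tetra c 0 + tetra c 1 + tetra c 2) := by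
    ext i; fin_cases i <;> simp [tetra]
  have u3 : rot U *ᵥ v 3 = ε • tetra c 3 := by
    rw [h3, ht, Matrix.mulVec_neg, Matrix.mulVec_add, Matrix.mulVec_add, u0, u1, u2, smul_neg,
      smul_add, smul_add]
  rw [cuboidBases_eq, hcv, image_cuboid]
  refine unitaryEquiv_of_rot U fun i => ?_
  fin_cases i
  exacts [eq_or_eq_neg_of_eq_smul hε u0, eq_or_eq_neg_of_eq_smul hε u1,
    eq_or_eq_neg_of_eq_smul hε u2, eq_or_eq_neg_of_eq_smul hε u3]

/-! ### Symmetric sets of one, two and three bases -/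

lemma phases_le_symmetryGroup (B : Set (Set Op)) : phases ≤ symmetryGroup B := by
  intro U hU
  have h : conj U = id := funext fun P => conj_of_mem_phases hU P
  show move U B = B
  simp [move, h]

lemma hasNontrivialSymmetry_iff {B : Set (Set Op)} :
    HasNontrivialSymmetry B ↔ ∃ U ∈ symmetryGroup B, U ∉ phases :=
  ⟨fun ⟨_, hH, U, hU, h⟩ => ⟨U, hH U hU, h⟩,
    fun h => ⟨symmetryGroup B, fun _ hU => hU, h⟩⟩

/-- If the three scalar products differ in absolute value, then a symmetry fixes the three axes, and
it cannot reverse one of them but not another, as they are not orthogonal. -/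
lemma exists_abs_dot_eq_of_symmetry {v : Fin 3 → Fin 3 → ℝ} (hu : ∀ i, v i ⬝ᵥ v i = 1)
    (hd : (Matrix.of v).det ≠ 0) (hlt : ∀ i j, i ≠ j → (v i ⬝ᵥ v j) ^ 2 < 1) {U : U2}
    (hU : U ∈ symmetryGroup (blochBasis '' Set.range v)) (hU' : U ∉ phases) :
    (v 0 ⬝ᵥ v 1) ^ 2 = (v 0 ⬝ᵥ v 2) ^ 2 ∨ (v 0 ⬝ᵥ v 1) ^ 2 = (v 1 ⬝ᵥ v 2) ^ 2 ∨
      (v 0 ⬝ᵥ v 2) ^ 2 = (v 1 ⬝ᵥ v 2) ^ 2 := by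
  by_contra hne
  simp only [not_or] at hne
  obtain ⟨n1, n2, n3⟩ := hne
  have hp : ∀ i, ∃ j, ∃ e : ℝ, (e = 1 ∨ e = -1) ∧ rot U *ᵥ v i = e • v j := by
    intro i
    obtain ⟨_, ⟨j, rfl⟩, h | h⟩ := exists_eq_or_eq_neg_of_mem_symmetryGroup hU (Set.mem_range_self i)
    · exact ⟨j, 1, Or.inl rfl, by rw [h, one_smul]⟩
    · exact ⟨j, -1, Or.inr rfl, by rw [h, neg_one_smul]⟩
  choose p e he hp using hp
  have he2 : ∀ i, e i * e i = 1 := fun i => mul_self_eq_one_iff.mpr (he i)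
  have hdot : ∀ i j, e i * e j * (v (p i) ⬝ᵥ v (p j)) = v i ⬝ᵥ v j := by
    intro i j
    rw [← dot_rot U (v i) (v j), hp, hp, smul_dotProduct, dotProduct_smul, smul_eq_mul,
      smul_eq_mul, mul_assoc]
  have hsq : ∀ i j, (v (p i) ⬝ᵥ v (p j)) ^ 2 = (v i ⬝ᵥ v j) ^ 2 := by
    intro i j
    rw [← hdot i j]
    linear_combination (-(v (p i) ⬝ᵥ v (p j)) ^ 2 * (e j * e j)) * he2 i -
      (v (p i) ⬝ᵥ v (p j)) ^ 2 * he2 j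
  have l1 := (hlt 0 1 (by decide)).ne
  have l2 := (hlt 0 2 (by decide)).ne
  have l3 := (hlt 1 2 (by decide)).ne
  have d01 := hdot 0 1
  have d02 := hdot 0 2
  have d12 := hdot 1 2
  have c : ∀ i : Fin 3, i = 0 ∨ i = 1 ∨ i = 2 := by decide
  have hid : p 0 = 0 ∧ p 1 = 1 ∧ p 2 = 2 := by
    have q1 := hsq 0 1
    have q2 := hsq 0 2
    have q3 := hsq 1 2
    rcases c (p 0) with h0 | h0 | h0 <;> rcases c (p 1) with h1 | h1 | h1 <;>
      rcases c (p 2) with h2 | h2 | h2 <;> rw [h0, h1] at q1 <;> rw [h0, h2] at q2 <;>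
      rw [h1, h2] at q3 <;>
      simp only [hu, dotProduct_comm (v 1) (v 0), dotProduct_comm (v 2) (v 0),
        dotProduct_comm (v 2) (v 1)] at q1 q2 q3 <;>
      first
      | exact ⟨h0, h1, h2⟩
      | exact absurd q1 n1
      | exact absurd q1.symm n1
      | exact absurd q1 n2
      | exact absurd q1.symm n2
      | exact absurd q2 n1
      | exact absurd q2.symm n1
      | exact absurd q2 n3
      | exact absurd q2.symm n3
      | (exfalso; rw [one_pow] at q1; exact l1 q1.symm)
      | (exfalso; rw [one_pow] at q2; exact l2 q2.symm)
  obtain ⟨h0, h1, h2⟩ := hid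
  rw [h0, h1] at d01
  rw [h0, h2] at d02
  rw [h1, h2] at d12
  -- the signs agree for a pair of axes that are not orthogonal
  have key : ∀ i j : Fin 3, e i * e j * (v i ⬝ᵥ v j) = v i ⬝ᵥ v j → v i ⬝ᵥ v j ≠ 0 → e i = e j := by
    intro i j h hne
    have : e i * e j = 1 := mul_right_cancel₀ hne (by rw [h, one_mul])
    linear_combination e j * this - e i * he2 j
  have hall : e 1 = e 0 ∧ e 2 = e 0 := by
    by_cases z01 : v 0 ⬝ᵥ v 1 = 0
    · have z02 : v 0 ⬝ᵥ v 2 ≠ 0 := fun h => n1 (by rw [z01, h])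
      have z12 : v 1 ⬝ᵥ v 2 ≠ 0 := fun h => n2 (by rw [z01, h])
      have k1 := key 0 2 d02 z02
      have k2 := key 1 2 d12 z12
      exact ⟨k2.trans k1.symm, k1.symm⟩
    · have k := key 0 1 d01 z01
      by_cases z02 : v 0 ⬝ᵥ v 2 = 0
      · have z12 : v 1 ⬝ᵥ v 2 ≠ 0 := fun h => n3 (by rw [z02, h])
        exact ⟨k.symm, (key 1 2 d12 z12).symm.trans k.symm⟩
      · exact ⟨k.symm, (key 0 2 d02 z02).symm⟩
  have hR : ∀ i, rot U *ᵥ v i = e 0 • v i := by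
    intro i
    rcases c i with rfl | rfl | rfl
    · rw [hp, h0]
    · rw [hp, h1, hall.1]
    · rw [hp, h2, hall.2]
  have hRe : rot U = e 0 • 1 := eq_of_mulVec_eq hd fun i => by
    rw [Matrix.smul_mulVec, Matrix.one_mulVec]
    exact hR i
  rcases he 0 with h | h
  · exact hU' (mem_phases_iff.mpr (by rw [hRe, h, one_smul]))
  · have := det_rot U
    rw [hRe, h, Matrix.det_smul, Matrix.det_one, Fintype.card_fin] at this
    norm_num at this

/-- Three independent unit vectors, two of which make opposite angles with the third. -/
lemma exists_Z2_of_dot {r s t : Fin 3 → ℝ} (hr : r ⬝ᵥ r = 1) (hs : s ⬝ᵥ s = 1) (ht : t ⬝ᵥ t = 1)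
    (hd : (Matrix.of ![r, s, t]).det ≠ 0) (hrs : -1 < r ⬝ᵥ s ∧ r ⬝ᵥ s < 1)
    (h : r ⬝ᵥ t = -(s ⬝ᵥ t)) (c0 : 0 ≤ 1 - r ⬝ᵥ s + 2 * (r ⬝ᵥ t))
    (c1 : 0 ≤ 1 - r ⬝ᵥ s - 2 * (r ⬝ᵥ t)) :
    ∃ θ ∈ Set.Ioo 0 (Real.pi / 2), ∃ φ ∈ Set.Ioo 0 Real.pi, |Real.cos φ| ≤ Real.sin θ ∧
      UnitaryEquiv (blochBasis '' Set.range ![r, s, t]) (threeBasesZ2 θ φ) := by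
  have hg := gram_det r s t
  have hpos : 0 < (Matrix.of ![r, s, t]).det ^ 2 := by positivity
  rw [hg, hr, hs, ht, h] at hpos
  obtain ⟨θ, hθdef⟩ : ∃ θ, θ = Real.arccos (r ⬝ᵥ s) / 2 := ⟨_, rfl⟩
  have hθ : θ ∈ Set.Ioo 0 (Real.pi / 2) := by
    have h1 := Real.arccos_pos.mpr hrs.2
    have h2 : Real.arccos (r ⬝ᵥ s) < Real.pi := by
      refine lt_of_le_of_ne (Real.arccos_le_pi _) fun h' => ?_
      rw [Real.arccos_eq_pi] at h'
      linarith
    constructor <;> linarith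
  have hc2 : Real.cos (2 * θ) = r ⬝ᵥ s := by
    rw [hθdef, mul_div_cancel₀ _ two_ne_zero, Real.cos_arccos hrs.1.le hrs.2.le]
  have hsin := sin_pos_of_mem hθ
  have hsc := Real.sin_sq_add_cos_sq θ
  have hs2 : r ⬝ᵥ s = 1 - 2 * Real.sin θ ^ 2 := by rw [← hc2, Real.cos_two_mul]; linarith
  have hlt : (s ⬝ᵥ t) ^ 2 < Real.sin θ ^ 2 := by
    rw [hs2] at hpos
    have h1 : 0 < Real.sin θ ^ 2 := by positivity
    have h2 : 0 < Real.cos θ ^ 2 := by nlinarith [hrs.1]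
    have : 0 < 4 * (1 - Real.sin θ ^ 2) * (Real.sin θ ^ 2 - (s ⬝ᵥ t) ^ 2) := by nlinarith
    by_contra hle
    nlinarith
  have hle : |(r ⬝ᵥ t) / Real.sin θ| < 1 := by
    rw [abs_div, abs_of_pos hsin, div_lt_one hsin]
    rw [← sq_lt_sq₀ (abs_nonneg _) hsin.le, sq_abs, h]
    linarith
  rw [abs_lt] at hle
  have hφ : Real.arccos (r ⬝ᵥ t / Real.sin θ) ∈ Set.Ioo 0 Real.pi := by
    refine ⟨Real.arccos_pos.mpr hle.2, lt_of_le_of_ne (Real.arccos_le_pi _) fun h' => ?_⟩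
    rw [Real.arccos_eq_pi] at h'
    linarith
  have hcφ : Real.cos (Real.arccos (r ⬝ᵥ t / Real.sin θ)) = r ⬝ᵥ t / Real.sin θ :=
    Real.cos_arccos hle.1.le hle.2.le
  generalize Real.arccos (r ⬝ᵥ t / Real.sin θ) = φ at *
  have hm : Real.sin θ * Real.cos φ = r ⬝ᵥ t := by rw [hcφ, mul_div_cancel₀ _ hsin.ne']
  have hφ2 := Real.sin_sq_add_cos_sq φ
  refine ⟨θ, hθ, φ, hφ, ?_, ?_⟩
  · rw [abs_le]
    rw [hs2, ← hm] at c0 c1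
    constructor
    · by_contra! hc
      nlinarith
    · by_contra! hc
      nlinarith
  · obtain ⟨U, ε, hε, u0, u1, u2⟩ := exists_rot_of_gram_three (p := vecZ2 θ φ 0) (q := vecZ2 θ φ 1)
      (m := vecZ2 θ φ 2) hd
      (by rw [hr]; simp [vecZ2, vecXZ, vecXZ']; linarith)
      (by rw [hs]; simp [vecZ2, vecXZ, vecXZ']; linarith)
      (by rw [ht]; simp [vecZ2, vecXZ, vecXZ']; linarith)
      (by rw [hs2]; simp [vecZ2, vecXZ, vecXZ']; linarith)
      (by rw [← hm]; simp [vecZ2, vecXZ, vecXZ'])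
      (by rw [← neg_eq_iff_eq_neg.mpr h, ← hm]; simp [vecZ2, vecXZ, vecXZ'])
    rw [threeBasesZ2_eq]
    refine unitaryEquiv_of_rot U fun i => ?_
    fin_cases i
    exacts [eq_or_eq_neg_of_eq_smul hε u0, eq_or_eq_neg_of_eq_smul hε u1,
      eq_or_eq_neg_of_eq_smul hε u2]

lemma exists_twoBases {r s : Fin 3 → ℝ} (hr : r ⬝ᵥ r = 1) (hs : s ⬝ᵥ s = 1)
    (hrs : -1 < r ⬝ᵥ s ∧ r ⬝ᵥ s < 1) :
    ∃ θ ∈ Set.Ioo 0 (Real.pi / 2), UnitaryEquiv (blochBasis '' Set.range ![r, s]) (twoBases θ) := by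
  have h1 := Real.arccos_pos.mpr hrs.2
  have h2 : Real.arccos (r ⬝ᵥ s) < Real.pi := by
    refine lt_of_le_of_ne (Real.arccos_le_pi _) fun h' => ?_
    rw [Real.arccos_eq_pi] at h'
    linarith
  obtain ⟨θ, hθ⟩ : ∃ θ, θ = Real.arccos (r ⬝ᵥ s) / 2 := ⟨_, rfl⟩
  have hc2 : Real.cos (2 * θ) = r ⬝ᵥ s := by
    rw [hθ, mul_div_cancel₀ _ two_ne_zero, Real.cos_arccos hrs.1.le hrs.2.le]
  have hsc := Real.sin_sq_add_cos_sq θ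
  rw [Real.cos_two_mul] at hc2
  refine ⟨θ, ⟨by linarith, by linarith⟩, ?_⟩
  obtain ⟨U, ε, hε, u0, u1⟩ := exists_rot_of_gram_two (p := vecXZ θ)
    (q := vecXZ' θ) (r := r) (s := s)
    (by rw [hr, hs]; nlinarith [hrs.1, hrs.2])
    (by rw [hr]; simp [vecXZ]; linarith)
    (by rw [hs]; simp [vecXZ']; linarith)
    (by rw [← hc2]; simp [vecXZ, vecXZ']; linarith)
  have e : ({vecXZ θ, vecXZ' θ} : Set (Fin 3 → ℝ)) = Set.range ![vecXZ θ, vecXZ' θ] := by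
    simp [Set.pair_comm]
  rw [twoBases_eq, e]
  refine unitaryEquiv_of_rot U fun i => ?_
  fin_cases i
  exacts [eq_or_eq_neg_of_eq_smul hε u0, eq_or_eq_neg_of_eq_smul hε u1]

/-! ### The list is exhaustive -/

lemma image_range_two (r s : Fin 3 → ℝ) :
    blochBasis '' Set.range ![r, s] = {blochBasis r, blochBasis s} := by
  ext b
  simp [eq_comm]
  tauto

lemma image_range_three (r s t : Fin 3 → ℝ) :
    blochBasis '' Set.range ![r, s, t] = {blochBasis r, blochBasis s, blochBasis t} := by
  ext b
  simp [eq_comm]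
  tauto

lemma image_range_four (r s t v : Fin 3 → ℝ) : blochBasis '' Set.range ![r, s, t, v] =
    {blochBasis r, blochBasis s, blochBasis t, blochBasis v} := by
  ext b
  simp [eq_comm]
  tauto

/-- Three non-negative bases, two of which make the same angle with the third. -/
lemma exists_Z2_of_sq {B : Set (Set Op)} (hB : IsNonneg.{u} B)
    {r s t : Fin 3 → ℝ} (hr : r ⬝ᵥ r = 1) (hs : s ⬝ᵥ s = 1) (ht : t ⬝ᵥ t = 1)
    (hrB : blochBasis r ∈ B) (hsB : blochBasis s ∈ B) (htB : blochBasis t ∈ B)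
    (hrs : blochBasis r ≠ blochBasis s) (hrt : blochBasis r ≠ blochBasis t)
    (hst : blochBasis s ≠ blochBasis t) (h : (r ⬝ᵥ t) ^ 2 = (s ⬝ᵥ t) ^ 2) :
    ∃ θ ∈ Set.Ioo 0 (Real.pi / 2), ∃ φ ∈ Set.Ioo 0 Real.pi, |Real.cos φ| ≤ Real.sin θ ∧
      UnitaryEquiv {blochBasis r, blochBasis s, blochBasis t} (threeBasesZ2 θ φ) := by
  -- the Bloch vector of one basis may be replaced by its negative
  obtain ⟨s', hs', hb, h'⟩ : ∃ s', s' ⬝ᵥ s' = 1 ∧ blochBasis s' = blochBasis s ∧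
      r ⬝ᵥ t = -(s' ⬝ᵥ t) := by
    rcases sq_eq_sq_iff_eq_or_eq_neg.mp h with h | h
    · exact ⟨-s, neg_dot_neg_self hs, blochBasis_neg s, by rw [neg_dotProduct, neg_neg, h]⟩
    · exact ⟨s, hs, rfl, h⟩
  rw [← hb] at hrs hst hsB ⊢
  have ht' := neg_dot_neg_self ht
  have htB' := htB
  rw [← blochBasis_neg] at htB'
  have hsB' := hsB
  rw [← blochBasis_neg] at hsB'
  have c0 := (hB.exists_functional hr (neg_dot_neg_self hs') ht hr hrB hsB' htB hrB).1
  have c1 := (hB.exists_functional hr (neg_dot_neg_self hs') ht' hr hrB hsB' htB' hrB).1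
  simp only [dotProduct_neg, neg_dotProduct, neg_neg] at c0 c1
  rw [← image_range_three]
  exact exists_Z2_of_dot hr hs' ht (hB.det_ne_zero hr hs' ht hrB hsB htB hrs hrt hst)
    (abs_dot_lt_one hr hs' hrs) h' (by linarith) (by linarith)

lemma IsNonneg.exists_Z2 {B : Set (Set Op)} (hB : IsNonneg.{u} B)
    {r s t : Fin 3 → ℝ} (hr : r ⬝ᵥ r = 1) (hs : s ⬝ᵥ s = 1) (ht : t ⬝ᵥ t = 1)
    (hrs : blochBasis r ≠ blochBasis s) (hrt : blochBasis r ≠ blochBasis t)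
    (hst : blochBasis s ≠ blochBasis t) (hE : B = {blochBasis r, blochBasis s, blochBasis t})
    (hsym : HasNontrivialSymmetry B) :
    ∃ θ ∈ Set.Ioo 0 (Real.pi / 2), ∃ φ ∈ Set.Ioo 0 Real.pi, |Real.cos φ| ≤ Real.sin θ ∧
      UnitaryEquiv B (threeBasesZ2 θ φ) := by
  have hrB : blochBasis r ∈ B := by simp [hE]
  have hsB : blochBasis s ∈ B := by simp [hE]
  have htB : blochBasis t ∈ B := by simp [hE]
  obtain ⟨U, hU, hU'⟩ := hasNontrivialSymmetry_iff.mp hsym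
  have sq : ∀ {x y : Fin 3 → ℝ}, x ⬝ᵥ x = 1 → y ⬝ᵥ y = 1 → blochBasis x ≠ blochBasis y →
      (x ⬝ᵥ y) ^ 2 < 1 := fun hx hy h => by
    obtain ⟨h1, h2⟩ := abs_dot_lt_one hx hy h
    nlinarith
  have := exists_abs_dot_eq_of_symmetry (v := ![r, s, t]) (U := U)
    (fun i => by fin_cases i; exacts [hr, hs, ht])
    (hB.det_ne_zero hr hs ht hrB hsB htB hrs hrt hst)
    (fun i j hij => by
      fin_cases i <;> fin_cases j <;>
        first
        | exact absurd rfl hij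
        | exact sq hr hs hrs
        | exact sq hr ht hrt
        | exact sq hs ht hst
        | exact sq hs hr hrs.symm
        | exact sq ht hr hrt.symm
        | exact sq ht hs hst.symm)
    (by rw [image_range_three, ← hE]; exact hU) hU'
  rcases this with h | h | h
  · have hE' : B = {blochBasis s, blochBasis t, blochBasis r} := by
      rw [hE, Set.pair_comm _ (blochBasis r), Set.insert_comm]
    have h' : (s ⬝ᵥ r) ^ 2 = (t ⬝ᵥ r) ^ 2 := by
      rw [dotProduct_comm s r, dotProduct_comm t r]
      exact h
    obtain ⟨θ, hθ, φ, hφ, hle, he⟩ := exists_Z2_of_sq hB hs ht hr hsB htB hrB hst hrs.symm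
      hrt.symm h'
    exact ⟨θ, hθ, φ, hφ, hle, hE' ▸ he⟩
  · have hE' : B = {blochBasis r, blochBasis t, blochBasis s} := by
      rw [hE, Set.pair_comm]
    have h' : (r ⬝ᵥ s) ^ 2 = (t ⬝ᵥ s) ^ 2 := by
      rw [dotProduct_comm t s]
      exact h
    obtain ⟨θ, hθ, φ, hφ, hle, he⟩ := exists_Z2_of_sq hB hr ht hs hrB htB hsB hrt hrs
      hst.symm h'
    exact ⟨θ, hθ, φ, hφ, hle, hE' ▸ he⟩
  · obtain ⟨θ, hθ, φ, hφ, hle, he⟩ := exists_Z2_of_sq hB hr hs ht hrB hsB htB hrs hrt hst h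
    exact ⟨θ, hθ, φ, hφ, hle, hE ▸ he⟩

/-- With a fourth basis, signs of the Bloch vectors can be chosen such that they sum to zero. Then
there is no fifth: its Bloch vector would be another signed sum of the first three, and two signed
sums can both be unit vectors only if two of the three vectors are parallel. -/
lemma IsNonneg.exists_cuboid {B : Set (Set Op)} (hB : IsNonneg.{u} B) (hb : ∀ b ∈ B, IsBasis b)
    {r s t v : Fin 3 → ℝ} (hr : r ⬝ᵥ r = 1) (hs : s ⬝ᵥ s = 1) (ht : t ⬝ᵥ t = 1) (hv : v ⬝ᵥ v = 1)
    (hrB : blochBasis r ∈ B) (hsB : blochBasis s ∈ B) (htB : blochBasis t ∈ B)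
    (hvB : blochBasis v ∈ B)
    (hrs : blochBasis r ≠ blochBasis s) (hrt : blochBasis r ≠ blochBasis t)
    (hst : blochBasis s ≠ blochBasis t) (hrv : blochBasis r ≠ blochBasis v)
    (hsv : blochBasis s ≠ blochBasis v) (htv : blochBasis t ≠ blochBasis v) :
    ∃ θ ∈ Set.Ioo 0 (Real.pi / 2), ∃ φ ∈ Set.Ioo 0 (Real.pi / 2),
      UnitaryEquiv B (cuboidBases θ φ) := by
  obtain ⟨α, β, γ, hα, hβ, hγ, hsum⟩ := hB.eq_signed_sum hr hs ht hv hrB hsB htB hvB hrs hrt hst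
    hrv hsv htv
  have er := blochBasis_smul hα r
  have es := blochBasis_smul hβ s
  have et := blochBasis_smul hγ t
  have nr := smul_dot_smul_self hα hr
  have ns := smul_dot_smul_self hβ hs
  have nt := smul_dot_smul_self hγ ht
  rw [← er] at hrB hrs hrt hrv
  rw [← es] at hsB hrs hst hsv
  rw [← et] at htB hrt hst htv
  generalize α • r = r' at *
  generalize β • s = s' at *
  generalize γ • t = t' at *
  clear er es et hr hs ht hα hβ hγ α β γ r s t
  have hcov : ∀ b ∈ B, b = blochBasis r' ∨ b = blochBasis s' ∨ b = blochBasis t' ∨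
      b = blochBasis v := by
    intro b hbB
    obtain ⟨w, hw, rfl⟩ := isBasis_iff.mp (hb b hbB)
    by_contra hne
    simp only [not_or] at hne
    obtain ⟨w1, w2, w3, w4⟩ := hne
    obtain ⟨α, β, γ, hα, hβ, hγ, hsum'⟩ := hB.eq_signed_sum nr ns nt hw hrB hsB htB hbB hrs hrt
      hst (Ne.symm w1) (Ne.symm w2) (Ne.symm w3)
    obtain ⟨a1, a2⟩ := abs_dot_lt_one nr ns hrs
    obtain ⟨b1, b2⟩ := abs_dot_lt_one nr nt hrt
    obtain ⟨c1, c2⟩ := abs_dot_lt_one ns nt hst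
    have w5 : w ≠ v := fun h => w4 (by rw [h])
    have w6 : w ≠ -v := fun h => w4 (by rw [h, blochBasis_neg])
    have hn := hv
    have hm := hw
    rw [hsum] at hn w5 w6
    rw [hsum'] at hm w5 w6
    simp only [add_dotProduct, dotProduct_add, smul_dotProduct, dotProduct_smul, smul_eq_mul, nr,
      ns, nt, dotProduct_comm s' r', dotProduct_comm t' r', dotProduct_comm t' s'] at hn hm
    rcases hα with rfl | rfl <;> rcases hβ with rfl | rfl <;> rcases hγ with rfl | rfl <;>
      first
      | linarith
      | (refine absurd ?_ w5; simp; done)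
      | (refine absurd ?_ w6; simp; abel)
  have hBE : B = blochBasis '' Set.range ![r', s', t', -v] := by
    rw [image_range_four, blochBasis_neg]
    ext b
    constructor
    · intro h
      simpa using hcov b h
    · intro h
      simp only [Set.mem_insert_iff, Set.mem_singleton_iff] at h
      rcases h with rfl | rfl | rfl | rfl <;> assumption
  rw [hBE]
  have hrv' : blochBasis r' ≠ blochBasis (-v) := by rwa [blochBasis_neg]
  refine exists_cuboid_of_sum_zero (fun i => ?_)
    (hB.det_ne_zero nr ns nt hrB hsB htB hrs hrt hst) (abs_dot_lt_one nr ns hrs).1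
    (abs_dot_lt_one nr nt hrt).1 (abs_dot_lt_one nr (neg_dot_neg_self hv) hrv').1 ?_
  · fin_cases i
    exacts [nr, ns, nt, neg_dot_neg_self hv]
  · show r' + s' + t' + -v = 0
    rw [hsum, add_neg_cancel]

lemma unitaryEquiv_oneBasis {r : Fin 3 → ℝ} (hr : r ⬝ᵥ r = 1) :
    UnitaryEquiv {blochBasis r} oneBasis := by
  obtain ⟨U, hU⟩ := exists_rot_mulVec_eq hr
  refine ⟨U⁻¹, ?_⟩
  have h : rot U⁻¹ *ᵥ r = ![0, 0, 1] := by
    rw [← hU, Matrix.mulVec_mulVec, ← rot_mul, inv_mul_cancel, rot_one, Matrix.one_mulVec]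
  rw [oneBasis, move, Set.image_singleton, image_conj_blochBasis, h]

/-- Three bases of the first family are in the second family as well, so the former does not occur
in the conclusion. -/
theorem exhaustive {B : Set (Set Op)} (hne : B.Nonempty) (hb : ∀ b ∈ B, IsBasis b)
    (hB : IsNonneg.{u} B) (hsym : HasNontrivialSymmetry B) :
    UnitaryEquiv B oneBasis ∨
      (∃ θ ∈ Set.Ioo 0 (Real.pi / 2), UnitaryEquiv B (twoBases θ)) ∨
      (∃ θ ∈ Set.Ioo 0 (Real.pi / 2), ∃ φ ∈ Set.Ioo 0 Real.pi, |Real.cos φ| ≤ Real.sin θ ∧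
        UnitaryEquiv B (threeBasesZ2 θ φ)) ∨
      (∃ θ ∈ Set.Ioo 0 (Real.pi / 2), ∃ φ ∈ Set.Ioo 0 (Real.pi / 2),
        UnitaryEquiv B (cuboidBases θ φ)) := by
  obtain ⟨b, hbB⟩ := hne
  obtain ⟨r, hr, rfl⟩ := isBasis_iff.mp (hb b hbB)
  by_cases h1 : ∀ b ∈ B, b = blochBasis r
  · left
    have : B = {blochBasis r} := Set.eq_singleton_iff_unique_mem.mpr ⟨hbB, h1⟩
    rw [this]
    exact unitaryEquiv_oneBasis hr
  push Not at h1
  obtain ⟨b, hsB, hrs⟩ := h1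
  obtain ⟨s, hs, rfl⟩ := isBasis_iff.mp (hb b hsB)
  by_cases h2 : ∀ b ∈ B, b = blochBasis r ∨ b = blochBasis s
  · right; left
    have : B = {blochBasis r, blochBasis s} := by
      ext b
      constructor
      · intro h
        simpa using h2 b h
      · rintro (rfl | rfl) <;> assumption
    rw [this, ← image_range_two]
    exact exists_twoBases hr hs (abs_dot_lt_one hr hs hrs.symm)
  push Not at h2
  obtain ⟨b, htB, hrt, hst⟩ := h2
  obtain ⟨t, ht, rfl⟩ := isBasis_iff.mp (hb b htB)
  right; right
  by_cases h3 : ∀ b ∈ B, b = blochBasis r ∨ b = blochBasis s ∨ b = blochBasis t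
  · left
    have : B = {blochBasis r, blochBasis s, blochBasis t} := by
      ext b
      constructor
      · intro h
        simpa using h3 b h
      · rintro (rfl | rfl | rfl) <;> assumption
    exact hB.exists_Z2 hr hs ht hrs.symm hrt.symm hst.symm this hsym
  · right
    push Not at h3
    obtain ⟨b, hvB, hrv, hsv, htv⟩ := h3
    obtain ⟨v, hv, rfl⟩ := isBasis_iff.mp (hb b hvB)
    exact hB.exists_cuboid hb hr hs ht hv hbB hsB htB hvB hrs.symm hrt.symm hst.symm hrv.symm
      hsv.symm htv.symm

/-! ### Invariance under unitary equivalence -/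

lemma move_inv_move (U : U2) (B : Set (Set Op)) : move U⁻¹ (move U B) = B := by
  rw [← move_mul, inv_mul_cancel, move_one]

lemma UnitaryEquiv.symm {B C : Set (Set Op)} (h : UnitaryEquiv B C) : UnitaryEquiv C B := by
  obtain ⟨U, rfl⟩ := h
  exact ⟨U⁻¹, move_inv_move U B⟩

lemma conj_inv_conj (U : U2) (P : Op) : conj U⁻¹ (conj U P) = P := by
  rw [← Function.comp_apply (f := conj U⁻¹), ← conj_mul, inv_mul_cancel, conj_one, id]

lemma trace_mul_conj (U : U2) (A B : Op) : (A * conj U B).trace = (conj U⁻¹ A * B).trace := by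
  rw [← trace_conj U (conj U⁻¹ A * B), ← conj_mul_conj]
  have := conj_inv_conj U⁻¹ A
  rw [inv_inv] at this
  rw [this]

lemma posSemidef_conj (U : U2) {A : Op} (hA : A.PosSemidef) : (conj U A).PosSemidef :=
  hA.mul_mul_conjTranspose_same (U : Op)

lemma isState_conj (U : U2) {A : Op} (hA : IsState A) : IsState (conj U A) :=
  ⟨posSemidef_conj U hA.1, by rw [trace_conj, hA.2]⟩

lemma conj_one_right (U : U2) : conj U 1 = 1 := by
  rw [conj, Matrix.mul_one, coe_mul_star]

lemma isEffect_conj (U : U2) {A : Op} (hA : IsEffect A) : IsEffect (conj U A) := by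
  refine ⟨posSemidef_conj U hA.1, ?_⟩
  have : 1 - conj U A = conj U (1 - A) := by
    rw [conj, conj, Matrix.mul_sub, Matrix.sub_mul, Matrix.mul_one, coe_mul_star]
  rw [this]
  exact posSemidef_conj U hA.2

lemma isPOVM_conj (U : U2) {n : ℕ} {E : Fin n → Op} (hE : IsPOVM E) :
    IsPOVM fun j => conj U (E j) := by
  refine ⟨fun j => posSemidef_conj U (hE.1 j), ?_⟩
  rw [← conj_one_right U, ← hE.2]
  simp only [conj, Matrix.mul_sum, Matrix.sum_mul]

/-- A representation is transported by applying the unitary to `F` and `G`. -/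
lemma IsNonneg.move {B : Set (Set Op)} (hB : IsNonneg.{u} B) (U : U2) :
    IsNonneg.{u} (move U B) := by
  obtain ⟨Λ, _, ν, F, G, h, hb⟩ := hB
  have hmu : ∀ A, mu (fun l => conj U (F l)) A = mu F (conj U⁻¹ A) := fun A => by
    funext l
    rw [mu, mu, trace_mul_conj]
  have hxi : ∀ A, xi (fun l => conj U (G l)) A = xi G (conj U⁻¹ A) := fun A => by
    funext l
    rw [xi, xi, trace_mul_conj]
  refine ⟨Λ, _, ν, fun l => conj U (F l), fun l => conj U (G l), ⟨fun l => ?_, fun l => ?_,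
    fun E hE => ?_, fun ρ hρ => ?_, fun ρ hρ => ?_, fun n E hE l => ?_, fun ρ E hρ hE => ?_,
    fun ρ E hρ hE => ?_⟩, ?_⟩
  · exact isHermitian_conj U (h.hermitian_F l)
  · exact isHermitian_conj U (h.hermitian_G l)
  · rw [hxi]
    exact h.measurable_xi _ (isEffect_conj _ hE)
  · rw [hmu]
    exact h.integrable_mu _ (isState_conj _ hρ)
  · rw [hmu]
    exact h.normalized _ (isState_conj _ hρ)
  · simp only [hxi]
    exact h.complete n _ (isPOVM_conj U⁻¹ hE) l
  · rw [hmu, hxi]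
    exact h.integrable_born _ _ (isState_conj _ hρ) (isEffect_conj _ hE)
  · rw [hmu, hxi, h.born _ _ (isState_conj _ hρ) (isEffect_conj _ hE), conj_mul_conj, trace_conj]
  · rintro _ ⟨b, hbB, rfl⟩ _ ⟨P, hP, rfl⟩ l
    rw [hmu, hxi, conj_inv_conj]
    exact hb b hbB P hP l

lemma symmetryGroup_move (U : U2) (B : Set (Set Op)) {V : U2} :
    V ∈ symmetryGroup (move U B) ↔ U⁻¹ * V * U ∈ symmetryGroup B := by
  constructor
  · intro h
    have h' : move V (move U B) = move U B := h
    show move (U⁻¹ * V * U) B = B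
    rw [move_mul, move_mul, h', move_inv_move]
  · intro h
    have h' : move (U⁻¹ * V * U) B = B := h
    show move V (move U B) = move U B
    rw [← move_mul]
    nth_rw 2 [← h']
    rw [← move_mul]
    congr 1
    group

lemma HasNontrivialSymmetry.move {B : Set (Set Op)} (h : HasNontrivialSymmetry B) (U : U2) :
    HasNontrivialSymmetry (move U B) := by
  obtain ⟨V, hV, hV'⟩ := hasNontrivialSymmetry_iff.mp h
  have e : U⁻¹ * (U * V * U⁻¹) * U = V := by group
  refine hasNontrivialSymmetry_iff.mpr ⟨U * V * U⁻¹, ?_, fun h => hV' ?_⟩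
  · rw [symmetryGroup_move, e]
    exact hV
  · have := phases_normal.conj_mem _ h U⁻¹
    rwa [inv_inv, e] at this

lemma isBasis_of_mem_move {B : Set (Set Op)} (hB : ∀ b ∈ B, IsBasis b) (U : U2) :
    ∀ b ∈ move U B, IsBasis b := by
  rintro _ ⟨b, hb, rfl⟩
  obtain ⟨r, hr, rfl⟩ := isBasis_iff.mp (hB b hb)
  exact isBasis_iff.mpr ⟨rot U *ᵥ r, by rw [dot_rot, hr], image_conj_blochBasis U r⟩

/-- Being in the list implies the four properties, once this holds for the representative. -/
lemma properties_of_unitaryEquiv {B C : Set (Set Op)} (h : UnitaryEquiv B C) (h1 : C.Nonempty)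
    (h2 : ∀ b ∈ C, IsBasis b) (h3 : IsNonneg.{u} C) (h4 : HasNontrivialSymmetry C) :
    B.Nonempty ∧ (∀ b ∈ B, IsBasis b) ∧ IsNonneg.{u} B ∧ HasNontrivialSymmetry B := by
  obtain ⟨U, rfl⟩ := h.symm
  exact ⟨h1.image _, isBasis_of_mem_move h2 U, h3.move U, h4.move U⟩

/-! ### Generators of the symmetry groups -/

lemma mem_generated {S : Set Op} {U : U2} (h : (U : Op) ∈ S) : U ∈ generated S :=
  Subgroup.mem_sup_left (Subgroup.subset_closure h)

lemma phases_le_generated (S : Set Op) : phases ≤ generated S := le_sup_right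

lemma generated_le_symmetryGroup {S : Set Op} {B : Set (Set Op)}
    (h : ∀ U : U2, (U : Op) ∈ S → U ∈ symmetryGroup B) : generated S ≤ symmetryGroup B :=
  sup_le ((Subgroup.closure_le _).mpr h) (phases_le_symmetryGroup B)

lemma mem_generated_of_rot_eq {S : Set Op} {U V : U2} (hV : V ∈ generated S)
    (h : rot V = rot U) : U ∈ generated S := by
  have := mul_mem hV (phases_le_generated S (rot_eq_iff.mp h))
  rwa [mul_inv_cancel_left] at this

lemma coe_eq_X {U : U2} : (U : Op) = X ↔ U = uX :=
  ⟨fun h => Subtype.ext h, fun h => h ▸ rfl⟩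
lemma coe_eq_Y {U : U2} : (U : Op) = Y ↔ U = uY :=
  ⟨fun h => Subtype.ext h, fun h => h ▸ rfl⟩
lemma coe_eq_Z {U : U2} : (U : Op) = Z ↔ U = uZ :=
  ⟨fun h => Subtype.ext h, fun h => h ▸ rfl⟩
lemma coe_eq_H {U : U2} : (U : Op) = hadamard ↔ U = uH :=
  ⟨fun h => Subtype.ext h, fun h => h ▸ rfl⟩
lemma coe_eq_P {U : U2} : (U : Op) = phaseGate ↔ U = uP :=
  ⟨fun h => Subtype.ext h, fun h => h ▸ rfl⟩
lemma coe_eq_S {U : U2} : (U : Op) = sqrtY ↔ U = uS :=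
  ⟨fun h => Subtype.ext h, fun h => h ▸ rfl⟩
lemma coe_eq_rotZ {U : U2} {t : ℝ} : (U : Op) = rotZ t ↔ U = uRotZ t :=
  ⟨fun h => Subtype.ext h, fun h => h ▸ rfl⟩

lemma uX_mulVec (r : Fin 3 → ℝ) : rot uX *ᵥ r = ![r 0, -r 1, -r 2] := by
  rw [rot_uX]; ext i
  fin_cases i <;> simp [Matrix.mulVec, dotProduct, Fin.sum_univ_three]

lemma uY_mulVec (r : Fin 3 → ℝ) : rot uY *ᵥ r = ![-r 0, r 1, -r 2] := by
  rw [rot_uY]; ext i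
  fin_cases i <;> simp [Matrix.mulVec, dotProduct, Fin.sum_univ_three]

lemma uZ_mulVec (r : Fin 3 → ℝ) : rot uZ *ᵥ r = ![-r 0, -r 1, r 2] := by
  rw [rot_uZ]; ext i
  fin_cases i <;> simp [Matrix.mulVec, dotProduct, Fin.sum_univ_three]

lemma uH_mulVec (r : Fin 3 → ℝ) : rot uH *ᵥ r = ![r 2, -r 1, r 0] := by
  rw [rot_uH]; ext i
  fin_cases i <;> simp [Matrix.mulVec, dotProduct, Fin.sum_univ_three]

lemma uP_mulVec (r : Fin 3 → ℝ) : rot uP *ᵥ r = ![-r 1, r 0, r 2] := by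
  rw [rot_uP]; ext i
  fin_cases i <;> simp [Matrix.mulVec, dotProduct, Fin.sum_univ_three]

lemma uS_mulVec (r : Fin 3 → ℝ) : rot uS *ᵥ r = ![r 2, r 1, -r 0] := by
  rw [rot_uS]; ext i
  fin_cases i <;> simp [Matrix.mulVec, dotProduct, Fin.sum_univ_three]

lemma uRotZ_mulVec (t : ℝ) (r : Fin 3 → ℝ) : rot (uRotZ t) *ᵥ r =
    ![Real.cos t * r 0 - Real.sin t * r 1, Real.sin t * r 0 + Real.cos t * r 1, r 2] := by
  rw [rot_uRotZ]; ext i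
  fin_cases i <;> simp [Matrix.mulVec, dotProduct, Fin.sum_univ_three]
  ring

lemma rot_mul_mulVec (U V : U2) (r : Fin 3 → ℝ) :
    rot (U * V) *ᵥ r = rot U *ᵥ (rot V *ᵥ r) := by
  rw [rot_mul, Matrix.mulVec_mulVec]

lemma rot_one_mulVec (r : Fin 3 → ℝ) : rot 1 *ᵥ r = r := by
  rw [rot_one, Matrix.one_mulVec]

/-- A unitary that acts on two independent vectors like a generated one is itself generated. -/
lemma mem_generated_of_two {S : Set Op} {U V : U2} {r s : Fin 3 → ℝ}
    (h : (r ⬝ᵥ r) * (s ⬝ᵥ s) - (r ⬝ᵥ s) ^ 2 ≠ 0) (hV : V ∈ generated S)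
    (hr : rot V *ᵥ r = rot U *ᵥ r) (hs : rot V *ᵥ s = rot U *ᵥ s) : U ∈ generated S :=
  mem_generated_of_rot_eq hV (rot_eq_of_two h hr hs)

/-! ### The symmetries of one and of two bases -/

/-- The symmetries that fix the axis pointwise are the rotations about it, and `X` reverses it. -/
theorem symmetryGroup_oneBasis :
    symmetryGroup oneBasis = generated (Set.range rotZ ∪ {X}) := by
  have hZ : ∀ t, uRotZ t ∈ generated (Set.range rotZ ∪ {X}) := fun t =>
    mem_generated (Or.inl ⟨t, rfl⟩)
  have hX : uX ∈ generated (Set.range rotZ ∪ {X}) := mem_generated (Or.inr rfl)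
  rw [oneBasis_eq]
  apply le_antisymm
  · have key : ∀ U : U2, rot U *ᵥ ![0, 0, 1] = ![0, 0, 1] → U ∈ generated (Set.range rotZ ∪ {X}) := by
      intro U hU
      have h1 := dot_rot U ![1, 0, 0] ![1, 0, 0]
      have h2 := dot_rot U ![1, 0, 0] ![0, 0, 1]
      rw [hU] at h2
      obtain ⟨w, hw⟩ : ∃ w, w = rot U *ᵥ ![1, 0, 0] := ⟨_, rfl⟩
      rw [← hw] at h1 h2
      have h2' : w 2 = 0 := by
        rw [dot_three] at h2
        simpa using h2
      rw [dot_self_three, h2'] at h1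
      obtain ⟨t, ht0, ht1⟩ := exists_cos_sin (x := w 0) (y := w 1) (by simpa using h1)
      refine mem_generated_of_two (r := ![1, 0, 0]) (s := ![0, 0, 1]) (by simp) (hZ t) ?_ ?_
      · rw [← hw, uRotZ_mulVec]
        ext i
        fin_cases i <;> simp [ht0, ht1, h2']
      · rw [hU, uRotZ_mulVec]
        ext i
        fin_cases i <;> simp
    intro U hU
    obtain ⟨_, rfl, h | h⟩ := exists_eq_or_eq_neg_of_mem_symmetryGroup hU (Set.mem_singleton _)
    · exact key U h
    · have := mul_mem (inv_mem hX) (key (uX * U) (by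
        rw [rot_mul_mulVec, h, uX_mulVec]; ext i; fin_cases i <;> simp))
      rwa [inv_mul_cancel_left] at this
  · refine generated_le_symmetryGroup fun U hU => ?_
    refine mem_symmetryGroup_of_forall (Set.finite_singleton _) ?_
    rintro _ rfl
    refine ⟨_, rfl, ?_⟩
    rcases hU with ⟨t, ht⟩ | hU
    · left
      rw [coe_eq_rotZ.mp ht.symm, uRotZ_mulVec]
      ext i
      fin_cases i <;> simp
    · right
      rw [coe_eq_X.mp hU, uX_mulVec]
      ext i
      fin_cases i <;> simp

lemma vecXZ_dot_self (θ : ℝ) : vecXZ θ ⬝ᵥ vecXZ θ = 1 := by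
  simp [vecXZ]
  linarith [Real.sin_sq_add_cos_sq θ]

lemma vecXZ'_dot_self (θ : ℝ) : vecXZ' θ ⬝ᵥ vecXZ' θ = 1 := by
  simp [vecXZ']
  linarith [Real.sin_sq_add_cos_sq θ]

lemma vecXZ_dot_vecXZ' (θ : ℝ) : vecXZ θ ⬝ᵥ vecXZ' θ = Real.cos (2 * θ) := by
  simp [vecXZ, vecXZ', Real.cos_two_mul]
  linarith [Real.sin_sq_add_cos_sq θ]

lemma sq_cos_two_mul_lt_one {θ : ℝ} (hθ : θ ∈ Set.Ioo 0 (Real.pi / 2)) :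
    Real.cos (2 * θ) ^ 2 < 1 := by
  have h1 := sin_pos_of_mem hθ
  have h2 := cos_pos_of_mem hθ
  have h3 := Real.sin_sq_add_cos_sq (2 * θ)
  have h4 : 0 < Real.sin (2 * θ) := by rw [Real.sin_two_mul]; positivity
  nlinarith

lemma cos_two_mul_ne_zero {θ : ℝ} (hθ : θ ∈ Set.Ioo 0 (Real.pi / 2)) (h : θ ≠ Real.pi / 4) :
    Real.cos (2 * θ) ≠ 0 := by
  intro h0
  apply h
  have : Real.cos (2 * θ) = Real.cos (Real.pi / 2) := by rw [h0, Real.cos_pi_div_two]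
  have := Real.injOn_cos ⟨by linarith [hθ.1], by linarith [hθ.2]⟩
    ⟨by linarith [Real.pi_pos], by linarith [Real.pi_pos]⟩ this
  linarith

/-- The possible images of the two Bloch vectors under a symmetry of the two bases. -/
lemma cases_of_mem_symmetryGroup_twoBases {θ : ℝ} (hθ : θ ∈ Set.Ioo 0 (Real.pi / 2)) {U : U2}
    (hU : U ∈ symmetryGroup (twoBases θ)) :
    ((rot U *ᵥ vecXZ θ = vecXZ θ ∧ rot U *ᵥ vecXZ' θ = vecXZ' θ) ∨
      (rot U *ᵥ vecXZ θ = -vecXZ θ ∧ rot U *ᵥ vecXZ' θ = -vecXZ' θ) ∨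
      (rot U *ᵥ vecXZ θ = vecXZ' θ ∧ rot U *ᵥ vecXZ' θ = vecXZ θ) ∨
      (rot U *ᵥ vecXZ θ = -vecXZ' θ ∧ rot U *ᵥ vecXZ' θ = -vecXZ θ)) ∨
    Real.cos (2 * θ) = 0 ∧
    ((rot U *ᵥ vecXZ θ = vecXZ θ ∧ rot U *ᵥ vecXZ' θ = -vecXZ' θ) ∨
      (rot U *ᵥ vecXZ θ = -vecXZ θ ∧ rot U *ᵥ vecXZ' θ = vecXZ' θ) ∨
      (rot U *ᵥ vecXZ θ = vecXZ' θ ∧ rot U *ᵥ vecXZ' θ = -vecXZ θ) ∨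
      (rot U *ᵥ vecXZ θ = -vecXZ' θ ∧ rot U *ᵥ vecXZ' θ = vecXZ θ)) := by
  rw [twoBases_eq] at hU
  have hg := sq_cos_two_mul_lt_one hθ
  have hd := dot_rot U (vecXZ θ) (vecXZ' θ)
  obtain ⟨_, rfl | rfl, h | h⟩ := exists_eq_or_eq_neg_of_mem_symmetryGroup hU (Set.mem_insert _ _) <;>
    obtain ⟨_, rfl | rfl, h' | h'⟩ := exists_eq_or_eq_neg_of_mem_symmetryGroup hU
      (Set.mem_insert_of_mem _ (Set.mem_singleton _)) <;>
    rw [h, h'] at hd <;> rw [h, h'] <;>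
    simp only [dotProduct_neg, neg_dotProduct, neg_neg, vecXZ_dot_self, vecXZ'_dot_self,
      dotProduct_comm (vecXZ' θ) (vecXZ θ), vecXZ_dot_vecXZ'] at hd <;>
    first
    | (exfalso; nlinarith)
    | (simp; done)
    | (have h0 : Real.cos (2 * θ) = 0 := by linarith
       simp [h0])

lemma uX_mem_symmetryGroup_twoBases (θ : ℝ) : uX ∈ symmetryGroup (twoBases θ) := by
  rw [twoBases_eq]
  refine mem_symmetryGroup_of_forall (Set.toFinite _) ?_
  rintro _ (rfl | rfl)
  · refine ⟨vecXZ' θ, by simp, Or.inr ?_⟩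
    rw [uX_mulVec]; ext i; fin_cases i <;> simp [vecXZ, vecXZ']
  · refine ⟨vecXZ θ, by simp, Or.inr ?_⟩
    rw [uX_mulVec]; ext i; fin_cases i <;> simp [vecXZ, vecXZ']

lemma uZ_mem_symmetryGroup_twoBases (θ : ℝ) : uZ ∈ symmetryGroup (twoBases θ) := by
  rw [twoBases_eq]
  refine mem_symmetryGroup_of_forall (Set.toFinite _) ?_
  rintro _ (rfl | rfl)
  · refine ⟨vecXZ' θ, by simp, Or.inl ?_⟩
    rw [uZ_mulVec]; ext i; fin_cases i <;> simp [vecXZ, vecXZ']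
  · refine ⟨vecXZ θ, by simp, Or.inl ?_⟩
    rw [uZ_mulVec]; ext i; fin_cases i <;> simp [vecXZ, vecXZ']

lemma gram_twoBases_ne_zero {θ : ℝ} (hθ : θ ∈ Set.Ioo 0 (Real.pi / 2)) :
    (vecXZ θ ⬝ᵥ vecXZ θ) * (vecXZ' θ ⬝ᵥ vecXZ' θ) - (vecXZ θ ⬝ᵥ vecXZ' θ) ^ 2 ≠ 0 := by
  rw [vecXZ_dot_self, vecXZ'_dot_self, vecXZ_dot_vecXZ']
  linarith [sq_cos_two_mul_lt_one hθ]

theorem symmetryGroup_twoBases {θ : ℝ} (hθ : θ ∈ Set.Ioo 0 (Real.pi / 2)) (h : θ ≠ Real.pi / 4) :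
    symmetryGroup (twoBases θ) = generated {X, Z} := by
  have hX : uX ∈ generated {X, Z} := mem_generated (Or.inl rfl)
  have hZ : uZ ∈ generated {X, Z} := mem_generated (Or.inr rfl)
  have hg := gram_twoBases_ne_zero hθ
  apply le_antisymm
  · intro U hU
    rcases cases_of_mem_symmetryGroup_twoBases hθ hU with (h1 | h1 | h1 | h1) | h1
    · refine mem_generated_of_two hg (one_mem _) ?_ ?_
      · rw [h1.1, rot_one_mulVec]
      · rw [h1.2, rot_one_mulVec]
    · refine mem_generated_of_two hg (mul_mem hX hZ) ?_ ?_
      · rw [h1.1, rot_mul_mulVec, uZ_mulVec, uX_mulVec]; ext i; fin_cases i <;> simp [vecXZ]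
      · rw [h1.2, rot_mul_mulVec, uZ_mulVec, uX_mulVec]; ext i; fin_cases i <;> simp [vecXZ']
    · refine mem_generated_of_two hg hZ ?_ ?_
      · rw [h1.1, uZ_mulVec]; ext i; fin_cases i <;> simp [vecXZ, vecXZ']
      · rw [h1.2, uZ_mulVec]; ext i; fin_cases i <;> simp [vecXZ, vecXZ']
    · refine mem_generated_of_two hg hX ?_ ?_
      · rw [h1.1, uX_mulVec]; ext i; fin_cases i <;> simp [vecXZ, vecXZ']
      · rw [h1.2, uX_mulVec]; ext i; fin_cases i <;> simp [vecXZ, vecXZ']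
    · exact absurd h1.1 (cos_two_mul_ne_zero hθ h)
  · refine generated_le_symmetryGroup ?_
    rintro U (hU | hU)
    · exact coe_eq_X.mp hU ▸ uX_mem_symmetryGroup_twoBases θ
    · exact coe_eq_Z.mp hU ▸ uZ_mem_symmetryGroup_twoBases θ

theorem symmetryGroup_twoBases_pi_div_four :
    symmetryGroup (twoBases (Real.pi / 4)) = generated {X, sqrtY} := by
  have hθ : Real.pi / 4 ∈ Set.Ioo 0 (Real.pi / 2) :=
    ⟨by linarith [Real.pi_pos], by linarith [Real.pi_pos]⟩
  have hX : uX ∈ generated {X, sqrtY} := mem_generated (Or.inl rfl)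
  have hS : uS ∈ generated {X, sqrtY} := mem_generated (Or.inr rfl)
  have hg := gram_twoBases_ne_zero hθ
  have X0 : rot uX *ᵥ vecXZ (Real.pi / 4) = -vecXZ' (Real.pi / 4) := by
    rw [uX_mulVec]; ext i; fin_cases i <;> simp [vecXZ, vecXZ']
  have X1 : rot uX *ᵥ vecXZ' (Real.pi / 4) = -vecXZ (Real.pi / 4) := by
    rw [uX_mulVec]; ext i; fin_cases i <;> simp [vecXZ, vecXZ']
  have S0 : rot uS *ᵥ vecXZ (Real.pi / 4) = -vecXZ' (Real.pi / 4) := by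
    rw [uS_mulVec]; ext i; fin_cases i <;> simp [vecXZ, vecXZ']
  have S1 : rot uS *ᵥ vecXZ' (Real.pi / 4) = vecXZ (Real.pi / 4) := by
    rw [uS_mulVec]; ext i; fin_cases i <;> simp [vecXZ, vecXZ']
  apply le_antisymm
  · intro U hU
    rcases cases_of_mem_symmetryGroup_twoBases hθ hU with (h | h | h | h) | ⟨-, h | h | h | h⟩
    · refine mem_generated_of_two hg (one_mem _) ?_ ?_ <;> simp [h]
    · refine mem_generated_of_two hg (mul_mem hS hS) ?_ ?_ <;>
        simp only [h, rot_mul_mulVec, S0, S1, Matrix.mulVec_neg]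
    · refine mem_generated_of_two hg (mul_mem (mul_mem hX hS) hS) ?_ ?_ <;>
        simp only [h, rot_mul_mulVec, S0, S1, X0, X1, Matrix.mulVec_neg, neg_neg]
    · refine mem_generated_of_two hg hX ?_ ?_ <;> simp only [h, X0, X1]
    · refine mem_generated_of_two hg (mul_mem hX hS) ?_ ?_ <;>
        simp only [h, rot_mul_mulVec, S0, S1, X0, X1, Matrix.mulVec_neg, neg_neg]
    · refine mem_generated_of_two hg (mul_mem hS hX) ?_ ?_ <;>
        simp only [h, rot_mul_mulVec, S0, S1, X0, X1, Matrix.mulVec_neg, neg_neg]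
    · refine mem_generated_of_two hg (mul_mem (mul_mem hS hS) hS) ?_ ?_ <;>
        simp only [h, rot_mul_mulVec, S0, S1, Matrix.mulVec_neg, neg_neg]
    · refine mem_generated_of_two hg hS ?_ ?_ <;> simp only [h, S0, S1]
  · refine generated_le_symmetryGroup ?_
    rintro U (hU | hU)
    · exact coe_eq_X.mp hU ▸ uX_mem_symmetryGroup_twoBases _
    · rw [coe_eq_S.mp hU, twoBases_eq]
      refine mem_symmetryGroup_of_forall (Set.toFinite _) ?_
      rintro _ (rfl | rfl)
      · exact ⟨vecXZ' _, by simp, Or.inr S0⟩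
      · exact ⟨vecXZ _, by simp, Or.inl S1⟩

/-! ### The symmetries of the stabilizer bases and of cuboids -/

lemma symm_stabilizer_apply {U : U2} (hU : U ∈ symmetryGroup stabilizerBases) (i : Fin 3) :
    ∃ j : Fin 3, rot U *ᵥ Pi.single i 1 = Pi.single j 1 ∨ rot U *ᵥ Pi.single i 1 = -Pi.single j 1 := by
  rw [stabilizerBases_eq] at hU
  obtain ⟨_, ⟨j, rfl⟩, h⟩ := exists_eq_or_eq_neg_of_mem_symmetryGroup hU (Set.mem_range_self i)
  exact ⟨j, h⟩

lemma single_dot_single (i j : Fin 3) :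
    (Pi.single i 1 : Fin 3 → ℝ) ⬝ᵥ Pi.single j 1 = if i = j then 1 else 0 := by
  rw [single_one_dotProduct, Pi.single_apply]

/-- The symmetries of the coordinate axes that fix the third axis pointwise are powers of `P`. -/
lemma mem_generated_of_phaseGate {S : Set Op} (hP : uP ∈ generated S) {U : U2}
    (h2 : rot U *ᵥ Pi.single 2 1 = Pi.single 2 1)
    (h0 : ∃ j : Fin 3, rot U *ᵥ Pi.single 0 1 = Pi.single j 1 ∨
      rot U *ᵥ Pi.single 0 1 = -Pi.single j 1) : U ∈ generated S := by
  have hg : ((Pi.single 0 1 : Fin 3 → ℝ) ⬝ᵥ Pi.single 0 1) *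
      ((Pi.single 2 1 : Fin 3 → ℝ) ⬝ᵥ Pi.single 2 1) -
      ((Pi.single 0 1 : Fin 3 → ℝ) ⬝ᵥ Pi.single 2 1) ^ 2 ≠ 0 := by
    simp only [single_dot_single]
    simp
  have P2 : rot uP *ᵥ Pi.single 2 1 = Pi.single 2 1 := by
    rw [uP_mulVec]; ext i; fin_cases i <;> simp
  have P0 : rot uP *ᵥ Pi.single 0 1 = Pi.single 1 1 := by
    rw [uP_mulVec]; ext i; fin_cases i <;> simp
  have P1 : rot uP *ᵥ Pi.single 1 1 = -Pi.single 0 1 := by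
    rw [uP_mulVec]; ext i; fin_cases i <;> simp
  have hd := dot_rot U (Pi.single 0 1) (Pi.single 2 1)
  rw [h2, single_dot_single] at hd
  obtain ⟨j, h⟩ := h0
  have c : ∀ j : Fin 3, j = 0 ∨ j = 1 ∨ j = 2 := by decide
  rcases c j with rfl | rfl | rfl
  · rcases h with h | h
    · exact mem_generated_of_two hg (one_mem _) (by rw [h, rot_one_mulVec])
        (by rw [h2, rot_one_mulVec])
    · exact mem_generated_of_two hg (mul_mem hP hP) (by rw [h, rot_mul_mulVec, P0, P1])
        (by rw [h2, rot_mul_mulVec, P2, P2])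
  · rcases h with h | h
    · exact mem_generated_of_two hg hP (by rw [h, P0]) (by rw [h2, P2])
    · exact mem_generated_of_two hg (mul_mem hP (mul_mem hP hP))
        (by rw [h, rot_mul_mulVec, rot_mul_mulVec, P0, P1, Matrix.mulVec_neg, P0])
        (by rw [h2, rot_mul_mulVec, rot_mul_mulVec, P2, P2, P2])
  · rcases h with h | h <;> rw [h] at hd <;> simp at hd

lemma uX_mem_symmetryGroup_stabilizer : uX ∈ symmetryGroup stabilizerBases := by
  rw [stabilizerBases_eq]
  refine mem_symmetryGroup_of_forall (Set.finite_range _) ?_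
  rintro _ ⟨i, rfl⟩
  refine ⟨_, ⟨i, rfl⟩, ?_⟩
  rw [uX_mulVec]
  fin_cases i
  · left; ext i; fin_cases i <;> simp
  · right; ext i; fin_cases i <;> simp
  · right; ext i; fin_cases i <;> simp

lemma uP_mem_symmetryGroup_stabilizer : uP ∈ symmetryGroup stabilizerBases := by
  rw [stabilizerBases_eq]
  refine mem_symmetryGroup_of_forall (Set.finite_range _) ?_
  rintro _ ⟨i, rfl⟩
  rw [uP_mulVec]
  fin_cases i
  · exact ⟨_, ⟨1, rfl⟩, Or.inl (by ext i; fin_cases i <;> simp)⟩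
  · exact ⟨_, ⟨0, rfl⟩, Or.inr (by ext i; fin_cases i <;> simp)⟩
  · exact ⟨_, ⟨2, rfl⟩, Or.inl (by ext i; fin_cases i <;> simp)⟩

lemma uH_mem_symmetryGroup_stabilizer : uH ∈ symmetryGroup stabilizerBases := by
  rw [stabilizerBases_eq]
  refine mem_symmetryGroup_of_forall (Set.finite_range _) ?_
  rintro _ ⟨i, rfl⟩
  rw [uH_mulVec]
  fin_cases i
  · exact ⟨_, ⟨2, rfl⟩, Or.inl (by ext i; fin_cases i <;> simp)⟩
  · exact ⟨_, ⟨1, rfl⟩, Or.inr (by ext i; fin_cases i <;> simp)⟩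
  · exact ⟨_, ⟨0, rfl⟩, Or.inl (by ext i; fin_cases i <;> simp)⟩

/-- The generated group is transitive on the six axis vectors, and the stabilizer of the third one
consists of the powers of `P`. -/
theorem symmetryGroup_stabilizerBases :
    symmetryGroup stabilizerBases = generated {hadamard, phaseGate} := by
  have hH : uH ∈ generated {hadamard, phaseGate} := mem_generated (Or.inl rfl)
  have hP : uP ∈ generated {hadamard, phaseGate} := mem_generated (Or.inr rfl)
  have H2 : rot uH *ᵥ Pi.single 2 1 = Pi.single 0 1 := by
    rw [uH_mulVec]; ext i; fin_cases i <;> simp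
  have H0 : rot uH *ᵥ Pi.single 0 1 = Pi.single 2 1 := by
    rw [uH_mulVec]; ext i; fin_cases i <;> simp
  have P0 : rot uP *ᵥ Pi.single 0 1 = Pi.single 1 1 := by
    rw [uP_mulVec]; ext i; fin_cases i <;> simp
  have P1 : rot uP *ᵥ Pi.single 1 1 = -Pi.single 0 1 := by
    rw [uP_mulVec]; ext i; fin_cases i <;> simp
  have hle : generated {hadamard, phaseGate} ≤ symmetryGroup stabilizerBases := by
    refine generated_le_symmetryGroup ?_
    rintro U (hU | hU)
    · exact coe_eq_H.mp hU ▸ uH_mem_symmetryGroup_stabilizer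
    · exact coe_eq_P.mp hU ▸ uP_mem_symmetryGroup_stabilizer
  refine le_antisymm (fun U hU => ?_) hle
  obtain ⟨V, hV, hVU⟩ : ∃ V ∈ generated {hadamard, phaseGate},
      rot V *ᵥ Pi.single 2 1 = rot U *ᵥ Pi.single 2 1 := by
    obtain ⟨j, h⟩ := symm_stabilizer_apply hU 2
    have c : ∀ j : Fin 3, j = 0 ∨ j = 1 ∨ j = 2 := by decide
    rcases c j with rfl | rfl | rfl <;> rcases h with h | h <;> rw [h]
    · exact ⟨uH, hH, H2⟩
    · exact ⟨uP * (uP * uH), mul_mem hP (mul_mem hP hH),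
        by rw [rot_mul_mulVec, rot_mul_mulVec, H2, P0, P1]⟩
    · exact ⟨uP * uH, mul_mem hP hH, by rw [rot_mul_mulVec, H2, P0]⟩
    · exact ⟨uP * (uP * (uP * uH)), mul_mem hP (mul_mem hP (mul_mem hP hH)),
        by rw [rot_mul_mulVec, rot_mul_mulVec, rot_mul_mulVec, H2, P0, P1, Matrix.mulVec_neg, P0]⟩
    · exact ⟨1, one_mem _, rot_one_mulVec _⟩
    · exact ⟨uH * (uP * (uP * uH)), mul_mem hH (mul_mem hP (mul_mem hP hH)),
        by rw [rot_mul_mulVec, rot_mul_mulVec, rot_mul_mulVec, H2, P0, P1, Matrix.mulVec_neg, H0]⟩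
  have hW : V⁻¹ * U ∈ generated {hadamard, phaseGate} := by
    refine mem_generated_of_phaseGate hP ?_
      (symm_stabilizer_apply (mul_mem (inv_mem (hle hV)) hU) 0)
    rw [rot_mul_mulVec, ← hVU, ← rot_mul_mulVec, inv_mul_cancel, rot_one_mulVec]
  have := mul_mem hV hW
  rwa [mul_inv_cancel_left] at this

lemma finite_cuboid (c : Fin 3 → ℝ) : (cuboid c).Finite := by
  refine (Set.Finite.pi' fun i => Set.toFinite ({c i, -c i} : Set ℝ)).subset fun v hv i => ?_
  simpa using hv i

/-- A symmetry of a cuboid maps the coordinate axes to coordinate axes parallel to edges of the same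
length. The images of the vertices have `k`-th coordinates `± m 0 ± m 1 ± m 2`, all of absolute
value `c k`, so that only one of the `m i` is nonzero. -/
lemma symm_cuboid_apply {c : Fin 3 → ℝ} (hc : ∀ i, 0 < c i) {U : U2}
    (hU : U ∈ symmetryGroup (blochBasis '' cuboid c)) (k : Fin 3) :
    ∃ i, c i = c k ∧ (rot U *ᵥ Pi.single k 1 = Pi.single i 1 ∨
      rot U *ᵥ Pi.single k 1 = -Pi.single i 1) := by
  have hU' := inv_mem hU
  have hval : ∀ x y z : ℝ, (x = 1 ∨ x = -1) → (y = 1 ∨ y = -1) → (z = 1 ∨ z = -1) →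
      (x * (rot U⁻¹ k 0 * c 0) + y * (rot U⁻¹ k 1 * c 1) + z * (rot U⁻¹ k 2 * c 2)) ^ 2
        = c k ^ 2 := by
    intro x y z hx hy hz
    have hv : ![x * c 0, y * c 1, z * c 2] ∈ cuboid c := by
      intro i
      fin_cases i
      · rcases hx with rfl | rfl <;> simp
      · rcases hy with rfl | rfl <;> simp
      · rcases hz with rfl | rfl <;> simp
    obtain ⟨w, hw, h⟩ := exists_eq_or_eq_neg_of_mem_symmetryGroup hU' hv
    have e : (rot U⁻¹ *ᵥ ![x * c 0, y * c 1, z * c 2]) k =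
        x * (rot U⁻¹ k 0 * c 0) + y * (rot U⁻¹ k 1 * c 1) + z * (rot U⁻¹ k 2 * c 2) := by
      simp [Matrix.mulVec, dotProduct, Fin.sum_univ_three]
      ring
    rw [← e]
    rcases h with h | h <;> rw [h] <;> rcases hw k with h' | h' <;> simp [h']
  have hrow : rot U⁻¹ k 0 ^ 2 + rot U⁻¹ k 1 ^ 2 + rot U⁻¹ k 2 ^ 2 = 1 := by
    have := congrFun (congrFun (rot_mul_transpose U⁻¹) k) k
    rw [Matrix.mul_apply, Fin.sum_univ_three, Matrix.one_apply_eq] at this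
    simp only [Matrix.transpose_apply] at this
    linarith
  have q0 := hval 1 1 1 (by simp) (by simp) (by simp)
  have q1 := hval 1 1 (-1) (by simp) (by simp) (by simp)
  have q2 := hval 1 (-1) 1 (by simp) (by simp) (by simp)
  have q3 := hval (-1) 1 1 (by simp) (by simp) (by simp)
  have hcol : ∀ i, (rot U *ᵥ Pi.single k 1) i = rot U⁻¹ k i := fun i => by
    rw [Matrix.mulVec_single_one, rot_inv]
    rfl
  have p0 := hc 0
  have p1 := hc 1
  have p2 := hc 2
  have pk := hc k
  have h0 := hcol 0
  have h1 := hcol 1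
  have h2 := hcol 2
  generalize rot U⁻¹ k 0 = a at *
  have done : ∀ i, c i ^ 2 = c k ^ 2 → c i = c k := fun i h =>
    (pow_left_inj₀ (hc i).le pk.le two_ne_zero).mp h
  have m01 : a * rot U⁻¹ k 1 = 0 := by
    have : (a * rot U⁻¹ k 1) * (c 0 * c 1) = 0 := by linear_combination (q0 + q1 - q2 - q3) / 8
    exact (mul_eq_zero.mp this).resolve_right (by positivity)
  have m02 : a * rot U⁻¹ k 2 = 0 := by
    have : (a * rot U⁻¹ k 2) * (c 0 * c 2) = 0 := by linear_combination (q0 + q2 - q1 - q3) / 8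
    exact (mul_eq_zero.mp this).resolve_right (by positivity)
  have m12 : rot U⁻¹ k 1 * rot U⁻¹ k 2 = 0 := by
    have : (rot U⁻¹ k 1 * rot U⁻¹ k 2) * (c 1 * c 2) = 0 := by
      linear_combination (q0 + q3 - q1 - q2) / 8
    exact (mul_eq_zero.mp this).resolve_right (by positivity)
  have hs : ∀ (i : Fin 3) (x : ℝ), x ^ 2 = 1 → rot U *ᵥ Pi.single k 1 = Pi.single i x →
      rot U *ᵥ Pi.single k 1 = Pi.single i 1 ∨ rot U *ᵥ Pi.single k 1 = -Pi.single i 1 := by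
    intro i x hx h
    rcases sq_eq_one_iff.mp hx with rfl | rfl
    · exact Or.inl h
    · exact Or.inr (by rw [h, Pi.single_neg])
  by_cases ha : a = 0
  · by_cases hb : rot U⁻¹ k 1 = 0
    · rw [ha, hb] at hrow q0
      refine ⟨2, done 2 ?_, hs 2 (rot U⁻¹ k 2) (by linarith) ?_⟩
      · linear_combination q0 - c 2 ^ 2 * hrow
      · ext i
        fin_cases i <;> simp [h0, h1, h2, ha, hb]
    · have hd : rot U⁻¹ k 2 = 0 := (mul_eq_zero.mp m12).resolve_left hb
      rw [ha, hd] at hrow q0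
      refine ⟨1, done 1 ?_, hs 1 (rot U⁻¹ k 1) (by linarith) ?_⟩
      · linear_combination q0 - c 1 ^ 2 * hrow
      · ext i
        fin_cases i <;> simp [h0, h1, h2, ha, hd]
  · have hb : rot U⁻¹ k 1 = 0 := (mul_eq_zero.mp m01).resolve_left ha
    have hd : rot U⁻¹ k 2 = 0 := (mul_eq_zero.mp m02).resolve_left ha
    rw [hb, hd] at hrow q0
    refine ⟨0, done 0 ?_, hs 0 a (by linarith) ?_⟩
    · linear_combination q0 - c 0 ^ 2 * hrow
    · ext i
      fin_cases i <;> simp [h0, h1, h2, hb, hd]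

/-- Every symmetry of a cuboid is a symmetry of the coordinate axes. -/
lemma symmetryGroup_cuboid_le {c : Fin 3 → ℝ} (hc : ∀ i, 0 < c i) :
    symmetryGroup (blochBasis '' cuboid c) ≤ symmetryGroup stabilizerBases := by
  intro U hU
  rw [stabilizerBases_eq]
  refine mem_symmetryGroup_of_forall (Set.finite_range _) ?_
  rintro _ ⟨k, rfl⟩
  obtain ⟨i, -, h⟩ := symm_cuboid_apply hc hU k
  exact ⟨_, ⟨i, rfl⟩, h⟩

lemma uX_mem_symmetryGroup_cuboid (c : Fin 3 → ℝ) : uX ∈ symmetryGroup (blochBasis '' cuboid c) := by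
  refine mem_symmetryGroup_of_forall (finite_cuboid c) fun v hv => ⟨_, ?_, Or.inl rfl⟩
  rw [uX_mulVec]
  intro i
  have := hv i
  fin_cases i <;> simp_all <;> grind

lemma uZ_mem_symmetryGroup_cuboid (c : Fin 3 → ℝ) : uZ ∈ symmetryGroup (blochBasis '' cuboid c) := by
  refine mem_symmetryGroup_of_forall (finite_cuboid c) fun v hv => ⟨_, ?_, Or.inl rfl⟩
  rw [uZ_mulVec]
  intro i
  have := hv i
  fin_cases i <;> simp_all <;> grind

lemma uP_mem_symmetryGroup_cuboid {c : Fin 3 → ℝ} (h : c 0 = c 1) :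
    uP ∈ symmetryGroup (blochBasis '' cuboid c) := by
  refine mem_symmetryGroup_of_forall (finite_cuboid c) fun v hv => ⟨_, ?_, Or.inl rfl⟩
  rw [uP_mulVec]
  have h0 := hv 0
  have h1 := hv 1
  have h2 := hv 2
  intro i
  fin_cases i <;> simp <;> grind

lemma uH_mem_symmetryGroup_cuboid {c : Fin 3 → ℝ} (h : c 0 = c 2) :
    uH ∈ symmetryGroup (blochBasis '' cuboid c) := by
  refine mem_symmetryGroup_of_forall (finite_cuboid c) fun v hv => ⟨_, ?_, Or.inl rfl⟩
  rw [uH_mulVec]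
  have h0 := hv 0
  have h1 := hv 1
  have h2 := hv 2
  intro i
  fin_cases i <;> simp <;> grind

lemma generated_le_symmetryGroup_cuboid (c : Fin 3 → ℝ) :
    generated {X, Z} ≤ symmetryGroup (blochBasis '' cuboid c) := by
  refine generated_le_symmetryGroup ?_
  rintro U (hU | hU)
  · exact coe_eq_X.mp hU ▸ uX_mem_symmetryGroup_cuboid c
  · exact coe_eq_Z.mp hU ▸ uZ_mem_symmetryGroup_cuboid c

theorem symmetryGroup_cuboid_of_injective {c : Fin 3 → ℝ} (hc : ∀ i, 0 < c i)
    (hi : Function.Injective c) :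
    symmetryGroup (blochBasis '' cuboid c) = generated {X, Z} := by
  have hX : uX ∈ generated {X, Z} := mem_generated (Or.inl rfl)
  have hZ : uZ ∈ generated {X, Z} := mem_generated (Or.inr rfl)
  refine le_antisymm (fun U hU => ?_) (generated_le_symmetryGroup_cuboid c)
  have hk : ∀ k, rot U *ᵥ Pi.single k 1 = Pi.single k 1 ∨ rot U *ᵥ Pi.single k 1 = -Pi.single k 1 := by
    intro k
    obtain ⟨i, h, h'⟩ := symm_cuboid_apply hc hU k
    rwa [hi h] at h'
  have hg : ((Pi.single 0 1 : Fin 3 → ℝ) ⬝ᵥ Pi.single 0 1) *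
      ((Pi.single 2 1 : Fin 3 → ℝ) ⬝ᵥ Pi.single 2 1) -
      ((Pi.single 0 1 : Fin 3 → ℝ) ⬝ᵥ Pi.single 2 1) ^ 2 ≠ 0 := by
    simp only [single_dot_single]
    simp
  have X0 : rot uX *ᵥ Pi.single 0 1 = Pi.single 0 1 := by
    rw [uX_mulVec]; ext i; fin_cases i <;> simp
  have X2 : rot uX *ᵥ Pi.single 2 1 = -Pi.single 2 1 := by
    rw [uX_mulVec]; ext i; fin_cases i <;> simp
  have Z0 : rot uZ *ᵥ Pi.single 0 1 = -Pi.single 0 1 := by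
    rw [uZ_mulVec]; ext i; fin_cases i <;> simp
  have Z2 : rot uZ *ᵥ Pi.single 2 1 = Pi.single 2 1 := by
    rw [uZ_mulVec]; ext i; fin_cases i <;> simp
  rcases hk 0 with h0 | h0 <;> rcases hk 2 with h2 | h2
  · exact mem_generated_of_two hg (one_mem _) (by rw [h0, rot_one_mulVec])
      (by rw [h2, rot_one_mulVec])
  · exact mem_generated_of_two hg hX (by rw [h0, X0]) (by rw [h2, X2])
  · exact mem_generated_of_two hg hZ (by rw [h0, Z0]) (by rw [h2, Z2])
  · exact mem_generated_of_two hg (mul_mem hX hZ)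
      (by rw [h0, rot_mul_mulVec, Z0, Matrix.mulVec_neg, X0])
      (by rw [h2, rot_mul_mulVec, Z2, X2])

theorem symmetryGroup_cuboid_of_eq_of_ne {c : Fin 3 → ℝ} (hc : ∀ i, 0 < c i) (h01 : c 0 = c 1)
    (h02 : c 0 ≠ c 2) :
    symmetryGroup (blochBasis '' cuboid c) = generated {X, phaseGate} := by
  have hX : uX ∈ generated {X, phaseGate} := mem_generated (Or.inl rfl)
  have hP : uP ∈ generated {X, phaseGate} := mem_generated (Or.inr rfl)
  have X2 : rot uX *ᵥ Pi.single 2 1 = -Pi.single 2 1 := by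
    rw [uX_mulVec]; ext i; fin_cases i <;> simp
  apply le_antisymm
  · intro U hU
    have h2 : rot U *ᵥ Pi.single 2 1 = Pi.single 2 1 ∨ rot U *ᵥ Pi.single 2 1 = -Pi.single 2 1 := by
      obtain ⟨i, h, h'⟩ := symm_cuboid_apply hc hU 2
      have c : ∀ j : Fin 3, j = 0 ∨ j = 1 ∨ j = 2 := by decide
      rcases c i with rfl | rfl | rfl
      · exact absurd h h02
      · exact absurd (h01.trans h) h02
      · exact h'
    have hst := symmetryGroup_cuboid_le hc hU
    rcases h2 with h2 | h2
    · exact mem_generated_of_phaseGate hP h2 (symm_stabilizer_apply hst 0)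
    · have := mul_mem (inv_mem hX) (mem_generated_of_phaseGate hP (U := uX * U)
        (by rw [rot_mul_mulVec, h2, Matrix.mulVec_neg, X2, neg_neg])
        (symm_stabilizer_apply (mul_mem uX_mem_symmetryGroup_stabilizer hst) 0))
      rwa [inv_mul_cancel_left] at this
  · refine generated_le_symmetryGroup ?_
    rintro U (hU | hU)
    · exact coe_eq_X.mp hU ▸ uX_mem_symmetryGroup_cuboid c
    · exact coe_eq_P.mp hU ▸ uP_mem_symmetryGroup_cuboid h01

theorem symmetryGroup_cube {c : Fin 3 → ℝ} (hc : ∀ i, 0 < c i) (h01 : c 0 = c 1)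
    (h02 : c 0 = c 2) :
    symmetryGroup (blochBasis '' cuboid c) = generated {hadamard, phaseGate} := by
  apply le_antisymm
  · rw [← symmetryGroup_stabilizerBases]
    exact symmetryGroup_cuboid_le hc
  · refine generated_le_symmetryGroup ?_
    rintro U (hU | hU)
    · exact coe_eq_H.mp hU ▸ uH_mem_symmetryGroup_cuboid h02
    · exact coe_eq_P.mp hU ▸ uP_mem_symmetryGroup_cuboid h01

/-! ### The first family of three bases -/

lemma vecD3_dot_self (θ : ℝ) (i : Fin 3) : vecD3 θ i ⬝ᵥ vecD3 θ i = 1 := by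
  have h3 : √3 ^ 2 = 3 := Real.sq_sqrt (by norm_num)
  have h := Real.sin_sq_add_cos_sq θ
  rw [dot_three]
  fin_cases i <;> simp [vecD3, vecXZ]
  · linear_combination h
  · linear_combination h + Real.sin θ ^ 2 / 4 * h3
  · linear_combination h + Real.sin θ ^ 2 / 4 * h3

lemma vecD3_dot (θ : ℝ) {i j : Fin 3} (hij : i ≠ j) :
    vecD3 θ i ⬝ᵥ vecD3 θ j = 1 - 3 / 2 * Real.sin θ ^ 2 := by
  have h3 : √3 ^ 2 = 3 := Real.sq_sqrt (by norm_num)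
  have h := Real.sin_sq_add_cos_sq θ
  rw [dot_three]
  fin_cases i <;> fin_cases j <;>
    first
    | exact absurd rfl hij
    | (simp [vecD3, vecXZ]; linear_combination h)
    | (simp [vecD3, vecXZ]; linear_combination h - Real.sin θ ^ 2 / 4 * h3)

lemma vecD3_dot_sq_lt_one {θ : ℝ} (hs : Real.sin θ ≠ 0) {i j : Fin 3} (hij : i ≠ j) :
    (vecD3 θ i ⬝ᵥ vecD3 θ j) ^ 2 < 1 := by
  rw [vecD3_dot θ hij]
  have h1 := Real.sin_sq_add_cos_sq θ
  have h2 : 0 < Real.sin θ ^ 2 := by positivity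
  nlinarith [sq_nonneg (Real.cos θ)]

lemma det_vecD3_ne_zero {θ : ℝ} (hs : Real.sin θ ≠ 0) (hc : Real.cos θ ≠ 0) :
    (Matrix.of ![vecD3 θ 0, vecD3 θ 1, vecD3 θ 2]).det ≠ 0 := by
  intro h0
  have hg := gram_det (vecD3 θ 0) (vecD3 θ 1) (vecD3 θ 2)
  rw [h0, vecD3_dot_self, vecD3_dot_self, vecD3_dot_self, vecD3_dot θ (i := 0) (j := 1) (by decide),
    vecD3_dot θ (i := 0) (j := 2) (by decide), vecD3_dot θ (i := 1) (j := 2) (by decide)] at hg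
  have h1 := Real.sin_sq_add_cos_sq θ
  have : 27 / 4 * (Real.sin θ ^ 4 * Real.cos θ ^ 2) = 0 := by
    linear_combination 27 / 4 * Real.sin θ ^ 4 * h1 - hg
  have h4 : 0 < Real.sin θ ^ 4 * Real.cos θ ^ 2 := by positivity
  linarith

lemma rotZ_mulVec_vecD3 (θ : ℝ) : rot (uRotZ (2 * Real.pi / 3)) *ᵥ vecD3 θ 0 = vecD3 θ 1 ∧
    rot (uRotZ (2 * Real.pi / 3)) *ᵥ vecD3 θ 1 = vecD3 θ 2 ∧
    rot (uRotZ (2 * Real.pi / 3)) *ᵥ vecD3 θ 2 = vecD3 θ 0 := by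
  have h3 : √3 ^ 2 = 3 := Real.sq_sqrt (by norm_num)
  have e : 2 * Real.pi / 3 = Real.pi - Real.pi / 3 := by ring
  have hc : Real.cos (2 * Real.pi / 3) = -(1 / 2) := by
    rw [e, Real.cos_pi_sub, Real.cos_pi_div_three]
  have hs : Real.sin (2 * Real.pi / 3) = √3 / 2 := by
    rw [e, Real.sin_pi_sub, Real.sin_pi_div_three]
  rw [uRotZ_mulVec, uRotZ_mulVec, uRotZ_mulVec, hc, hs]
  refine ⟨?_, ?_, ?_⟩ <;> ext i <;> fin_cases i <;> simp [vecD3, vecXZ] <;> ring_nf <;>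
    simp only [h3] <;> ring

lemma uY_mulVec_vecD3 (θ : ℝ) : rot uY *ᵥ vecD3 θ 0 = -vecD3 θ 0 ∧
    rot uY *ᵥ vecD3 θ 1 = -vecD3 θ 2 ∧ rot uY *ᵥ vecD3 θ 2 = -vecD3 θ 1 := by
  rw [uY_mulVec, uY_mulVec, uY_mulVec]
  refine ⟨?_, ?_, ?_⟩ <;> ext i <;> fin_cases i <;> simp [vecD3, vecXZ]

lemma generated_le_symmetryGroup_D3 (θ : ℝ) :
    generated {rotZ (2 * Real.pi / 3), Y} ≤ symmetryGroup (threeBasesD3 θ) := by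
  obtain ⟨t0, t1, t2⟩ := rotZ_mulVec_vecD3 θ
  obtain ⟨y0, y1, y2⟩ := uY_mulVec_vecD3 θ
  rw [threeBasesD3_eq]
  refine generated_le_symmetryGroup ?_
  rintro U (hU | hU)
  · rw [coe_eq_rotZ.mp hU]
    refine mem_symmetryGroup_of_forall (Set.finite_range _) ?_
    rintro _ ⟨i, rfl⟩
    fin_cases i
    exacts [⟨_, ⟨1, rfl⟩, Or.inl t0⟩, ⟨_, ⟨2, rfl⟩, Or.inl t1⟩, ⟨_, ⟨0, rfl⟩, Or.inl t2⟩]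
  · rw [coe_eq_Y.mp hU]
    refine mem_symmetryGroup_of_forall (Set.finite_range _) ?_
    rintro _ ⟨i, rfl⟩
    fin_cases i
    exacts [⟨_, ⟨0, rfl⟩, Or.inr y0⟩, ⟨_, ⟨2, rfl⟩, Or.inr y1⟩, ⟨_, ⟨1, rfl⟩, Or.inr y2⟩]

/-- The generated group is transitive on the six Bloch vectors, and a symmetry that fixes one of
them cannot interchange the two other axes, as it preserves the orientation. -/
theorem symmetryGroup_D3 {θ : ℝ} (hs : Real.sin θ ≠ 0) (hc : Real.cos θ ≠ 0)
    (h23 : Real.sin θ ^ 2 ≠ 2 / 3) :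
    symmetryGroup (threeBasesD3 θ) = generated {rotZ (2 * Real.pi / 3), Y} := by
  have hT : uRotZ (2 * Real.pi / 3) ∈ generated {rotZ (2 * Real.pi / 3), Y} :=
    mem_generated (Or.inl rfl)
  have hY : uY ∈ generated {rotZ (2 * Real.pi / 3), Y} := mem_generated (Or.inr rfl)
  obtain ⟨t0, t1, t2⟩ := rotZ_mulVec_vecD3 θ
  obtain ⟨y0, y1, y2⟩ := uY_mulVec_vecD3 θ
  have hle := generated_le_symmetryGroup_D3 θ
  have happ : ∀ U ∈ symmetryGroup (threeBasesD3 θ), ∀ i, ∃ j, rot U *ᵥ vecD3 θ i = vecD3 θ j ∨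
      rot U *ᵥ vecD3 θ i = -vecD3 θ j := by
    intro U hU i
    rw [threeBasesD3_eq] at hU
    obtain ⟨_, ⟨j, rfl⟩, h⟩ := exists_eq_or_eq_neg_of_mem_symmetryGroup hU (Set.mem_range_self i)
    exact ⟨j, h⟩
  have c : ∀ j : Fin 3, j = 0 ∨ j = 1 ∨ j = 2 := by decide
  have g01 := vecD3_dot θ (i := 0) (j := 1) (by decide)
  have g02 := vecD3_dot θ (i := 0) (j := 2) (by decide)
  have g12 := vecD3_dot θ (i := 1) (j := 2) (by decide)
  have g10 := vecD3_dot θ (i := 1) (j := 0) (by decide)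
  have g20 := vecD3_dot θ (i := 2) (j := 0) (by decide)
  have g21 := vecD3_dot θ (i := 2) (j := 1) (by decide)
  have hlt := vecD3_dot_sq_lt_one hs (i := 0) (j := 1) (by decide)
  rw [g01] at hlt
  have hg0 : 1 - 3 / 2 * Real.sin θ ^ 2 ≠ 0 := fun h => h23 (by linarith)
  have key : ∀ U ∈ symmetryGroup (threeBasesD3 θ), rot U *ᵥ vecD3 θ 0 = vecD3 θ 0 →
      U ∈ generated {rotZ (2 * Real.pi / 3), Y} := by
    intro U hU h0
    have d1 := dot_rot U (vecD3 θ 0) (vecD3 θ 1)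
    have d2 := dot_rot U (vecD3 θ 0) (vecD3 θ 2)
    have d3 := dot_rot U (vecD3 θ 1) (vecD3 θ 2)
    have dd := det_rot_mulVec U (vecD3 θ 0) (vecD3 θ 1) (vecD3 θ 2)
    have hne := det_vecD3_ne_zero hs hc
    rw [h0] at d1 d2 dd
    obtain ⟨i, h1⟩ := happ U hU 1
    obtain ⟨j, h2⟩ := happ U hU 2
    rw [g01] at d1
    rw [g02] at d2
    rw [g12] at d3
    have e1 : rot U *ᵥ vecD3 θ 1 = vecD3 θ 1 ∨ rot U *ᵥ vecD3 θ 1 = vecD3 θ 2 := by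
      rcases c i with rfl | rfl | rfl <;> rcases h1 with h1 | h1 <;> rw [h1] at d1 <;>
        simp only [dotProduct_neg, vecD3_dot_self, g01, g02] at d1 <;>
        first
        | exact Or.inl h1
        | exact Or.inr h1
        | (exfalso; nlinarith)
        | (exfalso; exact hg0 (by linarith))
    have e2 : rot U *ᵥ vecD3 θ 2 = vecD3 θ 1 ∨ rot U *ᵥ vecD3 θ 2 = vecD3 θ 2 := by
      rcases c j with rfl | rfl | rfl <;> rcases h2 with h2 | h2 <;> rw [h2] at d2 <;>
        simp only [dotProduct_neg, vecD3_dot_self, g01, g02] at d2 <;>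
        first
        | exact Or.inl h2
        | exact Or.inr h2
        | (exfalso; nlinarith)
        | (exfalso; exact hg0 (by linarith))
    rcases e1 with e1 | e1
    · refine mem_generated_of_two (r := vecD3 θ 0) (s := vecD3 θ 1) ?_ (one_mem _)
        (by rw [h0, rot_one_mulVec]) (by rw [e1, rot_one_mulVec])
      rw [vecD3_dot_self, vecD3_dot_self, g01]
      linarith
    · exfalso
      rw [e1] at d3 dd
      rcases e2 with e2 | e2
      · rw [e2, Matrix.det_fin_three, Matrix.det_fin_three] at dd
        rw [Matrix.det_fin_three] at hne
        simp only [Matrix.of_apply, Matrix.cons_val] at dd hne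
        exact hne (by linarith)
      · rw [e2, vecD3_dot_self] at d3
        nlinarith
  refine le_antisymm (fun U hU => ?_) hle
  obtain ⟨V, hV, hVU⟩ : ∃ V ∈ generated {rotZ (2 * Real.pi / 3), Y},
      rot V *ᵥ vecD3 θ 0 = rot U *ᵥ vecD3 θ 0 := by
    obtain ⟨j, h⟩ := happ U hU 0
    rcases c j with rfl | rfl | rfl <;> rcases h with h | h <;> rw [h]
    · exact ⟨1, one_mem _, rot_one_mulVec _⟩
    · exact ⟨uY, hY, y0⟩
    · exact ⟨_, hT, t0⟩
    · exact ⟨_, mul_mem hT hY, by rw [rot_mul_mulVec, y0, Matrix.mulVec_neg, t0]⟩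
    · exact ⟨_, mul_mem hT hT, by rw [rot_mul_mulVec, t0, t1]⟩
    · exact ⟨_, mul_mem hT (mul_mem hT hY),
        by rw [rot_mul_mulVec, rot_mul_mulVec, y0, Matrix.mulVec_neg, t0, Matrix.mulVec_neg, t1]⟩
  have hW := key (V⁻¹ * U) (mul_mem (inv_mem (hle hV)) hU) (by
    rw [rot_mul_mulVec, ← hVU, ← rot_mul_mulVec, inv_mul_cancel, rot_one_mulVec])
  have := mul_mem hV hW
  rwa [mul_inv_cancel_left] at this

lemma ncard_image_range {n : ℕ} {v : Fin n → Fin 3 → ℝ} (hu : ∀ i, v i ⬝ᵥ v i = 1)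
    (h : ∀ i j, i ≠ j → (v i ⬝ᵥ v j) ^ 2 < 1) : (blochBasis '' Set.range v).ncard = n := by
  rw [← Set.range_comp, ← Set.image_univ, Set.ncard_image_of_injective, Set.ncard_univ,
    Nat.card_eq_fintype_card, Fintype.card_fin]
  intro i j hij
  by_contra hne
  have := h i j hne
  rcases blochBasis_eq_iff.mp hij with h' | h' <;> rw [h'] at this <;> simp [hu] at this

/-- The condition is that the probability of equal signs of the three vectors is non-negative. -/
lemma IsNonneg.sin_sq_le {θ : ℝ} (h : IsNonneg.{u} (threeBasesD3 θ)) :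
    Real.sin θ ^ 2 ≤ 8 / 9 := by
  rw [threeBasesD3_eq] at h
  have hm : ∀ i, blochBasis (vecD3 θ i) ∈ blochBasis '' Set.range (vecD3 θ) := fun i =>
    Set.mem_image_of_mem _ (Set.mem_range_self i)
  have := (h.exists_functional (vecD3_dot_self θ 0) (vecD3_dot_self θ 1) (vecD3_dot_self θ 2)
    (vecD3_dot_self θ 0) (hm 0) (hm 1) (hm 2) (hm 0)).1
  rw [vecD3_dot θ (by decide), vecD3_dot θ (by decide), vecD3_dot θ (by decide)] at this
  linarith

lemma cos_ne_zero_of_sin_sq_le {θ : ℝ} (h : Real.sin θ ^ 2 ≤ 8 / 9) : Real.cos θ ≠ 0 := by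
  intro h0
  have := Real.sin_sq_add_cos_sq θ
  rw [h0] at this
  linarith

lemma represents_D3 {θ : ℝ} (hs : Real.sin θ ≠ 0) (h : Real.sin θ ^ 2 ≤ 8 / 9) :
    Represents (weightsD3 θ) (vectorsD3 θ) (threeBasesD3 θ) := by
  have hc := cos_ne_zero_of_sin_sq_le h
  rw [threeBasesD3_eq]
  refine represents_of_frame (weightsD3_nonneg h) (sum_weightsD3 θ) (frame_D3 hs hc) ?_
  rintro _ ⟨i, rfl⟩
  exact abs_dot_vectorsD3 hs hc i

lemma isNonneg_D3 {θ : ℝ} (hs : Real.sin θ ≠ 0) (h : Real.sin θ ^ 2 ≤ 8 / 9) :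
    IsNonneg.{u} (threeBasesD3 θ) := by
  have hc := cos_ne_zero_of_sin_sq_le h
  rw [threeBasesD3_eq]
  refine isNonneg_of_frame (weightsD3_nonneg h) (sum_weightsD3 θ) (frame_D3 hs hc) ?_
  rintro _ ⟨i, rfl⟩
  exact abs_dot_vectorsD3 hs hc i

/-- Unitary equivalence with the stabilizer bases means that the Bloch vectors are orthogonal. -/
lemma dot_eq_zero_of_unitaryEquiv_stabilizer {S : Set (Fin 3 → ℝ)}
    (h : UnitaryEquiv (blochBasis '' S) stabilizerBases) {r s : Fin 3 → ℝ} (hr : r ∈ S)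
    (hs : s ∈ S) (hlt : (r ⬝ᵥ s) ^ 2 < 1) : r ⬝ᵥ s = 0 := by
  obtain ⟨U, hU⟩ := h
  have key : ∀ r ∈ S, ∃ i : Fin 3, rot U *ᵥ r = Pi.single i 1 ∨ rot U *ᵥ r = -Pi.single i 1 := by
    intro r hr
    have h1 : blochBasis (rot U *ᵥ r) ∈ stabilizerBases := by
      rw [← hU, move_image_blochBasis]
      exact Set.mem_image_of_mem _ (Set.mem_image_of_mem _ hr)
    rw [stabilizerBases_eq] at h1
    obtain ⟨_, ⟨i, rfl⟩, h⟩ := h1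
    exact ⟨i, blochBasis_eq_iff.mp h.symm⟩
  obtain ⟨i, hi⟩ := key r hr
  obtain ⟨j, hj⟩ := key s hs
  rw [← dot_rot U] at hlt ⊢
  rcases eq_or_ne i j with rfl | hij
  · rcases hi with hi | hi <;> rcases hj with hj | hj <;> rw [hi, hj] at hlt <;> simp at hlt
  · rcases hi with hi | hi <;> rcases hj with hj | hj <;> rw [hi, hj] <;>
      simp [hij]

lemma unitaryEquiv_stabilizer {v : Fin 3 → Fin 3 → ℝ} (hu : ∀ i, v i ⬝ᵥ v i = 1)
    (h01 : v 0 ⬝ᵥ v 1 = 0) (h02 : v 0 ⬝ᵥ v 2 = 0) (h12 : v 1 ⬝ᵥ v 2 = 0) :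
    UnitaryEquiv (blochBasis '' Set.range v) stabilizerBases := by
  obtain ⟨U, ε, hε, u0, u1, u2⟩ := exists_rot_of_gram_three (r := v 0) (s := v 1) (t := v 2)
    (p := Pi.single 0 1) (q := Pi.single 1 1) (m := Pi.single 2 1)
    (fun h => by
      have := gram_det (v 0) (v 1) (v 2)
      rw [h, hu, hu, hu, h01, h02, h12] at this
      norm_num at this)
    (by rw [hu]; simp) (by rw [hu]; simp) (by rw [hu]; simp) (by rw [h01]; simp)
    (by rw [h02]; simp) (by rw [h12]; simp)
  rw [stabilizerBases_eq]
  refine unitaryEquiv_of_rot U fun i => ?_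
  fin_cases i
  exacts [eq_or_eq_neg_of_eq_smul hε u0, eq_or_eq_neg_of_eq_smul hε u1,
    eq_or_eq_neg_of_eq_smul hε u2]

lemma unitaryEquiv_D3_stabilizer_iff {θ : ℝ} (hs : Real.sin θ ≠ 0) :
    UnitaryEquiv (threeBasesD3 θ) stabilizerBases ↔ Real.sin θ ^ 2 = 2 / 3 := by
  rw [threeBasesD3_eq]
  constructor
  · intro h
    have := dot_eq_zero_of_unitaryEquiv_stabilizer h (Set.mem_range_self 0) (Set.mem_range_self 1)
      (vecD3_dot_sq_lt_one hs (by decide))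
    rw [vecD3_dot θ (by decide)] at this
    linarith
  · intro h
    refine unitaryEquiv_stabilizer (vecD3_dot_self θ) ?_ ?_ ?_ <;>
      rw [vecD3_dot θ (by decide), h] <;> norm_num

/-- Three independent unit vectors with equal scalar products. -/
lemma exists_D3_of_dot {v : Fin 3 → Fin 3 → ℝ} {g : ℝ} (hu : ∀ i, v i ⬝ᵥ v i = 1)
    (hd : (Matrix.of ![v 0, v 1, v 2]).det ≠ 0) (h01 : v 0 ⬝ᵥ v 1 = g) (h02 : v 0 ⬝ᵥ v 2 = g)
    (h12 : v 1 ⬝ᵥ v 2 = g) (hg : g < 1) :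
    ∃ θ ∈ Set.Ioo 0 (Real.pi / 2), Real.sin θ ^ 2 = 2 / 3 * (1 - g) ∧
      UnitaryEquiv (blochBasis '' Set.range v) (threeBasesD3 θ) := by
  have hgram := gram_det (v 0) (v 1) (v 2)
  rw [hu, hu, hu, h01, h02, h12] at hgram
  have hpos : 0 < (Matrix.of ![v 0, v 1, v 2]).det ^ 2 := by positivity
  have hfac : (Matrix.of ![v 0, v 1, v 2]).det ^ 2 = (1 - g) ^ 2 * (1 + 2 * g) := by
    rw [hgram]; ring
  have hg2 : 0 < 1 + 2 * g := by
    rw [hfac] at hpos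
    exact pos_of_mul_pos_right hpos (sq_nonneg _)
  have hlt : √(2 / 3 * (1 - g)) < 1 := by
    rw [Real.sqrt_lt' one_pos]
    linarith
  have h0 : 0 < √(2 / 3 * (1 - g)) := Real.sqrt_pos.mpr (by linarith)
  have hsin : Real.sin (Real.arcsin √(2 / 3 * (1 - g))) = √(2 / 3 * (1 - g)) :=
    Real.sin_arcsin (by linarith) hlt.le
  refine ⟨Real.arcsin √(2 / 3 * (1 - g)), ⟨Real.arcsin_pos.mpr h0,
    Real.arcsin_lt_pi_div_two.mpr hlt⟩, by rw [hsin, Real.sq_sqrt (by linarith)], ?_⟩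
  generalize Real.arcsin √(2 / 3 * (1 - g)) = θ at *
  have hg' : g = 1 - 3 / 2 * Real.sin θ ^ 2 := by
    rw [hsin, Real.sq_sqrt (by linarith)]; ring
  obtain ⟨U, ε, hε, u0, u1, u2⟩ := exists_rot_of_gram_three (p := vecD3 θ 0) (q := vecD3 θ 1)
    (m := vecD3 θ 2) hd (by rw [hu, vecD3_dot_self]) (by rw [hu, vecD3_dot_self])
    (by rw [hu, vecD3_dot_self]) (by rw [h01, vecD3_dot θ (by decide), hg'])
    (by rw [h02, vecD3_dot θ (by decide), hg']) (by rw [h12, vecD3_dot θ (by decide), hg'])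
  rw [threeBasesD3_eq]
  refine unitaryEquiv_of_rot U fun i => ?_
  fin_cases i
  exacts [eq_or_eq_neg_of_eq_smul hε u0, eq_or_eq_neg_of_eq_smul hε u1,
    eq_or_eq_neg_of_eq_smul hε u2]

/-! ### The second family of three bases -/

section Z2

variable {θ φ : ℝ}

lemma vecZ2_dot_self (θ φ : ℝ) (i : Fin 3) : vecZ2 θ φ i ⬝ᵥ vecZ2 θ φ i = 1 := by
  rw [dot_three]
  fin_cases i <;> simp [vecZ2, vecXZ, vecXZ']
  · linear_combination Real.sin_sq_add_cos_sq θ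
  · linear_combination Real.sin_sq_add_cos_sq θ
  · linear_combination Real.sin_sq_add_cos_sq φ

lemma vecZ2_dot01 (θ φ : ℝ) : vecZ2 θ φ 0 ⬝ᵥ vecZ2 θ φ 1 = Real.cos (2 * θ) :=
  vecXZ_dot_vecXZ' θ

lemma vecZ2_dot02 (θ φ : ℝ) : vecZ2 θ φ 0 ⬝ᵥ vecZ2 θ φ 2 = Real.sin θ * Real.cos φ := by
  simp [vecZ2, vecXZ, vecXZ']

lemma vecZ2_dot12 (θ φ : ℝ) : vecZ2 θ φ 1 ⬝ᵥ vecZ2 θ φ 2 = -(Real.sin θ * Real.cos φ) := by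
  simp [vecZ2, vecXZ']

lemma sin_mul_cos_sq_lt_one (hθ : θ ∈ Set.Ioo 0 (Real.pi / 2)) (φ : ℝ) :
    (Real.sin θ * Real.cos φ) ^ 2 < 1 := by
  have h1 := sin_pos_of_mem hθ
  have h2 := cos_pos_of_mem hθ
  have h3 := Real.sin_sq_add_cos_sq θ
  have h4 := Real.cos_sq_le_one φ
  have h5 : Real.sin θ ^ 2 < 1 := by nlinarith
  nlinarith [sq_nonneg (Real.cos φ), sq_nonneg (Real.sin θ)]

lemma vecZ2_dot_sq_lt_one (hθ : θ ∈ Set.Ioo 0 (Real.pi / 2)) (φ : ℝ) {i j : Fin 3} (hij : i ≠ j) :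
    (vecZ2 θ φ i ⬝ᵥ vecZ2 θ φ j) ^ 2 < 1 := by
  have h1 := sq_cos_two_mul_lt_one hθ
  have h2 := sin_mul_cos_sq_lt_one hθ φ
  have a : (vecZ2 θ φ 0 ⬝ᵥ vecZ2 θ φ 1) ^ 2 < 1 := by rwa [vecZ2_dot01]
  have b : (vecZ2 θ φ 0 ⬝ᵥ vecZ2 θ φ 2) ^ 2 < 1 := by rwa [vecZ2_dot02]
  have c : (vecZ2 θ φ 1 ⬝ᵥ vecZ2 θ φ 2) ^ 2 < 1 := by rwa [vecZ2_dot12, neg_sq]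
  fin_cases i <;> fin_cases j <;>
    first
    | exact absurd rfl hij
    | assumption
    | (rw [dotProduct_comm]; assumption)

lemma det_vecZ2_ne_zero (hθ : θ ∈ Set.Ioo 0 (Real.pi / 2)) (hφ : φ ∈ Set.Ioo 0 Real.pi) :
    (Matrix.of ![vecZ2 θ φ 0, vecZ2 θ φ 1, vecZ2 θ φ 2]).det ≠ 0 := by
  have h1 := sin_pos_of_mem hθ
  have h2 := cos_pos_of_mem hθ
  have h3 := Real.sin_pos_of_mem_Ioo hφ
  have : (Matrix.of ![vecZ2 θ φ 0, vecZ2 θ φ 1, vecZ2 θ φ 2]).det =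
      -(2 * (Real.sin θ * Real.cos θ * Real.sin φ)) := by
    rw [Matrix.det_fin_three]
    simp [vecZ2, vecXZ, vecXZ']
    ring
  rw [this]
  have : 0 < Real.sin θ * Real.cos θ * Real.sin φ := by positivity
  linarith

lemma symm_Z2_apply {U : U2} (hU : U ∈ symmetryGroup (threeBasesZ2 θ φ)) (i : Fin 3) :
    ∃ j, rot U *ᵥ vecZ2 θ φ i = vecZ2 θ φ j ∨ rot U *ᵥ vecZ2 θ φ i = -vecZ2 θ φ j := by
  rw [threeBasesZ2_eq] at hU
  obtain ⟨_, ⟨j, rfl⟩, h⟩ := exists_eq_or_eq_neg_of_mem_symmetryGroup hU (Set.mem_range_self i)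
  exact ⟨j, h⟩

lemma uZ_mulVec_vecZ2 (θ φ : ℝ) : rot uZ *ᵥ vecZ2 θ φ 0 = vecZ2 θ φ 1 ∧
    rot uZ *ᵥ vecZ2 θ φ 1 = vecZ2 θ φ 0 ∧ rot uZ *ᵥ vecZ2 θ φ 2 = -vecZ2 θ φ 2 := by
  rw [uZ_mulVec, uZ_mulVec, uZ_mulVec]
  refine ⟨?_, ?_, ?_⟩ <;> ext i <;> fin_cases i <;> simp [vecZ2, vecXZ, vecXZ']

lemma uZ_mem_symmetryGroup_Z2 (θ φ : ℝ) : uZ ∈ symmetryGroup (threeBasesZ2 θ φ) := by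
  obtain ⟨z0, z1, z2⟩ := uZ_mulVec_vecZ2 θ φ
  rw [threeBasesZ2_eq]
  refine mem_symmetryGroup_of_forall (Set.finite_range _) ?_
  rintro _ ⟨i, rfl⟩
  fin_cases i
  exacts [⟨_, ⟨1, rfl⟩, Or.inl z0⟩, ⟨_, ⟨0, rfl⟩, Or.inl z1⟩, ⟨_, ⟨2, rfl⟩, Or.inr z2⟩]

lemma generated_Z_le_symmetryGroup_Z2 (θ φ : ℝ) :
    generated {Z} ≤ symmetryGroup (threeBasesZ2 θ φ) :=
  generated_le_symmetryGroup fun _ hU => coe_eq_Z.mp hU ▸ uZ_mem_symmetryGroup_Z2 θ φ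

lemma sin_mul_cos_ne_zero (hθ : θ ∈ Set.Ioo 0 (Real.pi / 2)) (hφ : φ ∈ Set.Ioo 0 Real.pi)
    (h : φ ≠ Real.pi / 2) : Real.sin θ * Real.cos φ ≠ 0 := by
  refine mul_ne_zero (sin_pos_of_mem hθ).ne' fun h0 => h ?_
  have : Real.cos φ = Real.cos (Real.pi / 2) := by rw [h0, Real.cos_pi_div_two]
  exact Real.injOn_cos ⟨hφ.1.le, hφ.2.le⟩
    ⟨by linarith [Real.pi_pos], by linarith [Real.pi_pos]⟩ this

/-- If the third axis, which is the only one to form the same angle with both other axes, were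
moved to another one, then these two could not have images with the right scalar products. A
symmetry therefore fixes the third axis, and the orientation leaves no choice for the signs. -/
theorem symmetryGroup_Z2 (hθ : θ ∈ Set.Ioo 0 (Real.pi / 2)) (hφ : φ ∈ Set.Ioo 0 Real.pi)
    (h : φ ≠ Real.pi / 2) (hne : |Real.cos (2 * θ)| ≠ Real.sin θ * |Real.cos φ|) :
    symmetryGroup (threeBasesZ2 θ φ) = generated {Z} := by
  have hZ : uZ ∈ generated {Z} := mem_generated rfl
  refine le_antisymm (fun U hU => ?_) (generated_Z_le_symmetryGroup_Z2 θ φ)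
  obtain ⟨z0, z1, z2⟩ := uZ_mulVec_vecZ2 θ φ
  have h0 := sin_mul_cos_ne_zero hθ hφ h
  have hsq : Real.cos (2 * θ) ^ 2 ≠ (Real.sin θ * Real.cos φ) ^ 2 := by
    rw [← abs_of_pos (sin_pos_of_mem hθ), ← abs_mul] at hne
    exact fun h' => hne (sq_eq_sq_iff_abs_eq_abs _ _ |>.mp h')
  have lt1 := sq_cos_two_mul_lt_one hθ
  have lt2 := sin_mul_cos_sq_lt_one hθ φ
  have g01 := vecZ2_dot01 θ φ
  have g02 := vecZ2_dot02 θ φ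
  have g12 := vecZ2_dot12 θ φ
  have d01 := dot_rot U (vecZ2 θ φ 0) (vecZ2 θ φ 1)
  have d02 := dot_rot U (vecZ2 θ φ 0) (vecZ2 θ φ 2)
  have d12 := dot_rot U (vecZ2 θ φ 1) (vecZ2 θ φ 2)
  have dd := det_rot_mulVec U (vecZ2 θ φ 0) (vecZ2 θ φ 1) (vecZ2 θ φ 2)
  have hdet := det_vecZ2_ne_zero hθ hφ
  have hu := vecZ2_dot_self θ φ
  obtain ⟨i, σ, hσ, e0⟩ : ∃ i, ∃ σ : ℝ, (σ = 1 ∨ σ = -1) ∧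
      rot U *ᵥ vecZ2 θ φ 0 = σ • vecZ2 θ φ i := by
    obtain ⟨i, hi | hi⟩ := symm_Z2_apply hU 0
    exacts [⟨i, 1, Or.inl rfl, by simpa using hi⟩, ⟨i, -1, Or.inr rfl, by simpa using hi⟩]
  obtain ⟨j, τ, hτ, e1⟩ : ∃ i, ∃ σ : ℝ, (σ = 1 ∨ σ = -1) ∧
      rot U *ᵥ vecZ2 θ φ 1 = σ • vecZ2 θ φ i := by
    obtain ⟨i, hi | hi⟩ := symm_Z2_apply hU 1
    exacts [⟨i, 1, Or.inl rfl, by simpa using hi⟩, ⟨i, -1, Or.inr rfl, by simpa using hi⟩]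
  obtain ⟨k, ρ, hρ, e2⟩ : ∃ i, ∃ σ : ℝ, (σ = 1 ∨ σ = -1) ∧
      rot U *ᵥ vecZ2 θ φ 2 = σ • vecZ2 θ φ i := by
    obtain ⟨i, hi | hi⟩ := symm_Z2_apply hU 2
    exacts [⟨i, 1, Or.inl rfl, by simpa using hi⟩, ⟨i, -1, Or.inr rfl, by simpa using hi⟩]
  have s1 : σ ^ 2 = 1 := by rcases hσ with rfl | rfl <;> norm_num
  have s2 : τ ^ 2 = 1 := by rcases hτ with rfl | rfl <;> norm_num
  have s3 : ρ ^ 2 = 1 := by rcases hρ with rfl | rfl <;> norm_num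
  rw [e0, e1, e2] at dd
  rw [e0, e1] at d01
  rw [e0, e2] at d02
  rw [e1, e2] at d12
  simp only [dotProduct_smul, smul_dotProduct, smul_eq_mul, g01, g02, g12] at d01 d02 d12
  have q01 := congrArg (· ^ 2) d01
  have q02 := congrArg (· ^ 2) d02
  have q12 := congrArg (· ^ 2) d12
  simp only [mul_pow, neg_sq, s1, s2, s3, one_mul] at q01 q02 q12
  simp only [← mul_pow] at q01 q02 q12
  have g10 := (dotProduct_comm (vecZ2 θ φ 1) (vecZ2 θ φ 0)).trans g01
  have g20 := (dotProduct_comm (vecZ2 θ φ 2) (vecZ2 θ φ 0)).trans g02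
  have g21 := (dotProduct_comm (vecZ2 θ φ 2) (vecZ2 θ φ 1)).trans g12
  have c : ∀ j : Fin 3, j = 0 ∨ j = 1 ∨ j = 2 := by decide
  have perm : k = 2 ∧ ((i = 0 ∧ j = 1) ∨ (i = 1 ∧ j = 0)) := by
    rcases c i with rfl | rfl | rfl <;> rcases c j with rfl | rfl | rfl <;>
      rcases c k with rfl | rfl | rfl <;>
      simp only [hu, g01, g02, g12, g10, g20, g21, neg_sq, one_pow] at q01 q02 q12 <;>
      first
      | (simp; done)
      | (exfalso; linarith)
      | exact absurd q01 hsq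
      | exact absurd q01.symm hsq
  have hgram : (vecZ2 θ φ 0 ⬝ᵥ vecZ2 θ φ 0) * (vecZ2 θ φ 1 ⬝ᵥ vecZ2 θ φ 1) -
      (vecZ2 θ φ 0 ⬝ᵥ vecZ2 θ φ 1) ^ 2 ≠ 0 := by
    rw [hu, hu, g01]; linarith
  rw [Matrix.det_fin_three, Matrix.det_fin_three] at dd
  rw [Matrix.det_fin_three] at hdet
  simp only [Matrix.of_apply, Matrix.cons_val, Pi.smul_apply, smul_eq_mul] at dd hdet
  obtain ⟨rfl, ⟨rfl, rfl⟩ | ⟨rfl, rfl⟩⟩ := perm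
  · rw [g02] at d02
    rw [g12] at d12
    have a : σ * ρ = 1 := mul_right_cancel₀ h0 (by linear_combination d02)
    have b : τ * ρ = 1 := mul_right_cancel₀ h0 (by linear_combination -d12)
    have hst : σ = τ := by linear_combination -σ * b + τ * a
    have hsr : ρ = τ := by linear_combination τ * b - ρ * s2
    subst hst hsr
    have : ρ = 1 := by
      rcases hσ with h' | h'
      · exact h'
      · rw [h'] at dd
        exact absurd (by linarith) hdet
    subst this
    refine mem_generated_of_two hgram (one_mem _) ?_ ?_
    · rw [e0, rot_one_mulVec, one_smul]
    · rw [e1, rot_one_mulVec, one_smul]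
  · rw [g12] at d02
    rw [g02] at d12
    have a : σ * ρ = -1 := mul_right_cancel₀ h0 (by linear_combination -d02)
    have b : τ * ρ = -1 := mul_right_cancel₀ h0 (by linear_combination d12)
    have hst : σ = τ := by linear_combination σ * b - τ * a
    have hsr : ρ = -τ := by linear_combination τ * b - ρ * s2
    subst hst hsr
    have : σ = 1 := by
      rcases hσ with h' | h'
      · exact h'
      · rw [h'] at dd
        exact absurd (by linarith) hdet
    subst this
    refine mem_generated_of_two hgram hZ ?_ ?_
    · rw [e0, z0, one_smul]
    · rw [e1, z1, one_smul]

/-- If the third axis is orthogonal to the plane of the other two, then it is the only one that is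
orthogonal to both other axes. -/
theorem symmetryGroup_Z2_pi_div_two (hθ : θ ∈ Set.Ioo 0 (Real.pi / 2)) (h : θ ≠ Real.pi / 4) :
    symmetryGroup (threeBasesZ2 θ (Real.pi / 2)) = generated {X, Z} := by
  have h0 := cos_two_mul_ne_zero hθ h
  have lt1 := sq_cos_two_mul_lt_one hθ
  have g01 := vecZ2_dot01 θ (Real.pi / 2)
  have g02 := vecZ2_dot02 θ (Real.pi / 2)
  have g12 := vecZ2_dot12 θ (Real.pi / 2)
  rw [Real.cos_pi_div_two, mul_zero] at g02 g12
  rw [neg_zero] at g12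
  apply le_antisymm
  · intro U hU
    rw [← symmetryGroup_twoBases hθ h, twoBases_eq]
    have d01 := dot_rot U (vecZ2 θ (Real.pi / 2) 0) (vecZ2 θ (Real.pi / 2) 1)
    rw [g01] at d01
    obtain ⟨i, hi⟩ := symm_Z2_apply hU 0
    obtain ⟨j, hj⟩ := symm_Z2_apply hU 1
    have c : ∀ j : Fin 3, j = 0 ∨ j = 1 ∨ j = 2 := by decide
    have hij : i ≠ 2 ∧ j ≠ 2 := by
      have g20 := (dotProduct_comm (vecZ2 θ (Real.pi / 2) 2) (vecZ2 θ (Real.pi / 2) 0)).trans g02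
      have g21 := (dotProduct_comm (vecZ2 θ (Real.pi / 2) 2) (vecZ2 θ (Real.pi / 2) 1)).trans g12
      have hu := vecZ2_dot_self θ (Real.pi / 2) 2
      constructor
      · rintro rfl
        rcases c j with rfl | rfl | rfl <;> rcases hi with hi | hi <;> rcases hj with hj | hj <;>
          rw [hi, hj] at d01 <;>
          simp only [dotProduct_neg, neg_dotProduct, neg_neg, g20, g21, hu, neg_zero] at d01 <;>
          first
          | exact h0 d01.symm
          | (rw [← d01] at lt1; norm_num at lt1)
      · rintro rfl
        rcases c i with rfl | rfl | rfl <;> rcases hi with hi | hi <;> rcases hj with hj | hj <;>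
          rw [hi, hj] at d01 <;>
          simp only [dotProduct_neg, neg_dotProduct, neg_neg, g02, g12, hu, neg_zero] at d01 <;>
          first
          | exact h0 d01.symm
          | (rw [← d01] at lt1; norm_num at lt1)
    have hmem : ∀ i : Fin 3, i ≠ 2 →
        vecZ2 θ (Real.pi / 2) i ∈ ({vecXZ θ, vecXZ' θ} : Set (Fin 3 → ℝ)) := by
      intro i hi
      rcases c i with rfl | rfl | rfl
      exacts [Or.inl rfl, Or.inr rfl, absurd rfl hi]
    refine mem_symmetryGroup_of_forall (Set.toFinite _) ?_
    rintro _ (rfl | rfl)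
    exacts [⟨_, hmem i hij.1, hi⟩, ⟨_, hmem j hij.2, hj⟩]
  · refine generated_le_symmetryGroup ?_
    rintro U (hU | hU)
    · rw [coe_eq_X.mp hU, threeBasesZ2_eq]
      refine mem_symmetryGroup_of_forall (Set.finite_range _) ?_
      rintro _ ⟨i, rfl⟩
      rw [uX_mulVec]
      fin_cases i
      · exact ⟨_, ⟨1, rfl⟩, Or.inr (by ext i; fin_cases i <;> simp [vecZ2, vecXZ, vecXZ'])⟩
      · exact ⟨_, ⟨0, rfl⟩, Or.inr (by ext i; fin_cases i <;> simp [vecZ2, vecXZ, vecXZ'])⟩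
      · exact ⟨_, ⟨2, rfl⟩, Or.inr (by ext i; fin_cases i <;> simp [vecZ2, vecXZ'])⟩
    · exact coe_eq_Z.mp hU ▸ uZ_mem_symmetryGroup_Z2 _ _

/-- The two conditions are the non-negativity of the probabilities of the sign patterns with opposite
signs of the first two vectors. -/
lemma IsNonneg.abs_cos_le (hθ : θ ∈ Set.Ioo 0 (Real.pi / 2))
    (h : IsNonneg.{u} (threeBasesZ2 θ φ)) : |Real.cos φ| ≤ Real.sin θ := by
  rw [threeBasesZ2_eq] at h
  have hm : ∀ i, blochBasis (vecZ2 θ φ i) ∈ blochBasis '' Set.range (vecZ2 θ φ) := fun i =>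
    Set.mem_image_of_mem _ (Set.mem_range_self i)
  have hn : ∀ i, blochBasis (-vecZ2 θ φ i) ∈ blochBasis '' Set.range (vecZ2 θ φ) := fun i => by
    rw [blochBasis_neg]; exact hm i
  have hu := vecZ2_dot_self θ φ
  have c0 := (h.exists_functional (hu 0) (neg_dot_neg_self (hu 1)) (hu 2) (hu 0) (hm 0) (hn 1)
    (hm 2) (hm 0)).1
  have c1 := (h.exists_functional (hu 0) (neg_dot_neg_self (hu 1)) (neg_dot_neg_self (hu 2)) (hu 0)
    (hm 0) (hn 1) (hn 2) (hm 0)).1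
  simp only [dotProduct_neg, neg_dotProduct, neg_neg, vecZ2_dot01, vecZ2_dot02, vecZ2_dot12,
    Real.cos_two_mul] at c0 c1
  have h1 := sin_pos_of_mem hθ
  have h2 := Real.sin_sq_add_cos_sq θ
  rw [abs_le]
  constructor
  · exact le_of_mul_le_mul_left (by linarith) h1
  · exact le_of_mul_le_mul_left (by linarith) h1

lemma represents_Z2 (hθ : θ ∈ Set.Ioo 0 (Real.pi / 2)) (hφ : φ ∈ Set.Ioo 0 Real.pi)
    (h : |Real.cos φ| ≤ Real.sin θ) :
    Represents (weightsZ2 θ φ) (vectorsZ2 θ φ) (threeBasesZ2 θ φ) := by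
  have hs := (sin_pos_of_mem hθ).ne'
  have hc := (cos_pos_of_mem hθ).ne'
  have hp := (Real.sin_pos_of_mem_Ioo hφ).ne'
  rw [threeBasesZ2_eq]
  refine represents_of_frame (weightsZ2_nonneg h) (sum_weightsZ2 θ φ) (frame_Z2 hs hc hp) ?_
  rintro _ ⟨i, rfl⟩
  exact abs_dot_vectorsZ2 hs hc hp i

lemma isNonneg_Z2 (hθ : θ ∈ Set.Ioo 0 (Real.pi / 2)) (hφ : φ ∈ Set.Ioo 0 Real.pi)
    (h : |Real.cos φ| ≤ Real.sin θ) : IsNonneg.{u} (threeBasesZ2 θ φ) := by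
  have hs := (sin_pos_of_mem hθ).ne'
  have hc := (cos_pos_of_mem hθ).ne'
  have hp := (Real.sin_pos_of_mem_Ioo hφ).ne'
  rw [threeBasesZ2_eq]
  refine isNonneg_of_frame (weightsZ2_nonneg h) (sum_weightsZ2 θ φ) (frame_Z2 hs hc hp) ?_
  rintro _ ⟨i, rfl⟩
  exact abs_dot_vectorsZ2 hs hc hp i

lemma pi_div_two_mem : Real.pi / 2 ∈ Set.Ioo 0 Real.pi :=
  ⟨by linarith [Real.pi_pos], by linarith [Real.pi_pos]⟩

lemma abs_cos_pi_div_two_le (hθ : θ ∈ Set.Ioo 0 (Real.pi / 2)) :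
    |Real.cos (Real.pi / 2)| ≤ Real.sin θ := by
  rw [Real.cos_pi_div_two, abs_zero]
  exact (sin_pos_of_mem hθ).le

lemma twoBases_subset (θ φ : ℝ) : twoBases θ ⊆ threeBasesZ2 θ φ := by
  rintro _ (rfl | rfl)
  exacts [Or.inl rfl, Or.inr (Or.inl rfl)]

lemma IsNonneg.mono {B C : Set (Set Op)} (hC : IsNonneg.{u} C) (h : B ⊆ C) : IsNonneg.{u} B := by
  obtain ⟨Λ, m, ν, F, G, h1, h2⟩ := hC
  exact ⟨Λ, m, ν, F, G, h1, fun b hb => h2 b (h hb)⟩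

lemma Represents.mono {n : ℕ} {q : Fin n → ℝ} {d : Fin n → Fin 3 → ℝ} {B C : Set (Set Op)}
    (hC : Represents q d C) (h : B ⊆ C) : Represents q d B :=
  ⟨hC.1, hC.2.1, fun b hb => hC.2.2 b (h hb)⟩

lemma represents_twoBases (hθ : θ ∈ Set.Ioo 0 (Real.pi / 2)) :
    Represents (weightsZ2 θ (Real.pi / 2)) (vectorsZ2 θ (Real.pi / 2)) (twoBases θ) :=
  (represents_Z2 hθ pi_div_two_mem (abs_cos_pi_div_two_le hθ)).mono (twoBases_subset _ _)

lemma isNonneg_twoBases (hθ : θ ∈ Set.Ioo 0 (Real.pi / 2)) : IsNonneg.{u} (twoBases θ) :=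
  (isNonneg_Z2 hθ pi_div_two_mem (abs_cos_pi_div_two_le hθ)).mono (twoBases_subset _ _)

lemma unitaryEquiv_Z2_stabilizer_iff (hθ : θ ∈ Set.Ioo 0 (Real.pi / 2))
    (hφ : φ ∈ Set.Ioo 0 Real.pi) :
    UnitaryEquiv (threeBasesZ2 θ φ) stabilizerBases ↔ θ = Real.pi / 4 ∧ φ = Real.pi / 2 := by
  rw [threeBasesZ2_eq]
  constructor
  · intro h
    have a := dot_eq_zero_of_unitaryEquiv_stabilizer h (Set.mem_range_self 0)
      (Set.mem_range_self 1) (vecZ2_dot_sq_lt_one hθ φ (by decide))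
    have b := dot_eq_zero_of_unitaryEquiv_stabilizer h (Set.mem_range_self 0)
      (Set.mem_range_self 2) (vecZ2_dot_sq_lt_one hθ φ (by decide))
    rw [vecZ2_dot01] at a
    rw [vecZ2_dot02] at b
    constructor
    · by_contra h'
      exact cos_two_mul_ne_zero hθ h' a
    · by_contra h'
      exact sin_mul_cos_ne_zero hθ hφ h' b
  · rintro ⟨rfl, rfl⟩
    refine unitaryEquiv_stabilizer (vecZ2_dot_self _ _) ?_ ?_ ?_
    · rw [vecZ2_dot01, show 2 * (Real.pi / 4) = Real.pi / 2 by ring, Real.cos_pi_div_two]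
    · rw [vecZ2_dot02, Real.cos_pi_div_two, mul_zero]
    · rw [vecZ2_dot12, Real.cos_pi_div_two, mul_zero, neg_zero]

/-- After a change of the signs of the Bloch vectors their scalar products are all equal, so the
three bases belong to the first family, too. -/
lemma exists_unitaryEquiv_Z2_D3 (hθ : θ ∈ Set.Ioo 0 (Real.pi / 2)) (hφ : φ ∈ Set.Ioo 0 Real.pi)
    (h : φ ≠ Real.pi / 2) (he : |Real.cos (2 * θ)| = Real.sin θ * |Real.cos φ|) :
    ∃ η ∈ Set.Ioo 0 (Real.pi / 2), Real.sin η ^ 2 ≠ 2 / 3 ∧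
      UnitaryEquiv (threeBasesZ2 θ φ) (threeBasesD3 η) := by
  have h0 := sin_mul_cos_ne_zero hθ hφ h
  have lt1 := sq_cos_two_mul_lt_one hθ
  have hu := vecZ2_dot_self θ φ
  rw [← abs_of_pos (sin_pos_of_mem hθ), ← abs_mul, abs_eq_abs] at he
  obtain ⟨σ, hσ, hm⟩ : ∃ σ : ℝ, (σ = 1 ∨ σ = -1) ∧
      σ * (Real.sin θ * Real.cos φ) = -Real.cos (2 * θ) := by
    rcases he with he | he
    · exact ⟨-1, Or.inr rfl, by rw [he]; ring⟩
    · exact ⟨1, Or.inl rfl, by rw [he]; ring⟩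
  have hs2 : σ * σ = 1 := mul_self_eq_one_iff.mpr hσ
  have hs0 : σ ≠ 0 := fun h => by rw [h] at hs2; norm_num at hs2
  have hc0 : Real.cos (2 * θ) ≠ 0 := fun h' => by
    rw [h', neg_zero] at hm
    exact mul_ne_zero hs0 h0 hm
  obtain ⟨η, hη, hsin, hequiv⟩ := exists_D3_of_dot
    (v := ![vecZ2 θ φ 0, -vecZ2 θ φ 1, σ • vecZ2 θ φ 2]) (g := -Real.cos (2 * θ))
    (by
      intro i
      fin_cases i <;> simp [hu, hs2])
    (by
      have hd := det_vecZ2_ne_zero hθ hφ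
      have e : (Matrix.of ![vecZ2 θ φ 0, -vecZ2 θ φ 1, σ • vecZ2 θ φ 2]).det =
          -σ * (Matrix.of ![vecZ2 θ φ 0, vecZ2 θ φ 1, vecZ2 θ φ 2]).det := by
        rw [Matrix.det_fin_three, Matrix.det_fin_three]
        simp only [Matrix.of_apply, Matrix.cons_val, Pi.smul_apply, Pi.neg_apply, smul_eq_mul]
        ring
      exact (e.symm ▸ mul_ne_zero (neg_ne_zero.mpr hs0) hd :
        (Matrix.of ![vecZ2 θ φ 0, -vecZ2 θ φ 1, σ • vecZ2 θ φ 2]).det ≠ 0))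
    (by simp [vecZ2_dot01])
    (by simp [vecZ2_dot02, hm])
    (by simp [vecZ2_dot12, hm])
    (by nlinarith)
  refine ⟨η, hη, fun h' => hc0 (by linarith), ?_⟩
  have e : threeBasesZ2 θ φ =
      blochBasis '' Set.range ![vecZ2 θ φ 0, -vecZ2 θ φ 1, σ • vecZ2 θ φ 2] := by
    rw [threeBasesZ2_eq, ← Set.range_comp, ← Set.range_comp]
    congr 1
    funext i
    fin_cases i
    exacts [rfl, (blochBasis_neg _).symm, (blochBasis_smul hσ _).symm]
  rwa [e]

end Z2

/-! ### Point groups -/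

lemma mk_eq_one_iff {U : U2} : QuotientGroup.mk' phases U = 1 ↔ rot U = 1 := by
  rw [QuotientGroup.mk'_apply, QuotientGroup.eq_one_iff, mem_phases_iff]

lemma pointGroup_congr {B C : Set (Set Op)} (h : symmetryGroup B = symmetryGroup C) :
    pointGroup B = pointGroup C := by
  rw [pointGroup, pointGroup, h]

lemma pointGroup_eq_closure {B : Set (Set Op)} {S : Set Op} (h : symmetryGroup B = generated S) :
    pointGroup B = Subgroup.closure (QuotientGroup.mk' phases '' {U | (U : Op) ∈ S}) := by
  have h0 : phases.map (QuotientGroup.mk' phases) = ⊥ := by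
    rw [Subgroup.map_eq_bot_iff, QuotientGroup.ker_mk']
  rw [pointGroup, h, generated, Subgroup.map_sup, h0, sup_bot_eq, MonoidHom.map_closure]

/-- The rotation of a unitary, as a homomorphism. -/
def rotHom : U2 →* Matrix (Fin 3) (Fin 3) ℝ where
  toFun := rot
  map_one' := rot_one
  map_mul' := rot_mul

lemma rot_pow (U : U2) (n : ℕ) : rot (U ^ n) = rot U ^ n := map_pow rotHom U n

lemma orderOf_mk (U : U2) : orderOf (QuotientGroup.mk' phases U) = orderOf (rot U) := by
  rw [orderOf_eq_orderOf_iff]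
  intro n
  rw [← map_pow, mk_eq_one_iff, rot_pow]

/-- Recognition of a dihedral group by generators: `r` of order `n` and an involution `s`, not in
the group generated by `r`, that inverts `r`. -/
lemma nonempty_closure_mulEquiv_dihedralGroup {G : Type*} [Group G] {n : ℕ} [NeZero n] {r s : G}
    (hr : orderOf r = n) (hs : s * s = 1) (hrs : s * r * s = r⁻¹) (hne : ∀ k : ℕ, s * r ^ k ≠ 1) :
    Nonempty (Subgroup.closure {r, s} ≃* DihedralGroup n) := by
  -- the powers of `r`, with exponents in `ZMod n`
  obtain ⟨P, hP⟩ : ∃ P : ZMod n → G, ∀ a, P a = r ^ a.val := ⟨_, fun _ => rfl⟩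
  have hmod : ∀ k : ℕ, r ^ (k % n) = r ^ k := fun k => by rw [← hr, pow_mod_orderOf]
  have hadd : ∀ a b, P (a + b) = P a * P b := by
    intro a b
    rw [hP, hP, hP, ZMod.val_add, hmod, pow_add]
  have hinv : s⁻¹ = s := inv_eq_of_mul_eq_one_left hs
  have hconj : ∀ a, P a * s = s * (P a)⁻¹ := by
    intro a
    have h1 : (s * r * s⁻¹) ^ a.val = s * r ^ a.val * s⁻¹ := conj_pow
    rw [hinv, hrs, inv_pow] at h1
    rw [hP, h1, ← mul_assoc, ← mul_assoc, hs, one_mul]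
  have hsub : ∀ a b, (P a)⁻¹ * P b = P (b - a) := by
    intro a b
    rw [inv_mul_eq_iff_eq_mul, ← hadd, add_sub_cancel]
  let f : DihedralGroup n →* G := MonoidHom.mk' (fun x => match x with
    | .r i => P i
    | .sr i => s * P i) (by
      rintro (a | a) (b | b)
      · exact hadd a b
      · show s * P (b - a) = P a * (s * P b)
        rw [← mul_assoc, hconj, mul_assoc, hsub]
      · show s * P (a + b) = s * P a * P b
        rw [hadd, mul_assoc]
      · show P (b - a) = s * P a * (s * P b)
        rw [mul_assoc, ← mul_assoc (P a), hconj, mul_assoc, ← mul_assoc, hs, one_mul, hsub])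
  have hf : Function.Injective f := by
    rw [injective_iff_map_eq_one]
    rintro (a | a) h
    · have h' : r ^ a.val = 1 := by rw [← hP]; exact h
      have h1 := orderOf_dvd_of_pow_eq_one h'
      rw [hr] at h1
      have h2 := Nat.eq_zero_of_dvd_of_lt h1 (ZMod.val_lt a)
      rw [(ZMod.val_eq_zero a).mp h2]
      rfl
    · have h' : s * r ^ a.val = 1 := by rw [← hP]; exact h
      exact absurd h' (hne _)
  have hrange : f.range = Subgroup.closure {r, s} := by
    have hrm : r ∈ Subgroup.closure {r, s} := Subgroup.subset_closure (Or.inl rfl)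
    have hsm : s ∈ Subgroup.closure {r, s} := Subgroup.subset_closure (Or.inr rfl)
    apply le_antisymm
    · rintro _ ⟨a | a, rfl⟩
      · show P a ∈ _
        rw [hP]
        exact pow_mem hrm _
      · show s * P a ∈ _
        rw [hP]
        exact mul_mem hsm (pow_mem hrm _)
    · rw [Subgroup.closure_le]
      rintro _ (rfl | rfl)
      · refine ⟨.r 1, ?_⟩
        show P 1 = _
        rw [hP, ZMod.val_one_eq_one_mod, hmod, pow_one]
      · refine ⟨.sr 0, ?_⟩
        show _ * P 0 = _
        rw [hP, ZMod.val_zero, pow_zero, mul_one]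
  exact ⟨((MonoidHom.ofInjective hf).trans (MulEquiv.subgroupCongr hrange)).symm⟩

/-- A point group generated by a rotation of order `n` and by a half-turn that inverts it and does
not fix its axis `w`. -/
lemma nonempty_pointGroup_mulEquiv_dihedralGroup {B : Set (Set Op)} {S : Set Op} {R T : U2} {n : ℕ}
    [NeZero n] {w : Fin 3 → ℝ} (h : symmetryGroup B = generated S)
    (hS : ∀ U : U2, (U : Op) ∈ S ↔ U = R ∨ U = T) (hR : orderOf (rot R) = n)
    (hT : rot T * rot T = 1) (hRT : rot T * rot R * rot T * rot R = 1) (hw : rot R *ᵥ w = w)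
    (hw' : rot T *ᵥ w ≠ w) : Nonempty (pointGroup B ≃* DihedralGroup n) := by
  have e : pointGroup B =
      Subgroup.closure {QuotientGroup.mk' phases R, QuotientGroup.mk' phases T} := by
    rw [pointGroup_eq_closure h, ← Set.image_pair]
    congr 2
    ext U
    exact hS U
  rw [e]
  refine nonempty_closure_mulEquiv_dihedralGroup ?_ ?_ ?_ fun k hk => ?_
  · rw [orderOf_mk, hR]
  · rw [← map_mul, mk_eq_one_iff, rot_mul, hT]
  · rw [eq_inv_iff_mul_eq_one, ← map_mul, ← map_mul, ← map_mul, mk_eq_one_iff, rot_mul, rot_mul,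
      rot_mul, hRT]
  · rw [← map_pow, ← map_mul, mk_eq_one_iff, rot_mul, rot_pow] at hk
    have hp : ∀ k : ℕ, rot R ^ k *ᵥ w = w := by
      intro k
      induction k with
      | zero => rw [pow_zero, Matrix.one_mulVec]
      | succ k ih => rw [pow_succ, ← Matrix.mulVec_mulVec, hw, ih]
    apply hw'
    conv_lhs => rw [← hp k, Matrix.mulVec_mulVec, hk, Matrix.one_mulVec]

lemma pointGroup_XZ {B : Set (Set Op)} (h : symmetryGroup B = generated {X, Z}) :
    Nonempty (pointGroup B ≃* DihedralGroup 2) := by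
  refine nonempty_pointGroup_mulEquiv_dihedralGroup (R := uX) (T := uZ) (w := ![1, 0, 0]) h
    (fun U => or_congr coe_eq_X coe_eq_Z) (orderOf_eq_prime ?_ ?_) ?_ ?_ ?_ ?_
  · rw [pow_two, rot_uX]; ext i j; fin_cases i <;> fin_cases j <;> simp
  · intro h
    have := congrFun (congrFun h 1) 1
    rw [rot_uX] at this
    norm_num at this
  · rw [rot_uZ]; ext i j; fin_cases i <;> fin_cases j <;> simp
  · rw [rot_uX, rot_uZ]; ext i j; fin_cases i <;> fin_cases j <;>
      simp
  · rw [uX_mulVec]; ext i; fin_cases i <;> simp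
  · rw [uZ_mulVec]
    intro h
    have := congrFun h 0
    norm_num at this

lemma pointGroup_XS {B : Set (Set Op)} (h : symmetryGroup B = generated {X, sqrtY}) :
    Nonempty (pointGroup B ≃* DihedralGroup 4) := by
  refine nonempty_pointGroup_mulEquiv_dihedralGroup (R := uS) (T := uX) (w := ![0, 1, 0]) h
    (fun U => (or_congr coe_eq_X coe_eq_S).trans or_comm)
    (orderOf_eq_prime_pow (p := 2) (n := 1) ?_ ?_) ?_ ?_ ?_ ?_
  · intro h
    have := congrFun (congrFun h 0) 0
    rw [rot_uS] at this
    norm_num [pow_two] at this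
  · rw [rot_uS]; ext i j; fin_cases i <;> fin_cases j <;> simp [pow_succ]
  · rw [rot_uX]; ext i j; fin_cases i <;> fin_cases j <;> simp
  · rw [rot_uX, rot_uS]; ext i j; fin_cases i <;> fin_cases j <;> simp
  · rw [uS_mulVec]; ext i; fin_cases i <;> simp
  · rw [uX_mulVec]
    intro h
    have := congrFun h 1
    norm_num at this

lemma pointGroup_XP {B : Set (Set Op)} (h : symmetryGroup B = generated {X, phaseGate}) :
    Nonempty (pointGroup B ≃* DihedralGroup 4) := by
  refine nonempty_pointGroup_mulEquiv_dihedralGroup (R := uP) (T := uX) (w := ![0, 0, 1]) h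
    (fun U => (or_congr coe_eq_X coe_eq_P).trans or_comm)
    (orderOf_eq_prime_pow (p := 2) (n := 1) ?_ ?_) ?_ ?_ ?_ ?_
  · intro h
    have := congrFun (congrFun h 0) 0
    rw [rot_uP] at this
    norm_num [pow_two] at this
  · rw [rot_uP]; ext i j; fin_cases i <;> fin_cases j <;> simp [pow_succ]
  · rw [rot_uX]; ext i j; fin_cases i <;> fin_cases j <;> simp
  · rw [rot_uX, rot_uP]; ext i j; fin_cases i <;> fin_cases j <;> simp
  · rw [uP_mulVec]; ext i; fin_cases i <;> simp
  · rw [uX_mulVec]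
    intro h
    have : (-1 : ℝ) = 1 := congrFun h 2
    norm_num at this

lemma pointGroup_rotZ_Y {B : Set (Set Op)}
    (h : symmetryGroup B = generated {rotZ (2 * Real.pi / 3), Y}) :
    Nonempty (pointGroup B ≃* DihedralGroup 3) := by
  have h2 : √3 ^ 2 = 3 := Real.sq_sqrt (by norm_num)
  have h3 : √3 ^ 3 = 3 * √3 := by rw [pow_succ, h2]
  have e : 2 * Real.pi / 3 = Real.pi - Real.pi / 3 := by ring
  have hc : Real.cos (2 * Real.pi / 3) = -(1 / 2) := by
    rw [e, Real.cos_pi_sub, Real.cos_pi_div_three]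
  have hs : Real.sin (2 * Real.pi / 3) = √3 / 2 := by
    rw [e, Real.sin_pi_sub, Real.sin_pi_div_three]
  refine nonempty_pointGroup_mulEquiv_dihedralGroup (R := uRotZ (2 * Real.pi / 3)) (T := uY)
    (w := ![0, 0, 1]) h (fun U => or_congr coe_eq_rotZ coe_eq_Y) (orderOf_eq_prime ?_ ?_) ?_ ?_ ?_ ?_
  · rw [rot_uRotZ, hc, hs]
    ext i j
    fin_cases i <;> fin_cases j <;> simp [pow_succ] <;> ring_nf <;>
      (try simp only [h2, h3]) <;> try ring
  · intro h
    have := congrFun (congrFun h 0) 0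
    rw [rot_uRotZ, hc] at this
    norm_num at this
  · rw [rot_uY]; ext i j; fin_cases i <;> fin_cases j <;> simp
  · rw [rot_uRotZ, hc, hs, rot_uY]
    ext i j
    fin_cases i <;> fin_cases j <;> simp <;> ring_nf <;>
      (try simp only [h2]) <;> try ring
  · rw [uRotZ_mulVec]; ext i; fin_cases i <;> simp
  · rw [uY_mulVec]
    intro h
    have : (-1 : ℝ) = 1 := congrFun h 2
    norm_num at this

lemma pointGroup_Z {B : Set (Set Op)} (h : symmetryGroup B = generated {Z}) :
    Nonempty (pointGroup B ≃* Multiplicative (ZMod 2)) := by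
  have e : pointGroup B = Subgroup.zpowers (QuotientGroup.mk' phases uZ) := by
    rw [pointGroup_eq_closure h, Subgroup.zpowers_eq_closure, ← Set.image_singleton]
    congr 2
    ext U
    exact coe_eq_Z
  have hord : orderOf (QuotientGroup.mk' phases uZ) = 2 := by
    rw [orderOf_mk]
    refine orderOf_eq_prime ?_ ?_
    · rw [pow_two, rot_uZ]; ext i j; fin_cases i <;> fin_cases j <;> simp
    · intro h
      have := congrFun (congrFun h 0) 0
      rw [rot_uZ] at this
      norm_num at this
  rw [e]
  exact ⟨mulEquivOfPrimeCardEq (p := 2) (by rw [Nat.card_zpowers, hord])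
    (by rw [Nat.card_eq_fintype_card, Fintype.card_multiplicative, ZMod.card])⟩

/-- A surjective homomorphism from the symmetry group whose kernel consists of the phases
identifies the point group. -/
lemma nonempty_pointGroup_mulEquiv {B : Set (Set Op)} {G : Type*} [Group G]
    (f : symmetryGroup B →* G) (hf : Function.Surjective f)
    (hk : ∀ U, f U = 1 ↔ (U : U2) ∈ phases) : Nonempty (pointGroup B ≃* G) := by
  let g := (QuotientGroup.mk' phases).subgroupMap (symmetryGroup B)
  have hg : Function.Surjective g := MonoidHom.subgroupMap_surjective _ _
  have h : g.ker = f.ker := by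
    ext U
    rw [MonoidHom.mem_ker, MonoidHom.mem_ker, hk, mem_phases_iff, ← mk_eq_one_iff]
    exact Subtype.ext_iff
  exact ⟨(QuotientGroup.quotientKerEquivOfSurjective g hg).symm.trans
    ((QuotientGroup.quotientMulEquivOfEq h).trans
      (QuotientGroup.quotientKerEquivOfSurjective f hf))⟩

lemma UnitaryEquiv.nonempty_pointGroup_mulEquiv {B C : Set (Set Op)} (h : UnitaryEquiv B C) :
    Nonempty (pointGroup B ≃* pointGroup C) := by
  obtain ⟨U, rfl⟩ := h
  refine Qubit.nonempty_pointGroup_mulEquiv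
    ((((QuotientGroup.mk' phases).comp (MulAut.conj U).toMonoidHom).comp
      (symmetryGroup B).subtype).codRestrict (pointGroup (move U B)) ?_) ?_ ?_
  · intro V
    refine ⟨U * V * U⁻¹, ?_, rfl⟩
    rw [SetLike.mem_coe, symmetryGroup_move]
    have : U⁻¹ * (U * V * U⁻¹) * U = V := by group
    rw [this]
    exact V.2
  · rintro ⟨_, W, hW, rfl⟩
    refine ⟨⟨U⁻¹ * W * U, (symmetryGroup_move U B).mp hW⟩, Subtype.ext ?_⟩
    show QuotientGroup.mk' phases (U * (U⁻¹ * W * U) * U⁻¹) = _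
    congr 1
    group
  · intro V
    rw [Subtype.ext_iff]
    show QuotientGroup.mk' phases (U * V * U⁻¹) = 1 ↔ _
    rw [QuotientGroup.mk'_apply, QuotientGroup.eq_one_iff]
    constructor
    · intro h
      have := phases_normal.conj_mem _ h U⁻¹
      have e : U⁻¹ * (U * V * U⁻¹) * U⁻¹⁻¹ = V := by group
      rwa [e] at this
    · exact fun h => phases_normal.conj_mem _ h U

/-! ### The point group of one basis -/

/-- The upper left block of a matrix. -/
def upperLeft (R : Matrix (Fin 3) (Fin 3) ℝ) : Matrix (Fin 2) (Fin 2) ℝ :=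
  !![R 0 0, R 0 1; R 1 0, R 1 1]

/-- The rotations of the symmetries of one basis are block matrices. -/
lemma rot_block_of_mem {U : U2} (hU : U ∈ symmetryGroup oneBasis) :
    rot U 0 2 = 0 ∧ rot U 1 2 = 0 ∧ rot U 2 0 = 0 ∧ rot U 2 1 = 0 := by
  have key : ∀ V ∈ symmetryGroup oneBasis, rot V 0 2 = 0 ∧ rot V 1 2 = 0 := by
    intro V hV
    rw [oneBasis_eq] at hV
    obtain ⟨_, rfl, h⟩ := exists_eq_or_eq_neg_of_mem_symmetryGroup hV (Set.mem_singleton _)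
    have e : ∀ i, (rot V *ᵥ ![0, 0, 1]) i = rot V i 2 := fun i => by
      simp [Matrix.mulVec, dotProduct, Fin.sum_univ_three]
    rw [← e, ← e]
    rcases h with h | h <;> rw [h] <;> simp
  obtain ⟨h1, h2⟩ := key U hU
  obtain ⟨h3, h4⟩ := key U⁻¹ (inv_mem hU)
  rw [rot_inv] at h3 h4
  exact ⟨h1, h2, h3, h4⟩

lemma upperLeft_mul {R S : Matrix (Fin 3) (Fin 3) ℝ} (h0 : R 0 2 = 0) (h1 : R 1 2 = 0) :
    upperLeft (R * S) = upperLeft R * upperLeft S := by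
  ext i j
  fin_cases i <;> fin_cases j <;>
    simp [upperLeft, Matrix.mul_apply, Fin.sum_univ_three, h0, h1]

lemma upperLeft_one : upperLeft 1 = 1 := by
  ext i j
  fin_cases i <;> fin_cases j <;> simp [upperLeft]

lemma upperLeft_transpose (R : Matrix (Fin 3) (Fin 3) ℝ) : upperLeft Rᵀ = (upperLeft R)ᵀ := by
  ext i j
  fin_cases i <;> fin_cases j <;> simp [upperLeft]

/-- The symmetries of one basis act on the plane that is orthogonal to the axis by arbitrary
orthogonal transformations; the orientation determines what happens to the axis. -/
theorem pointGroup_oneBasis :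
    Nonempty (pointGroup oneBasis ≃* Matrix.orthogonalGroup (Fin 2) ℝ) := by
  have horth : ∀ U : symmetryGroup oneBasis,
      upperLeft (rot U) ∈ Matrix.orthogonalGroup (Fin 2) ℝ := by
    intro U
    obtain ⟨h1, h2, -, -⟩ := rot_block_of_mem U.2
    rw [Matrix.mem_orthogonalGroup_iff, ← upperLeft_transpose, ← upperLeft_mul h1 h2,
      rot_mul_transpose, upperLeft_one]
  let f : symmetryGroup oneBasis →* Matrix.orthogonalGroup (Fin 2) ℝ :=
    MonoidHom.mk' (fun U => ⟨upperLeft (rot U), horth U⟩) fun U V => Subtype.ext (by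
      obtain ⟨h1, h2, -, -⟩ := rot_block_of_mem U.2
      show upperLeft (rot (U * V)) = upperLeft (rot U) * upperLeft (rot V)
      rw [rot_mul, upperLeft_mul h1 h2])
  refine nonempty_pointGroup_mulEquiv f ?_ ?_
  · rintro ⟨A, hA⟩
    have hd : A.det * A.det = 1 := by
      have h := congrArg Matrix.det ((Matrix.mem_orthogonalGroup_iff' _ _).mp hA)
      rwa [Matrix.det_mul, Matrix.det_transpose, Matrix.det_one] at h
    have hA' := (Matrix.mem_orthogonalGroup_iff' _ _).mp hA
    have e : ∀ i j, (Aᵀ * A) i j = A 0 i * A 0 j + A 1 i * A 1 j := fun i j => by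
      simp [Matrix.mul_apply, Matrix.transpose_apply]
    have a00 := (e 0 0).symm.trans (congrFun (congrFun hA' 0) 0)
    have a01 := (e 0 1).symm.trans (congrFun (congrFun hA' 0) 1)
    have a10 := (e 1 0).symm.trans (congrFun (congrFun hA' 1) 0)
    have a11 := (e 1 1).symm.trans (congrFun (congrFun hA' 1) 1)
    simp only [Matrix.one_apply_eq, ne_eq, zero_ne_one, one_ne_zero, not_false_eq_true,
      Matrix.one_apply_ne] at a00 a01 a10 a11
    obtain ⟨U, hU⟩ := exists_rot_eq
      (R := !![A 0 0, A 0 1, 0; A 1 0, A 1 1, 0; 0, 0, A.det])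
      (by
        ext i j
        fin_cases i <;> fin_cases j <;>
          simp [Matrix.mul_apply, Fin.sum_univ_three, a00, a01, a10, a11, hd])
      (by
        rw [Matrix.det_fin_three]
        simp only [Matrix.of_apply, Matrix.cons_val]
        rw [Matrix.det_fin_two] at hd ⊢
        linear_combination hd)
    have hm : U ∈ symmetryGroup oneBasis := by
      rw [oneBasis_eq]
      refine mem_symmetryGroup_of_forall (Set.finite_singleton _) ?_
      rintro _ rfl
      refine ⟨_, rfl, ?_⟩
      have : rot U *ᵥ ![0, 0, 1] = A.det • ![0, 0, 1] := by
        rw [hU]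
        ext i
        fin_cases i <;> simp [Matrix.mulVec, dotProduct, Fin.sum_univ_three]
      exact eq_or_eq_neg_of_eq_smul (mul_self_eq_one_iff.mp hd) this
    refine ⟨⟨U, hm⟩, Subtype.ext ?_⟩
    show upperLeft (rot U) = A
    rw [hU]
    ext i j
    fin_cases i <;> fin_cases j <;> simp [upperLeft]
  · intro U
    rw [mem_phases_iff, Subtype.ext_iff]
    show upperLeft (rot U) = 1 ↔ _
    constructor
    · intro h
      obtain ⟨h02, h12, h20, h21⟩ := rot_block_of_mem U.2
      have h00 : rot U 0 0 = 1 := by simpa [upperLeft] using congrFun (congrFun h 0) 0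
      have h01 : rot U 0 1 = 0 := by simpa [upperLeft] using congrFun (congrFun h 0) 1
      have h10 : rot U 1 0 = 0 := by simpa [upperLeft] using congrFun (congrFun h 1) 0
      have h11 : rot U 1 1 = 1 := by simpa [upperLeft] using congrFun (congrFun h 1) 1
      have hd := det_rot (U : U2)
      rw [Matrix.det_fin_three, h00, h01, h02, h10, h11, h12, h20, h21] at hd
      have h22 : rot U 2 2 = 1 := by linarith
      ext i j
      fin_cases i <;> fin_cases j <;> simp [h00, h01, h02, h10, h11, h12, h20, h21, h22]
    · intro h
      rw [h, upperLeft_one]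

/-! ### The point group of the cube -/

/-- The four Bloch vectors of the cube that are the vertices of a regular tetrahedron. -/
def tetraOne : Fin 4 → Fin 3 → ℝ := tetra fun _ => 1

lemma tetraOne_dot (i j : Fin 4) : tetraOne i ⬝ᵥ tetraOne j = if i = j then 3 else -1 := by
  fin_cases i <;> fin_cases j <;> simp [tetraOne, tetra] <;> norm_num

lemma sum_tetraOne : ∑ i, tetraOne i = 0 := by
  rw [Fin.sum_univ_four]
  ext i
  fin_cases i <;> simp [tetraOne, tetra]

lemma eq_of_tetraOne {σ τ : ℝ} {i j : Fin 4} (hσ : σ = 1 ∨ σ = -1) (hτ : τ = 1 ∨ τ = -1)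
    (h : σ • tetraOne i = τ • tetraOne j) : i = j := by
  by_contra hij
  have := congrArg (tetraOne i ⬝ᵥ ·) h
  simp only [dotProduct_smul, tetraOne_dot, if_neg hij, smul_eq_mul, if_true] at this
  rcases hσ with rfl | rfl <;> rcases hτ with rfl | rfl <;> norm_num at this

lemma symm_tetraOne_apply {U : U2} (hU : U ∈ symmetryGroup (blochBasis '' cuboid fun _ => 1))
    (i : Fin 4) : ∃ j, ∃ σ : ℝ, (σ = 1 ∨ σ = -1) ∧ rot U *ᵥ tetraOne i = σ • tetraOne j := by
  rw [image_cuboid] at hU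
  obtain ⟨_, ⟨j, rfl⟩, h | h⟩ := exists_eq_or_eq_neg_of_mem_symmetryGroup hU (Set.mem_range_self i)
  · exact ⟨j, 1, Or.inl rfl, by rw [one_smul]; exact h⟩
  · exact ⟨j, -1, Or.inr rfl, by rw [neg_one_smul]; exact h⟩

lemma det_tetraOne_ne_zero {i j k : Fin 4} (hij : i ≠ j) (hik : i ≠ k) (hjk : j ≠ k) :
    (Matrix.of ![tetraOne i, tetraOne j, tetraOne k]).det ≠ 0 := by
  intro h
  have := gram_det (tetraOne i) (tetraOne j) (tetraOne k)
  simp only [h, tetraOne_dot, if_neg hij, if_neg hik, if_neg hjk, if_true] at this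
  norm_num at this

/-- The symmetries of the cube permute its four body diagonals in all possible ways. -/
theorem pointGroup_cube :
    Nonempty (pointGroup (blochBasis '' cuboid fun _ => 1) ≃* Equiv.Perm (Fin 4)) := by
  choose p σ hσ hp using fun U : symmetryGroup (blochBasis '' cuboid fun _ => 1) =>
    symm_tetraOne_apply U.2
  have huniq : ∀ (U : symmetryGroup (blochBasis '' cuboid fun _ => 1)) i j (τ : ℝ), (τ = 1 ∨ τ = -1) →
      rot (U : U2) *ᵥ tetraOne i = τ • tetraOne j → p U i = j := fun U i j τ hτ h =>
    eq_of_tetraOne (hσ U i) hτ ((hp U i).symm.trans h)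
  let f : symmetryGroup (blochBasis '' cuboid fun _ => 1) →* Function.End (Fin 4) :=
    { toFun := p
      map_one' := funext fun i => huniq 1 i i 1 (Or.inl rfl)
        (by rw [one_smul]; exact rot_one_mulVec _)
      map_mul' := fun U V => funext fun i =>
        huniq (U * V) i (p U (p V i)) (σ V i * σ U (p V i))
          (by rcases hσ V i with h | h <;> rcases hσ U (p V i) with h' | h' <;> rw [h, h'] <;> norm_num)
          (by
            show rot ((U : U2) * V) *ᵥ _ = _
            rw [rot_mul_mulVec, hp, Matrix.mulVec_smul, hp, smul_smul]) }
  refine nonempty_pointGroup_mulEquiv f.toHomPerm ?_ ?_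
  · intro q
    have hq : ∀ i j, tetraOne i ⬝ᵥ tetraOne j = tetraOne (q i) ⬝ᵥ tetraOne (q j) := by
      intro i j
      simp only [tetraOne_dot, q.injective.eq_iff]
    obtain ⟨U, ε, hε, h0, h1, h2⟩ := exists_rot_of_gram_three (r := tetraOne 0) (s := tetraOne 1)
      (t := tetraOne 2) (det_tetraOne_ne_zero (by decide) (by decide) (by decide))
      (hq 0 0) (hq 1 1) (hq 2 2) (hq 0 1) (hq 0 2) (hq 1 2)
    have h3 : rot U *ᵥ tetraOne 3 = ε • tetraOne (q 3) := by
      have a : rot U *ᵥ (∑ i, tetraOne i) = 0 := by rw [sum_tetraOne, Matrix.mulVec_zero]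
      have b : ε • ∑ i, tetraOne (q i) = 0 := by
        rw [Equiv.sum_comp q tetraOne, sum_tetraOne, smul_zero]
      rw [Fin.sum_univ_four, Matrix.mulVec_add, Matrix.mulVec_add, Matrix.mulVec_add, h0, h1,
        h2] at a
      rw [Fin.sum_univ_four, smul_add, smul_add, smul_add] at b
      exact add_left_cancel (a.trans b.symm)
    have h : ∀ i, rot U *ᵥ tetraOne i = ε • tetraOne (q i) := by
      intro i
      fin_cases i
      exacts [h0, h1, h2, h3]
    have hU : U ∈ symmetryGroup (blochBasis '' cuboid fun _ => 1) := by
      rw [image_cuboid]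
      refine mem_symmetryGroup_of_forall (Set.finite_range _) ?_
      rintro _ ⟨i, rfl⟩
      exact ⟨_, ⟨q i, rfl⟩, eq_or_eq_neg_of_eq_smul hε (h i)⟩
    refine ⟨⟨U, hU⟩, Equiv.ext fun i => ?_⟩
    exact huniq ⟨U, hU⟩ i (q i) ε hε (h i)
  · intro U
    rw [mem_phases_iff]
    constructor
    · intro h
      have hfix : ∀ i, p U i = i := fun i => congrArg (fun e : Equiv.Perm (Fin 4) => e i) h
      have hU : ∀ i, rot (U : U2) *ᵥ tetraOne i = σ U i • tetraOne i := fun i => by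
        rw [hp, hfix]
      -- the scalar products show that the signs are equal, and the orientation that they are `1`
      have hs : ∀ i j, i ≠ j → σ U i * σ U j = 1 := by
        intro i j hij
        have := dot_rot (U : U2) (tetraOne i) (tetraOne j)
        rw [hU, hU, smul_dotProduct, dotProduct_smul, tetraOne_dot, if_neg hij, smul_eq_mul,
          smul_eq_mul] at this
        linarith
      have s01 := hs 0 1 (by decide)
      have s02 := hs 0 2 (by decide)
      have hd := det_rot_mulVec (U : U2) (tetraOne 0) (tetraOne 1) (tetraOne 2)
      have hne := det_tetraOne_ne_zero (i := 0) (j := 1) (k := 2) (by decide) (by decide) (by decide)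
      rw [hU, hU, hU] at hd
      have e : (Matrix.of ![σ U 0 • tetraOne 0, σ U 1 • tetraOne 1, σ U 2 • tetraOne 2]).det =
          σ U 0 * σ U 1 * σ U 2 * (Matrix.of ![tetraOne 0, tetraOne 1, tetraOne 2]).det := by
        rw [Matrix.det_fin_three, Matrix.det_fin_three]
        simp only [Matrix.of_apply, Matrix.cons_val, Pi.smul_apply, smul_eq_mul]
        ring
      rw [e, s01, one_mul] at hd
      have s2 : σ U 2 = 1 := mul_right_cancel₀ hne (by rw [hd, one_mul])
      have s0 : σ U 0 = 1 := by rw [s2, mul_one] at s02; exact s02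
      have s1 : σ U 1 = 1 := by rw [s0, one_mul] at s01; exact s01
      rw [← rot_one]
      refine rot_eq_of_two (r := tetraOne 0) (s := tetraOne 1) ?_ ?_ ?_
      · simp only [tetraOne_dot]
        norm_num
      · rw [hU, s0, one_smul, rot_one_mulVec]
      · rw [hU, s1, one_smul, rot_one_mulVec]
    · intro h
      refine Equiv.ext fun i => ?_
      exact huniq U i i 1 (Or.inl rfl) (by rw [h, Matrix.one_mulVec, one_smul])

lemma pointGroup_of_clifford {B : Set (Set Op)}
    (h : symmetryGroup B = generated {hadamard, phaseGate}) :
    Nonempty (pointGroup B ≃* Equiv.Perm (Fin 4)) := by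
  rw [pointGroup_congr (h.trans (symmetryGroup_cube (c := fun _ => 1) (fun _ => one_pos) rfl
    rfl).symm)]
  exact pointGroup_cube

/-! ### Cuboids with two equal edges -/

/-- The axes of a cuboid can be permuted cyclically. -/
lemma unitaryEquiv_cuboid_shift (c : Fin 3 → ℝ) :
    UnitaryEquiv (blochBasis '' cuboid c) (blochBasis '' cuboid ![c 1, c 2, c 0]) := by
  obtain ⟨U, hU⟩ := exists_rot_eq (R := !![0, 1, 0; 0, 0, 1; 1, 0, 0])
    (by ext i j; fin_cases i <;> fin_cases j <;> simp [Matrix.mul_apply, Fin.sum_univ_three])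
    (by rw [Matrix.det_fin_three]; simp)
  have h : ∀ r : Fin 3 → ℝ, rot U *ᵥ r = ![r 1, r 2, r 0] := by
    intro r
    rw [hU]
    ext i
    fin_cases i <;> simp [Matrix.mulVec, dotProduct, Fin.sum_univ_three]
  refine ⟨U, ?_⟩
  rw [move_image_blochBasis]
  congr 1
  ext v
  constructor
  · rintro ⟨w, hw, rfl⟩ i
    simp only [h]
    fin_cases i
    exacts [hw 1, hw 2, hw 0]
  · intro hv
    refine ⟨![v 2, v 0, v 1], fun i => ?_, ?_⟩
    · fin_cases i
      exacts [hv 2, hv 0, hv 1]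
    · simp only [h]
      ext i
      fin_cases i <;> simp

theorem pointGroup_cuboid_of_not_injective {c : Fin 3 → ℝ} (hc : ∀ i, 0 < c i)
    (h : ¬ Function.Injective c) (h' : ¬ ∀ i j, c i = c j) :
    Nonempty (pointGroup (blochBasis '' cuboid c) ≃* DihedralGroup 4) := by
  have key : ∀ c : Fin 3 → ℝ, (∀ i, 0 < c i) → c 0 = c 1 → c 0 ≠ c 2 →
      Nonempty (pointGroup (blochBasis '' cuboid c) ≃* DihedralGroup 4) := fun c hc h01 h02 =>
    pointGroup_XP (symmetryGroup_cuboid_of_eq_of_ne hc h01 h02)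
  have hshift : ∀ c : Fin 3 → ℝ, (∀ i, 0 < c i) → ∀ i, 0 < ![c 1, c 2, c 0] i := by
    intro c hc i
    fin_cases i
    exacts [hc 1, hc 2, hc 0]
  have htrans : ∀ c : Fin 3 → ℝ,
      Nonempty (pointGroup (blochBasis '' cuboid ![c 1, c 2, c 0]) ≃* DihedralGroup 4) →
      Nonempty (pointGroup (blochBasis '' cuboid c) ≃* DihedralGroup 4) := by
    rintro c ⟨e⟩
    obtain ⟨e'⟩ := (unitaryEquiv_cuboid_shift c).nonempty_pointGroup_mulEquiv
    exact ⟨e'.trans e⟩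
  have h3 : ¬ (c 0 = c 1 ∧ c 0 = c 2) := by
    rintro ⟨h1, h2⟩
    apply h'
    have : ∀ i, c i = c 0 := by
      intro i
      fin_cases i
      exacts [rfl, h1.symm, h2.symm]
    intro i j
    rw [this i, this j]
  have h2 : c 0 = c 1 ∨ c 1 = c 2 ∨ c 0 = c 2 := by
    by_contra hcon
    push Not at hcon
    obtain ⟨n1, n2, n3⟩ := hcon
    apply h
    intro i j hij
    fin_cases i <;> fin_cases j <;>
      first
      | rfl
      | exact absurd hij n1
      | exact absurd hij n2
      | exact absurd hij n3
      | exact absurd hij.symm n1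
      | exact absurd hij.symm n2
      | exact absurd hij.symm n3
  rcases h2 with h2 | h2 | h2
  · exact key c hc h2 fun h => h3 ⟨h2, h⟩
  · refine htrans c (key _ (hshift c hc) h2 ?_)
    exact fun h => h3 ⟨Eq.symm h, (Eq.symm h).trans h2⟩
  · refine htrans c (htrans _ (key _ (hshift _ (hshift c hc)) h2.symm ?_))
    exact fun h => h3 ⟨h2.trans h, h2⟩

/-! ### The properties of the families of bases -/

lemma isBasis_of_mem_image {S : Set (Fin 3 → ℝ)} (h : ∀ r ∈ S, r ⬝ᵥ r = 1) :
    ∀ b ∈ blochBasis '' S, IsBasis b := by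
  rintro _ ⟨r, hr, rfl⟩
  exact isBasis_iff.mpr ⟨r, h r hr, rfl⟩

lemma uZ_notMem_phases : uZ ∉ phases := by
  rw [mem_phases_iff, rot_uZ]
  intro h
  have := congrFun (congrFun h 0) 0
  norm_num at this

lemma uY_notMem_phases : uY ∉ phases := by
  rw [mem_phases_iff, rot_uY]
  intro h
  have := congrFun (congrFun h 0) 0
  norm_num at this

lemma represents_stabilizerBases :
    Represents weightsStabilizer vectorsStabilizer stabilizerBases := by
  rw [stabilizerBases_eq]
  refine represents_of_frame (fun a => by simp [weightsStabilizer]) sum_weightsStabilizer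
    frame_stabilizer ?_
  rintro _ ⟨i, rfl⟩
  exact abs_dot_vectorsStabilizer i

lemma isNonneg_stabilizerBases : IsNonneg.{u} stabilizerBases := by
  rw [stabilizerBases_eq]
  refine isNonneg_of_frame (fun a => by simp [weightsStabilizer]) sum_weightsStabilizer
    frame_stabilizer ?_
  rintro _ ⟨i, rfl⟩
  exact abs_dot_vectorsStabilizer i

lemma oneBasis_subset : oneBasis ⊆ stabilizerBases := by
  rintro _ rfl
  exact Or.inr (Or.inr rfl)

lemma properties_oneBasis : oneBasis.Nonempty ∧ (∀ b ∈ oneBasis, IsBasis b) ∧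
    IsNonneg.{u} oneBasis ∧ HasNontrivialSymmetry oneBasis := by
  refine ⟨Set.singleton_nonempty _, ?_, isNonneg_stabilizerBases.mono oneBasis_subset,
    hasNontrivialSymmetry_iff.mpr ⟨uRotZ Real.pi, ?_, ?_⟩⟩
  · rw [oneBasis_eq]
    refine isBasis_of_mem_image ?_
    rintro _ rfl
    simp
  · rw [symmetryGroup_oneBasis]
    exact mem_generated (Or.inl ⟨_, rfl⟩)
  · rw [mem_phases_iff, rot_uRotZ]
    intro h
    have := congrFun (congrFun h 0) 0
    simp at this
    norm_num at this

lemma ncard_twoBases {θ : ℝ} (hθ : θ ∈ Set.Ioo 0 (Real.pi / 2)) : (twoBases θ).ncard = 2 := by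
  have e : twoBases θ = blochBasis '' Set.range ![vecXZ θ, vecXZ' θ] := by
    rw [twoBases_eq, Matrix.range_cons, Matrix.range_cons, Matrix.range_empty, Set.union_empty]
    rfl
  have h := sq_cos_two_mul_lt_one hθ
  rw [e]
  refine ncard_image_range ?_ ?_
  · intro i
    fin_cases i
    exacts [vecXZ_dot_self θ, vecXZ'_dot_self θ]
  · have h1 : (vecXZ θ ⬝ᵥ vecXZ' θ) ^ 2 < 1 := by rwa [vecXZ_dot_vecXZ']
    have h2 : (vecXZ' θ ⬝ᵥ vecXZ θ) ^ 2 < 1 := by rwa [dotProduct_comm]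
    intro i j hij
    fin_cases i <;> fin_cases j
    exacts [absurd rfl hij, h1, h2, absurd rfl hij]

lemma properties_twoBases {θ : ℝ} (hθ : θ ∈ Set.Ioo 0 (Real.pi / 2)) :
    (twoBases θ).Nonempty ∧ (∀ b ∈ twoBases θ, IsBasis b) ∧ IsNonneg.{u} (twoBases θ) ∧
      HasNontrivialSymmetry (twoBases θ) := by
  refine ⟨⟨_, Or.inl rfl⟩, ?_, isNonneg_twoBases hθ,
    hasNontrivialSymmetry_iff.mpr ⟨uZ, uZ_mem_symmetryGroup_twoBases θ, uZ_notMem_phases⟩⟩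
  rw [twoBases_eq]
  refine isBasis_of_mem_image ?_
  rintro _ (rfl | rfl)
  exacts [vecXZ_dot_self θ, vecXZ'_dot_self θ]

lemma properties_D3 {θ : ℝ} (hθ : θ ∈ Set.Ioo 0 Real.pi) (h : Real.sin θ ^ 2 ≤ 8 / 9) :
    (threeBasesD3 θ).Nonempty ∧ (∀ b ∈ threeBasesD3 θ, IsBasis b) ∧
      IsNonneg.{u} (threeBasesD3 θ) ∧ HasNontrivialSymmetry (threeBasesD3 θ) := by
  refine ⟨⟨_, Or.inl rfl⟩, ?_, isNonneg_D3 (Real.sin_pos_of_mem_Ioo hθ).ne' h,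
    hasNontrivialSymmetry_iff.mpr ⟨uY, generated_le_symmetryGroup_D3 θ
      (mem_generated (Or.inr rfl)), uY_notMem_phases⟩⟩
  rw [threeBasesD3_eq]
  refine isBasis_of_mem_image ?_
  rintro _ ⟨i, rfl⟩
  exact vecD3_dot_self θ i

lemma properties_Z2 {θ φ : ℝ} (hθ : θ ∈ Set.Ioo 0 (Real.pi / 2)) (hφ : φ ∈ Set.Ioo 0 Real.pi)
    (h : |Real.cos φ| ≤ Real.sin θ) :
    (threeBasesZ2 θ φ).Nonempty ∧ (∀ b ∈ threeBasesZ2 θ φ, IsBasis b) ∧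
      IsNonneg.{u} (threeBasesZ2 θ φ) ∧ HasNontrivialSymmetry (threeBasesZ2 θ φ) := by
  refine ⟨⟨_, Or.inl rfl⟩, ?_, isNonneg_Z2 hθ hφ h,
    hasNontrivialSymmetry_iff.mpr ⟨uZ, uZ_mem_symmetryGroup_Z2 θ φ, uZ_notMem_phases⟩⟩
  rw [threeBasesZ2_eq]
  refine isBasis_of_mem_image ?_
  rintro _ ⟨i, rfl⟩
  exact vecZ2_dot_self θ φ i

section Cuboid

variable {θ φ : ℝ}

lemma cuboid_dot_self {r : Fin 3 → ℝ} (hr : r ∈ cuboid (cuboidVec θ φ)) : r ⬝ᵥ r = 1 := by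
  have h := sum_sq_cuboidVec θ φ
  rw [Fin.sum_univ_three] at h
  have e : ∀ i, r i ^ 2 = cuboidVec θ φ i ^ 2 := fun i => by
    rcases hr i with h | h <;> rw [h]
    ring
  rw [dot_self_three, e, e, e, h]

lemma ncard_cuboidBases (hθ : θ ∈ Set.Ioo 0 (Real.pi / 2)) (hφ : φ ∈ Set.Ioo 0 (Real.pi / 2)) :
    (cuboidBases θ φ).ncard = 4 := by
  have hc := cuboidVec_pos hθ hφ
  have h := sum_sq_cuboidVec θ φ
  rw [cuboidBases_eq, image_cuboid]
  generalize cuboidVec θ φ = c at hc h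
  rw [Fin.sum_univ_three] at h
  have h0 := pow_pos (hc 0) 2
  have h1 := pow_pos (hc 1) 2
  have h2 := pow_pos (hc 2) 2
  have e0 : (2 * c 0 ^ 2 - 1) ^ 2 < 1 := by nlinarith
  have e1 : (2 * c 1 ^ 2 - 1) ^ 2 < 1 := by nlinarith
  have e2 : (2 * c 2 ^ 2 - 1) ^ 2 < 1 := by nlinarith
  refine ncard_image_range ?_ ?_
  · intro i
    fin_cases i <;> simp [tetra] <;> linarith
  · intro i j hij
    have hd : tetra c i ⬝ᵥ tetra c j = 2 * c 0 ^ 2 - 1 ∨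
        tetra c i ⬝ᵥ tetra c j = 2 * c 1 ^ 2 - 1 ∨ tetra c i ⬝ᵥ tetra c j = 2 * c 2 ^ 2 - 1 := by
      rw [dot_three]
      fin_cases i <;> fin_cases j <;>
        first
        | exact absurd rfl hij
        | (left; simp [tetra]; linarith)
        | (right; left; simp [tetra]; linarith)
        | (right; right; simp [tetra]; linarith)
    rcases hd with hd | hd | hd <;> rwa [hd]

lemma represents_cuboidBases (hθ : θ ∈ Set.Ioo 0 (Real.pi / 2)) (hφ : φ ∈ Set.Ioo 0 (Real.pi / 2)) :
    Represents (weightsCuboid θ φ) (vectorsCuboid θ φ) (cuboidBases θ φ) := by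
  have hc := fun i => (cuboidVec_pos hθ hφ i).ne'
  rw [cuboidBases_eq]
  exact represents_of_frame (fun a => sq_nonneg _) (sum_sq_cuboidVec θ φ) (frame_cuboid hc)
    fun r hr => abs_dot_vectorsCuboid hc hr

lemma properties_cuboidBases (hθ : θ ∈ Set.Ioo 0 (Real.pi / 2))
    (hφ : φ ∈ Set.Ioo 0 (Real.pi / 2)) :
    (cuboidBases θ φ).Nonempty ∧ (∀ b ∈ cuboidBases θ φ, IsBasis b) ∧
      IsNonneg.{u} (cuboidBases θ φ) ∧ HasNontrivialSymmetry (cuboidBases θ φ) := by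
  have hc := fun i => (cuboidVec_pos hθ hφ i).ne'
  rw [cuboidBases_eq]
  refine ⟨⟨_, cuboidVec θ φ, fun i => Or.inl rfl, rfl⟩,
    isBasis_of_mem_image fun r hr => cuboid_dot_self hr, ?_,
    hasNontrivialSymmetry_iff.mpr ⟨uZ, uZ_mem_symmetryGroup_cuboid _, uZ_notMem_phases⟩⟩
  exact isNonneg_of_frame (q := weightsCuboid θ φ) (fun a => sq_nonneg _) (sum_sq_cuboidVec θ φ)
    (frame_cuboid hc) fun r hr => abs_dot_vectorsCuboid hc hr

lemma cuboidVec_pi_div_four_eq_iff (hθ : θ ∈ Set.Ioo 0 (Real.pi / 2)) :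
    cuboidVec θ (Real.pi / 4) 0 = cuboidVec θ (Real.pi / 4) 2 ↔ Real.cos θ = 1 / √3 := by
  have hs := sin_pos_of_mem hθ
  have hc := cos_pos_of_mem hθ
  have h := Real.sin_sq_add_cos_sq θ
  have h2 : √2 ^ 2 = 2 := Real.sq_sqrt (by norm_num)
  have h3 : √3 ^ 2 = 3 := Real.sq_sqrt (by norm_num)
  have e3 : Real.cos θ = 1 / √3 ↔ Real.cos θ ^ 2 = 1 / 3 := by
    rw [← sq_eq_sq₀ hc.le (by positivity), div_pow, one_pow, h3]
  have e2 : √2 / 2 * Real.sin θ = Real.cos θ ↔ Real.sin θ ^ 2 / 2 = Real.cos θ ^ 2 := by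
    rw [← sq_eq_sq₀ (by positivity) hc.le, mul_pow, div_pow, h2]
    constructor <;> intro h' <;> linarith
  rw [e3]
  simp only [cuboidVec, Matrix.cons_val, Real.cos_pi_div_four]
  rw [e2]
  constructor <;> intro h' <;> linarith

lemma cuboidVec_pi_div_four (θ : ℝ) :
    cuboidVec θ (Real.pi / 4) 0 = cuboidVec θ (Real.pi / 4) 1 := by
  simp [cuboidVec]

end Cuboid

lemma weightsD3_eq {θ : ℝ} (h : Real.sin θ ^ 2 = 2 / 3) : weightsD3 θ = weightsStabilizer := by
  ext a
  fin_cases a <;> simp [weightsD3, weightsStabilizer, h] <;> norm_num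

lemma weightsZ2_pi_div_four : weightsZ2 (Real.pi / 4) (Real.pi / 2) = weightsStabilizer := by
  have h2 : √2 ^ 2 = 2 := Real.sq_sqrt (by norm_num)
  ext a
  fin_cases a <;> simp [weightsZ2, weightsStabilizer] <;> ring_nf <;> rw [h2] <;> norm_num

end Qubit

end

theorem mainTheorem3 :
    -- the exhaustive list
    (∀ B : Set (Set Qubit.Op),
      (B.Nonempty ∧ (∀ b ∈ B, Qubit.IsBasis b) ∧ Qubit.IsNonneg.{u} B ∧
          Qubit.HasNontrivialSymmetry B) ↔
        (Qubit.UnitaryEquiv B Qubit.oneBasis ∨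
        (∃ θ ∈ Set.Ioo 0 (Real.pi / 2), Qubit.UnitaryEquiv B (Qubit.twoBases θ)) ∨
        (∃ θ ∈ Set.Ioo 0 Real.pi, Real.sin θ ^ 2 ≤ 8 / 9 ∧
          Qubit.UnitaryEquiv B (Qubit.threeBasesD3 θ)) ∨
        (∃ θ ∈ Set.Ioo 0 (Real.pi / 2), ∃ φ ∈ Set.Ioo 0 Real.pi, |Real.cos φ| ≤ Real.sin θ ∧
          Qubit.UnitaryEquiv B (Qubit.threeBasesZ2 θ φ)) ∨
        (∃ θ ∈ Set.Ioo 0 (Real.pi / 2), ∃ φ ∈ Set.Ioo 0 (Real.pi / 2),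
          Qubit.UnitaryEquiv B (Qubit.cuboidBases θ φ)))) ∧
    -- one basis
    (Qubit.oneBasis.ncard = 1 ∧
      Qubit.symmetryGroup Qubit.oneBasis =
        Qubit.generated (Set.range Qubit.rotZ ∪ {Qubit.X}) ∧
      Nonempty (Qubit.pointGroup Qubit.oneBasis ≃* Matrix.orthogonalGroup (Fin 2) ℝ) ∧
      Qubit.Represents Qubit.weightsStabilizer Qubit.vectorsStabilizer Qubit.oneBasis) ∧
    -- two bases
    (∀ θ ∈ Set.Ioo 0 (Real.pi / 2),
      (Qubit.twoBases θ).ncard = 2 ∧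
      (θ ≠ Real.pi / 4 →
        Qubit.symmetryGroup (Qubit.twoBases θ) = Qubit.generated {Qubit.X, Qubit.Z} ∧
        Nonempty (Qubit.pointGroup (Qubit.twoBases θ) ≃* DihedralGroup 2)) ∧
      (θ = Real.pi / 4 →
        Qubit.symmetryGroup (Qubit.twoBases θ) = Qubit.generated {Qubit.X, Qubit.sqrtY} ∧
        Nonempty (Qubit.pointGroup (Qubit.twoBases θ) ≃* DihedralGroup 4)) ∧
      Qubit.Represents (Qubit.weightsZ2 θ (Real.pi / 2)) (Qubit.vectorsZ2 θ (Real.pi / 2))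
        (Qubit.twoBases θ)) ∧
    -- three bases, first family
    (∀ θ ∈ Set.Ioo 0 Real.pi,
      (Qubit.threeBasesD3 θ).ncard = 3 ∧
      (Qubit.IsNonneg.{u} (Qubit.threeBasesD3 θ) ↔ Real.sin θ ^ 2 ≤ 8 / 9) ∧
      (θ ≠ Real.pi / 2 → Real.sin θ ^ 2 ≠ 2 / 3 →
        Qubit.symmetryGroup (Qubit.threeBasesD3 θ) =
          Qubit.generated {Qubit.rotZ (2 * Real.pi / 3), Qubit.Y} ∧
        Nonempty (Qubit.pointGroup (Qubit.threeBasesD3 θ) ≃* DihedralGroup 3)) ∧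
      (Qubit.UnitaryEquiv (Qubit.threeBasesD3 θ) Qubit.stabilizerBases ↔
        Real.sin θ ^ 2 = 2 / 3) ∧
      (Real.sin θ ^ 2 ≤ 8 / 9 →
        Qubit.Represents (Qubit.weightsD3 θ) (Qubit.vectorsD3 θ) (Qubit.threeBasesD3 θ)) ∧
      (Real.sin θ ^ 2 = 2 / 3 → Qubit.weightsD3 θ = Qubit.weightsStabilizer)) ∧
    -- three bases, second family
    (∀ θ ∈ Set.Ioo 0 (Real.pi / 2), ∀ φ ∈ Set.Ioo 0 Real.pi,
      (Qubit.threeBasesZ2 θ φ).ncard = 3 ∧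
      (Qubit.IsNonneg.{u} (Qubit.threeBasesZ2 θ φ) ↔ |Real.cos φ| ≤ Real.sin θ) ∧
      (φ ≠ Real.pi / 2 → |Real.cos (2 * θ)| ≠ Real.sin θ * |Real.cos φ| →
        Qubit.symmetryGroup (Qubit.threeBasesZ2 θ φ) = Qubit.generated {Qubit.Z} ∧
        Nonempty (Qubit.pointGroup (Qubit.threeBasesZ2 θ φ) ≃* Multiplicative (ZMod 2))) ∧
      (φ ≠ Real.pi / 2 → |Real.cos (2 * θ)| = Real.sin θ * |Real.cos φ| →
        Qubit.generated {Qubit.Z} ≤ Qubit.symmetryGroup (Qubit.threeBasesZ2 θ φ) ∧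
        Nonempty (Qubit.pointGroup (Qubit.threeBasesZ2 θ φ) ≃* DihedralGroup 3)) ∧
      (φ = Real.pi / 2 → θ ≠ Real.pi / 4 →
        Qubit.symmetryGroup (Qubit.threeBasesZ2 θ φ) = Qubit.generated {Qubit.X, Qubit.Z} ∧
        Nonempty (Qubit.pointGroup (Qubit.threeBasesZ2 θ φ) ≃* DihedralGroup 2)) ∧
      (Qubit.UnitaryEquiv (Qubit.threeBasesZ2 θ φ) Qubit.stabilizerBases ↔
        θ = Real.pi / 4 ∧ φ = Real.pi / 2) ∧
      (|Real.cos φ| ≤ Real.sin θ →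
        Qubit.Represents (Qubit.weightsZ2 θ φ) (Qubit.vectorsZ2 θ φ)
          (Qubit.threeBasesZ2 θ φ)) ∧
      (θ = Real.pi / 4 → φ = Real.pi / 2 → Qubit.weightsZ2 θ φ = Qubit.weightsStabilizer)) ∧
    -- the stabilizer states
    (Qubit.symmetryGroup Qubit.stabilizerBases = Qubit.generated {Qubit.hadamard, Qubit.phaseGate} ∧
      Nonempty (Qubit.pointGroup Qubit.stabilizerBases ≃* Equiv.Perm (Fin 4)) ∧
      Qubit.Represents Qubit.weightsStabilizer Qubit.vectorsStabilizer Qubit.stabilizerBases) ∧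
    -- four bases
    (∀ θ ∈ Set.Ioo 0 (Real.pi / 2), ∀ φ ∈ Set.Ioo 0 (Real.pi / 2),
      (Qubit.cuboidBases θ φ).ncard = 4 ∧
      Qubit.generated {Qubit.X, Qubit.Z} ≤ Qubit.symmetryGroup (Qubit.cuboidBases θ φ) ∧
      (Function.Injective (Qubit.cuboidVec θ φ) →
        Qubit.symmetryGroup (Qubit.cuboidBases θ φ) = Qubit.generated {Qubit.X, Qubit.Z} ∧
        Nonempty (Qubit.pointGroup (Qubit.cuboidBases θ φ) ≃* DihedralGroup 2)) ∧
      (¬ Function.Injective (Qubit.cuboidVec θ φ) → ¬ (∀ i j, Qubit.cuboidVec θ φ i =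
          Qubit.cuboidVec θ φ j) →
        Nonempty (Qubit.pointGroup (Qubit.cuboidBases θ φ) ≃* DihedralGroup 4)) ∧
      (φ = Real.pi / 4 → Real.cos θ ≠ 1 / √3 →
        Qubit.symmetryGroup (Qubit.cuboidBases θ φ) = Qubit.generated {Qubit.X, Qubit.phaseGate}) ∧
      (φ = Real.pi / 4 → Real.cos θ = 1 / √3 →
        Qubit.symmetryGroup (Qubit.cuboidBases θ φ) = Qubit.generated {Qubit.hadamard, Qubit.phaseGate} ∧
        Nonempty (Qubit.pointGroup (Qubit.cuboidBases θ φ) ≃* Equiv.Perm (Fin 4))) ∧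
      Qubit.Represents (Qubit.weightsCuboid θ φ) (Qubit.vectorsCuboid θ φ)
        (Qubit.cuboidBases θ φ)) := by
  refine ⟨fun B => ⟨?_, ?_⟩, ⟨Set.ncard_singleton _, Qubit.symmetryGroup_oneBasis,
    Qubit.pointGroup_oneBasis, Qubit.represents_stabilizerBases.mono Qubit.oneBasis_subset⟩,
    fun θ hθ => ⟨Qubit.ncard_twoBases hθ, fun h => ?_, ?_, Qubit.represents_twoBases hθ⟩,
    fun θ hθ => ?_, fun θ hθ φ hφ => ?_,
    ⟨Qubit.symmetryGroup_stabilizerBases,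
      Qubit.pointGroup_of_clifford Qubit.symmetryGroup_stabilizerBases,
      Qubit.represents_stabilizerBases⟩, fun θ hθ φ hφ => ?_⟩
  · rintro ⟨hne, hb, hB, hsym⟩
    rcases Qubit.exhaustive hne hb hB hsym with h | h | h | h
    exacts [Or.inl h, Or.inr (Or.inl h), Or.inr (Or.inr (Or.inr (Or.inl h))),
      Or.inr (Or.inr (Or.inr (Or.inr h)))]
  · have key : ∀ {C : Set (Set Qubit.Op)}, Qubit.UnitaryEquiv B C →
        C.Nonempty ∧ (∀ b ∈ C, Qubit.IsBasis b) ∧ Qubit.IsNonneg.{u} C ∧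
          Qubit.HasNontrivialSymmetry C →
        B.Nonempty ∧ (∀ b ∈ B, Qubit.IsBasis b) ∧ Qubit.IsNonneg.{u} B ∧
          Qubit.HasNontrivialSymmetry B := fun h hC =>
      Qubit.properties_of_unitaryEquiv h hC.1 hC.2.1 hC.2.2.1 hC.2.2.2
    rintro (h | ⟨θ, hθ, h⟩ | ⟨θ, hθ, hs, h⟩ | ⟨θ, hθ, φ, hφ, hc, h⟩ | ⟨θ, hθ, φ, hφ, h⟩)
    exacts [key h Qubit.properties_oneBasis, key h (Qubit.properties_twoBases hθ),
      key h (Qubit.properties_D3 hθ hs), key h (Qubit.properties_Z2 hθ hφ hc),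
      key h (Qubit.properties_cuboidBases hθ hφ)]
  · have hsymm := Qubit.symmetryGroup_twoBases hθ h
    exact ⟨hsymm, Qubit.pointGroup_XZ hsymm⟩
  · rintro rfl
    exact ⟨Qubit.symmetryGroup_twoBases_pi_div_four,
      Qubit.pointGroup_XS Qubit.symmetryGroup_twoBases_pi_div_four⟩
  · have hs := (Real.sin_pos_of_mem_Ioo hθ).ne'
    refine ⟨?_, ⟨fun h => h.sin_sq_le, Qubit.isNonneg_D3 hs⟩, fun h h23 => ?_,
      Qubit.unitaryEquiv_D3_stabilizer_iff hs, Qubit.represents_D3 hs, Qubit.weightsD3_eq⟩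
    · rw [Qubit.threeBasesD3_eq]
      exact Qubit.ncard_image_range (Qubit.vecD3_dot_self θ) fun i j =>
        Qubit.vecD3_dot_sq_lt_one hs
    · have hc : Real.cos θ ≠ 0 := fun h0 => h (Real.injOn_cos ⟨hθ.1.le, hθ.2.le⟩
        ⟨by linarith [Real.pi_pos], by linarith [Real.pi_pos]⟩ (h0.trans Real.cos_pi_div_two.symm))
      have hsymm := Qubit.symmetryGroup_D3 hs hc h23
      exact ⟨hsymm, Qubit.pointGroup_rotZ_Y hsymm⟩
  · refine ⟨?_, ⟨fun h => h.abs_cos_le hθ, Qubit.isNonneg_Z2 hθ hφ⟩, fun h h' => ?_,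
      fun h h' => ⟨Qubit.generated_Z_le_symmetryGroup_Z2 θ φ, ?_⟩, ?_,
      Qubit.unitaryEquiv_Z2_stabilizer_iff hθ hφ, Qubit.represents_Z2 hθ hφ, ?_⟩
    · rw [Qubit.threeBasesZ2_eq]
      exact Qubit.ncard_image_range (Qubit.vecZ2_dot_self θ φ) fun i j =>
        Qubit.vecZ2_dot_sq_lt_one hθ φ
    · have hsymm := Qubit.symmetryGroup_Z2 hθ hφ h h'
      exact ⟨hsymm, Qubit.pointGroup_Z hsymm⟩
    · obtain ⟨η, hη, hne, hequiv⟩ := Qubit.exists_unitaryEquiv_Z2_D3 hθ hφ h h'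
      obtain ⟨e⟩ := hequiv.nonempty_pointGroup_mulEquiv
      obtain ⟨e'⟩ := Qubit.pointGroup_rotZ_Y (Qubit.symmetryGroup_D3 (Qubit.sin_pos_of_mem hη).ne'
        (Qubit.cos_pos_of_mem hη).ne' hne)
      exact ⟨e.trans e'⟩
    · rintro rfl h
      have hsymm := Qubit.symmetryGroup_Z2_pi_div_two hθ h
      exact ⟨hsymm, Qubit.pointGroup_XZ hsymm⟩
    · rintro rfl rfl
      exact Qubit.weightsZ2_pi_div_four
  · have hc := Qubit.cuboidVec_pos hθ hφ
    refine ⟨Qubit.ncard_cuboidBases hθ hφ, ?_, fun h => ?_, fun h h' => ?_, ?_, ?_,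
      Qubit.represents_cuboidBases hθ hφ⟩
    · rw [Qubit.cuboidBases_eq]
      exact Qubit.generated_le_symmetryGroup_cuboid _
    · rw [Qubit.cuboidBases_eq]
      have hsymm := Qubit.symmetryGroup_cuboid_of_injective hc h
      exact ⟨hsymm, Qubit.pointGroup_XZ hsymm⟩
    · rw [Qubit.cuboidBases_eq]
      exact Qubit.pointGroup_cuboid_of_not_injective hc h h'
    · rintro rfl h
      rw [Qubit.cuboidBases_eq]
      exact Qubit.symmetryGroup_cuboid_of_eq_of_ne hc (Qubit.cuboidVec_pi_div_four θ)
        fun h' => h ((Qubit.cuboidVec_pi_div_four_eq_iff hθ).mp h')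
    · rintro rfl h
      rw [Qubit.cuboidBases_eq]
      have hsymm := Qubit.symmetryGroup_cube hc (Qubit.cuboidVec_pi_div_four θ)
        ((Qubit.cuboidVec_pi_div_four_eq_iff hθ).mpr h)
      exact ⟨hsymm, Qubit.pointGroup_of_clifford hsymm⟩
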